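/- Let $M$ be a toric Fano manifold of complex dimension $n$ with compact torus $G_0=(S^1)^n$, open dense orbit $(\mathbb C^*)^n$ with coordinates $w_1,\dots,w_n$, and anticanonical moment polytope $P=\{x\in\mathbb R^n:\langle x,\ell_i\rangle\le 1,\ i=1,\dots,d\}$, where $\ell_1,\dots,\ell_d\in\mathbb Z^n$ are the primitive outer normals of the facets; $P$ is bounded and at each vertex the normals of the adjacent facets form a $\mathbb Z$-basis of $\mathbb Z^n$. Let $\omega_g\in 2\pi c_1(M)$ be a $G_0$-invariant Kähler form, written as the curvature form of a $G_0$-invariant Hermitian metric $\|\cdot\|$ on $-K_M$; put $\varphi_0=-\log\|w_1\partial_{w_1}\wedge\dots\wedge w_n\partial_{w_n}\|^2$, so that $\omega_g=\sqrt{-1}\,\partial\bar\partial\varphi_0$ on the open orbit and $\varphi_0$ is a function of $\xi\in\mathbb R^n$, $\xi_j=\log|w_j|^2$. Let $\theta_1,\dots,\theta_n\in\mathbb R$, $X=\sum_j\theta_jw_j\partial_{w_j}$ (for instance the soliton vector field) and $\theta(x)=\sum_j\theta_jx_j$. Let $\mathcal H_{G_0}(\omega_g)$ be the set of smooth $G_0$-invariant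 functions $\phi$ on $M$ with $\omega_\phi=\omega_g+\sqrt{-1}\,\partial\bar\partial\phi>0$. For such $\phi$ let $h_\phi$ be a smooth real function with $\mathrm{Ric}(\omega_\phi)-\omega_\phi=\sqrt{-1}\,\partial\bar\partial h_\phi$ (unique up to a constant), $\theta_X(\omega_\phi)$ the smooth real function with $i_X\omega_\phi=\sqrt{-1}\,\bar\partial\theta_X(\omega_\phi)$ and $\int_M\theta_X(\omega_\phi)e^{h_\phi}\frac{\omega_\phi^n}{n!}=0$, and $S(\phi)=\mathrm{tr}_{\omega_\phi}\mathrm{Ric}(\omega_\phi)$. With $V=\int_M\frac{\omega_g^n}{n!}$, the modified K-energy is $$\mu_{\omega_g}(\phi)=-\frac1V\int_0^1\!\!\int_M\dot\phi_t\Big[S(\phi_t)-n-\mathrm{tr}_{\omega_{\phi_t}}(\nabla_{\omega_{\phi_t}}X)+X\big(h_{\phi_t}-\theta_X(\omega_{\phi_t})\big)\Big]e^{\theta_X(\omega_{\phi_t})}\frac{\omega_{\phi_t}^n}{n!}\,dt,$$ where $\phi_t$, $0\le t\le1$, is a smooth path in $\mathcal H_{G_0}(\omega_g)$ from $0$ to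 $\phi$. For $\phi\in\mathcal H_{G_0}(\omega_g)$ let $u(x)=\sup_{\xi\in\mathbb R^n}\big(\langle\xi,x\rangle-(\varphi_0+\phi)(\xi)\big)$, $x\in P$, be the Legendre dual function of $\varphi_0+\phi$, and let $$\mathcal F(u)=-\int_P\log\det(u_{ij})\,e^{\theta(x)}\,dx+\mathcal L(u),\qquad \mathcal L(u)=\int_{\partial P}u\,e^{\theta(x)}\,d\sigma-\int_P(n+\theta(x))\,e^{\theta(x)}u\,dx,$$ where $d\sigma=\langle\vec n,x\rangle\,d\sigma_0$, $\vec n$ is the unit outer normal of $\partial P$ and $d\sigma_0$ the Lebesgue measure on $\partial P$. Then there is a constant $C$, independent of $\phi$, such that for every $\phi\in\mathcal H_{G_0}(\omega_g)$ the integrals in $\mathcal F(u)$ converge absolutely and, for every choice of the path $\phi_t$, $$\mu_{\omega_g}(\phi)=\frac{(2\pi)^n}{V}\,\mathcal F(u)+C .$$ -/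

import Mathlib

open MeasureTheory
open scoped ComplexOrder

noncomputable section

/-! ## Complex differential calculus in a coordinate space `ℂ^N` -/

namespace ToricKahler

variable {N : Type*} [Fintype N] [DecidableEq N]

/-- The Wirtinger derivative `∂f/∂z_a = (∂f/∂x_a - √-1 ∂f/∂y_a)/2`. -/
def dz (f : (N → ℂ) → ℂ) (a : N) (z : N → ℂ) : ℂ :=
  (fderiv ℝ f z (Pi.single a 1) - Complex.I * fderiv ℝ f z (Pi.single a Complex.I)) / 2

/-- The Wirtinger derivative `∂f/∂z̄_a = (∂f/∂x_a + √-1 ∂f/∂y_a)/2`. -/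
def dzbar (f : (N → ℂ) → ℂ) (a : N) (z : N → ℂ) : ℂ :=
  (fderiv ℝ f z (Pi.single a 1) + Complex.I * fderiv ℝ f z (Pi.single a Complex.I)) / 2

/-- The matrix `(∂²ψ/∂z_a∂z̄_b)`, i.e. the coefficients of the real `(1,1)`-form
`√-1 ∂∂̄ψ = √-1 ∑ ψ_{a b̄} dz_a ∧ dz̄_b`. -/
def complexHessian (ψ : (N → ℂ) → ℝ) (z : N → ℂ) : Matrix N N ℂ :=
  Matrix.of fun a b => dz (dzbar (fun y => (ψ y : ℂ)) b) a z

/-! The following notions refer to a Kähler form `ω = √-1 ∑ g_{a b̄} dz_a ∧ dz̄_b`. -/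

/-- The density of `ω^n/n! = det(g_{a b̄}) ∏ (√-1 dz_a ∧ dz̄_a)` with respect to Lebesgue
measure. -/
def volumeDensity (g : (N → ℂ) → Matrix N N ℂ) (z : N → ℂ) : ℝ :=
  2 ^ Fintype.card N * (g z).det.re

/-- The Ricci form `Ric(ω) = -√-1 ∂∂̄ log det(g_{a b̄})`. -/
def ricci (g : (N → ℂ) → Matrix N N ℂ) (z : N → ℂ) : Matrix N N ℂ :=
  -complexHessian (fun y => Real.log (g y).det.re) z

/-- The scalar curvature `S = g^{a b̄} R_{a b̄}` (trace of the Ricci form with respect to `ω`). -/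
def scalarCurvature (g : (N → ℂ) → Matrix N N ℂ) (z : N → ℂ) : ℂ :=
  ((g z)⁻¹ * ricci g z).trace

/-- The Christoffel symbols `Γ^c_{ab} = ∑_e g^{c ē} ∂_a g_{b ē}` of the Levi-Civita (= Chern)
connection of `ω`. -/
def christoffel (g : (N → ℂ) → Matrix N N ℂ) (c a b : N) (z : N → ℂ) : ℂ :=
  ∑ e, dz (fun y => g y b e) a z * (g z)⁻¹ e c

/-- `tr(∇X) = ∑_a ∇_a X^a` for a holomorphic vector field `X = ∑ X^a ∂/∂z_a`. -/
def traceNabla (g : (N → ℂ) → Matrix N N ℂ) (X : (N → ℂ) → N → ℂ) (z : N → ℂ) : ℂ :=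
  ∑ a, (dz (fun y => X y a) a z + ∑ b, christoffel g a a b z * X z b)

/-- `X(f) = ∑ X^a ∂f/∂z_a`. -/
def applyField (X : (N → ℂ) → N → ℂ) (f : (N → ℂ) → ℂ) (z : N → ℂ) : ℂ :=
  ∑ a, X z a * dz f a z

end ToricKahler

/-! ## Toric Fano manifolds -/

/-- A smooth Fano polytope `P = {x ∈ ℝⁿ : ⟨x, ℓ_i⟩ ≤ 1, i = 1, …, d}`: it is bounded, each of the
`d` integral outer normals `ℓ_i` defines a facet, and at each vertex the normals of the facets
through it form a `ℤ`-basis of `ℤⁿ`. These polytopes classify toric Fano manifolds. -/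
structure FanoPolytope (n d : ℕ) where
  normal : Fin d → Fin n → ℤ
  bounded : Bornology.IsBounded
    {x : EuclideanSpace ℝ (Fin n) | ∀ i, ∑ j, x j * (normal i j : ℝ) ≤ 1}
  facet : ∀ i, ∃ x : EuclideanSpace ℝ (Fin n),
    ∑ j, x j * (normal i j : ℝ) = 1 ∧ ∀ k, k ≠ i → ∑ j, x j * (normal k j : ℝ) < 1
  smooth : ∀ v ∈ Set.extremePoints ℝ
      {x : EuclideanSpace ℝ (Fin n) | ∀ i, ∑ j, x j * (normal i j : ℝ) ≤ 1},
    LinearIndependent ℤ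
      (fun a : {i : Fin d // ∑ j, v j * (normal i j : ℝ) = 1} => normal a.1) ∧
    Submodule.span ℤ
      (Set.range fun a : {i : Fin d // ∑ j, v j * (normal i j : ℝ) = 1} => normal a.1) = ⊤

namespace FanoPolytope

open ToricKahler

variable {n d : ℕ} (P : FanoPolytope n d)

/-- The (closed) polytope. -/
def body : Set (EuclideanSpace ℝ (Fin n)) :=
  {x | ∀ i, ∑ j, x j * (P.normal i j : ℝ) ≤ 1}

/-- The closed facet `P ∩ {⟨x, ℓ_i⟩ = 1}`. -/
def face (i : Fin d) : Set (EuclideanSpace ℝ (Fin n)) :=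
  {x | x ∈ P.body ∧ ∑ j, x j * (P.normal i j : ℝ) = 1}

/-- The unit outer normal of the `i`-th facet. -/
def unitNormal (i : Fin d) : EuclideanSpace ℝ (Fin n) :=
  let l : EuclideanSpace ℝ (Fin n) := WithLp.toLp 2 fun j => (P.normal i j : ℝ)
  ‖l‖⁻¹ • l

/-- The vertices of the polytope. -/
abbrev Vertex : Type := {v : EuclideanSpace ℝ (Fin n) // v ∈ Set.extremePoints ℝ P.body}

/-- The facets through the vertex `v`. -/
abbrev Active (v : P.Vertex) : Type := {i : Fin d // ∑ j, v.1 j * (P.normal i j : ℝ) = 1}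

theorem nonempty_vertex : Nonempty P.Vertex := by
  have hcl : IsClosed P.body := by
    have : P.body = ⋂ i, {x | ∑ j, x j * (P.normal i j : ℝ) ≤ 1} := by
      ext x; simp [body]
    rw [this]
    exact isClosed_iInter fun i => isClosed_le (by fun_prop) continuous_const
  have hc : IsCompact P.body := Metric.isCompact_of_isClosed_isBounded hcl P.bounded
  have h0 : P.body.Nonempty := ⟨0, fun i => by simp⟩
  obtain ⟨v, hv⟩ := hc.extremePoints_nonempty h0
  exact ⟨⟨v, hv⟩⟩

/-- The `ℤ`-basis `(ℓ_a)` of `ℤⁿ` formed by the normals at the vertex `v`. -/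
def normalBasis (v : P.Vertex) : Module.Basis (P.Active v) ℤ (Fin n → ℤ) :=
  Module.Basis.mk (P.smooth v.1 v.2).1 (P.smooth v.1 v.2).2.ge

/-- The primitive edge vectors `e_a` of `P` at the vertex `v`, determined by
`⟨e_a, ℓ_b⟩ = -δ_{ab}`; they form a `ℤ`-basis of `ℤⁿ`. -/
def edge (v : P.Vertex) (a : P.Active v) (j : Fin n) : ℤ :=
  -((P.normalBasis v).repr (Pi.single j 1) a)

/-- The points of `ℂ^d` that are homogeneous coordinates of a point of the toric manifold: the
facets whose coordinate vanishes have a vertex in common. -/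
def CoxDomain : Type :=
  {x : Fin d → ℂ // ∃ v : P.Vertex, ∀ i, x i = 0 → ∑ j, v.1 j * (P.normal i j : ℝ) = 1}

/-- Two systems of homogeneous coordinates agree up to the group
`{t ∈ (ℂ^*)^d : ∏ t_i^{ℓ_i} = 1}`. -/
def coxSetoid : Setoid P.CoxDomain where
  r x y := ∃ t : Fin d → ℂˣ, (∀ j, ∏ i, t i ^ P.normal i j = 1) ∧ ∀ i, y.1 i = t i * x.1 i
  iseqv :=
    { refl := fun x => ⟨1, by simp, by simp⟩
      symm := by
        rintro x y ⟨t, ht, hxy⟩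
        refine ⟨t⁻¹, fun j => ?_, fun i => ?_⟩
        · simp [ht j]
        · simp [hxy i]
      trans := by
        rintro x y z ⟨t, ht, hxy⟩ ⟨s, hs, hyz⟩
        refine ⟨s * t, fun j => ?_, fun i => ?_⟩
        · simp [mul_zpow, Finset.prod_mul_distrib, ht j, hs j]
        · simp [hxy i, hyz i, mul_assoc] }

/-- The toric Fano manifold `M` with moment polytope `P` (anticanonically polarized), as the
quotient of `CoxDomain` by `{t ∈ (ℂ^*)^d : ∏ t_i^{ℓ_i} = 1}`. -/
def Manifold : Type := Quotient P.coxSetoid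

/-- The affine holomorphic chart (parametrization) `ℂⁿ → M` belonging to the vertex `v`: all
homogeneous coordinates that belong to facets not through `v` are normalized to `1`. These charts
are injective and form the holomorphic atlas of `M`. -/
def chart (v : P.Vertex) (y : P.Active v → ℂ) : P.Manifold :=
  Quotient.mk P.coxSetoid
    ⟨fun i => if h : ∑ j, v.1 j * (P.normal i j : ℝ) = 1 then y ⟨i, h⟩ else 1, v, fun i hi => by
      by_contra h
      simp [h] at hi⟩

/-- The coordinates `y_a = w^{e_a}` in the chart of `v` of the point of the open orbit with
coordinates `w ∈ (ℂ^*)ⁿ`. -/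
def monomial (v : P.Vertex) (w : Fin n → ℂ) (a : P.Active v) : ℂ :=
  ∏ j, w j ^ P.edge v a j

/-- The open dense orbit `(ℂ^*)ⁿ → M` in its coordinates `(w_1, …, w_n)`. (The point does not
depend on the vertex that is used.) -/
def orbit (w : Fin n → ℂ) : P.Manifold :=
  P.chart P.nonempty_vertex.some (P.monomial _ w)

/-- The torus `(ℂ^*)ⁿ` as a subset of `ℂⁿ`. -/
def torus (n : ℕ) : Set (Fin n → ℂ) := {w | ∀ j, w j ≠ 0}

/-- The affine logarithmic coordinates `ξ_j = log |w_j|²` on the open orbit: the point with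
`w_j = exp (ξ_j / 2)`. -/
def logPoint (ξ : EuclideanSpace ℝ (Fin n)) : P.Manifold :=
  P.orbit fun j => (Real.exp (ξ j / 2) : ℂ)

/-- The action of `G₀ = (S¹)ⁿ`, `w_j ↦ s_j w_j`, in the chart of `v`. -/
def rotate (v : P.Vertex) (s : Fin n → Circle) (y : P.Active v → ℂ) : P.Active v → ℂ :=
  fun a => P.monomial v (fun j => (s j : ℂ)) a * y a

/-- Smooth functions on `M`. -/
def IsSmooth (f : P.Manifold → ℝ) : Prop :=
  ∀ v, ContDiff ℝ (⊤ : ℕ∞) fun y => f (P.chart v y)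

/-- Invariance under the compact torus `G₀ = (S¹)ⁿ`. -/
def IsTorusInvariant (f : P.Manifold → ℝ) : Prop :=
  ∀ v s y, f (P.chart v (P.rotate v s y)) = f (P.chart v y)

/-- A `G₀`-invariant Kähler form `ω_g ∈ 2π c₁(M)`, given as the curvature form of a smooth
`G₀`-invariant Hermitian metric `‖·‖` on `-K_M`. In the chart of `v`, the local weight is
`weight v = -log ‖∂_{y_1} ∧ ⋯ ∧ ∂_{y_n}‖²`, and `ω_g = √-1 ∂∂̄ (weight v)`. On the open orbit `-K_M` is
trivialized by `w_1 ∂_{w_1} ∧ ⋯ ∧ w_n ∂_{w_n} = ± ∏ y_a · ∂_{y_1} ∧ ⋯ ∧ ∂_{y_n}`, and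
`pot = -log ‖w_1 ∂_{w_1} ∧ ⋯ ∧ w_n ∂_{w_n}‖²` is the potential `φ₀` of `ω_g` there. -/
structure KahlerMetric where
  pot : P.Manifold → ℝ
  weight : ∀ v : P.Vertex, (P.Active v → ℂ) → ℝ
  weight_smooth : ∀ v, ContDiff ℝ (⊤ : ℕ∞) (weight v)
  weight_eq : ∀ v y, (∀ a, y a ≠ 0) →
    weight v y = pot (P.chart v y) + ∑ a, Real.log (‖y a‖ ^ 2)
  invariant : ∀ v s y, weight v (P.rotate v s y) = weight v y
  positive : ∀ v y, (complexHessian (weight v) y).PosDef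

variable {P}

/-- The set `H_{G₀}(ω_g)` of `G₀`-invariant Kähler potentials: smooth `G₀`-invariant functions `φ` on
`M` such that `ω_φ = ω_g + √-1 ∂∂̄φ` is positive. -/
def IsKahlerPotential (g : P.KahlerMetric) (φ : P.Manifold → ℝ) : Prop :=
  P.IsSmooth φ ∧ P.IsTorusInvariant φ ∧
    ∀ v y, (complexHessian (fun z => g.weight v z + φ (P.chart v z)) y).PosDef

/-- The coefficients of `ω_φ` in the coordinates `w` of the open orbit. -/
def orbitMetric (g : P.KahlerMetric) (φ : P.Manifold → ℝ) (w : Fin n → ℂ) :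
    Matrix (Fin n) (Fin n) ℂ :=
  complexHessian (fun w => g.pot (P.orbit w) + φ (P.orbit w)) w

/-- The holomorphic vector field `X = ∑ θ_j w_j ∂/∂w_j` in the coordinates of the open orbit. -/
def toricField (θ : Fin n → ℝ) (w : Fin n → ℂ) (j : Fin n) : ℂ := θ j * w j

/-- `∫_M F ω_φ^n/n!`, for a function `F` given on the open orbit (whose complement, a union of
divisors, is a null set). -/
def integralM (g : P.KahlerMetric) (φ : P.Manifold → ℝ) (F : (Fin n → ℂ) → ℂ) : ℂ :=
  ∫ w in torus n, F w * (volumeDensity (orbitMetric g φ) w : ℂ)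

/-- The volume `V = ∫_M ω_g^n/n!`. -/
def vol (g : P.KahlerMetric) : ℝ :=
  ∫ w in torus n, volumeDensity (orbitMetric g 0) w

/-- `h` is a Ricci potential of `ω_φ`: `Ric(ω_φ) - ω_φ = √-1 ∂∂̄h` (on the open dense orbit, hence
everywhere on `M`). -/
def IsRicciPotential (g : P.KahlerMetric) (φ h : P.Manifold → ℝ) : Prop :=
  P.IsSmooth h ∧ ∀ w ∈ torus n,
    ricci (orbitMetric g φ) w - orbitMetric g φ w = complexHessian (fun w => h (P.orbit w)) w

/-- `Θ = θ_X(ω_φ)` is the potential of `X` with respect to `ω_φ`: `i_X ω_φ = √-1 ∂̄Θ` (on the open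
dense orbit, hence everywhere on `M`), normalized by `∫_M Θ e^h ω_φ^n/n! = 0`, where `h` is a Ricci
potential of `ω_φ`. -/
def IsFieldPotential (g : P.KahlerMetric) (θ : Fin n → ℝ) (φ h Θ : P.Manifold → ℝ) : Prop :=
  P.IsSmooth Θ ∧
  (∀ w ∈ torus n, ∀ b, ∑ a, toricField θ w a * orbitMetric g φ w a b =
    dzbar (fun w => (Θ (P.orbit w) : ℂ)) b w) ∧
  integralM g φ (fun w => (Θ (P.orbit w) * Real.exp (h (P.orbit w)) : ℝ)) = 0

/-- A smooth path `φ_t`, `0 ≤ t ≤ 1`, in `H_{G₀}(ω_g)` from `0` to `φ`. -/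
def IsPotentialPath (g : P.KahlerMetric) (φ : P.Manifold → ℝ) (path : ℝ → P.Manifold → ℝ) : Prop :=
  (∀ v, ContDiffOn ℝ (⊤ : ℕ∞) (fun q : ℝ × (P.Active v → ℂ) => path q.1 (P.chart v q.2))
    (Set.Icc 0 1 ×ˢ Set.univ)) ∧
  (∀ t ∈ Set.Icc (0 : ℝ) 1, IsKahlerPotential g (path t)) ∧ path 0 = 0 ∧ path 1 = φ

/-- The modified K-energy, evaluated along a path `φ_t` of Kähler potentials with Ricci potentials
`h_t` and potentials `Θ_t = θ_X(ω_{φ_t})`: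
`-(1/V) ∫₀¹ ∫_M φ̇_t [S(φ_t) - n - tr(∇X) + X(h_t - Θ_t)] e^{Θ_t} ω_{φ_t}^n/n! dt`. -/
def modifiedKEnergy (g : P.KahlerMetric) (θ : Fin n → ℝ) (path h Θ : ℝ → P.Manifold → ℝ) : ℂ :=
  -(1 / (vol g : ℂ)) * ∫ t in (0 : ℝ)..1, integralM g (path t) fun w =>
    (deriv (fun s => path s (P.orbit w)) t : ℂ) *
      (scalarCurvature (orbitMetric g (path t)) w - n
        - traceNabla (orbitMetric g (path t)) (toricField θ) w
        + applyField (toricField θ)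
            (fun w => ((h t (P.orbit w) - Θ t (P.orbit w) : ℝ) : ℂ)) w) *
      (Real.exp (Θ t (P.orbit w)) : ℂ)

/-- The potential `φ₀ + φ` of `ω_φ` as a function of the logarithmic coordinates `ξ ∈ ℝⁿ`. -/
def logPotential (g : P.KahlerMetric) (φ : P.Manifold → ℝ) (ξ : EuclideanSpace ℝ (Fin n)) : ℝ :=
  g.pot (P.logPoint ξ) + φ (P.logPoint ξ)

end FanoPolytope

/-! ## The reduced functional on the polytope -/

/-- The Legendre dual function `u(x) = sup_ξ (⟨ξ, x⟩ - f(ξ))`. For a smooth strictly convex `f` it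
takes the value `⟨ξ, Df(ξ)⟩ - f(ξ)` at `x = Df(ξ)`. -/
def legendreDual {n : ℕ} (f : EuclideanSpace ℝ (Fin n) → ℝ) (x : EuclideanSpace ℝ (Fin n)) : ℝ :=
  ⨆ ξ : EuclideanSpace ℝ (Fin n), (∑ j, ξ j * x j - f ξ)

/-- The Hessian matrix `(u_ij)`. -/
def realHessian {n : ℕ} (u : EuclideanSpace ℝ (Fin n) → ℝ) (x : EuclideanSpace ℝ (Fin n)) :
    Matrix (Fin n) (Fin n) ℝ :=
  Matrix.of fun i j =>
    fderiv ℝ (fun y => fderiv ℝ u y (EuclideanSpace.single j 1)) x (EuclideanSpace.single i 1)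

/-- The linear function `θ(x) = ∑ θ_j x_j`. -/
def linearForm {n : ℕ} (θ : Fin n → ℝ) (x : EuclideanSpace ℝ (Fin n)) : ℝ := ∑ j, θ j * x j

namespace FanoPolytope

variable {n d : ℕ} (P : FanoPolytope n d)

/-- `L(u) = ∫_{∂P} u e^θ dσ - ∫_P (n + θ) e^θ u dx`, where `dσ = ⟨ν, x⟩ dσ₀`, `ν` is the unit outer
normal and `dσ₀` the Lebesgue measure of `∂P` (which is the union of the facets). -/
def linearPart (θ : Fin n → ℝ) (u : EuclideanSpace ℝ (Fin n) → ℝ) : ℝ :=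
  (∑ i, ∫ x in P.face i, u x * Real.exp (linearForm θ x) * inner ℝ (P.unitNormal i) x ∂μHE[n - 1])
    - ∫ x in P.body, (n + linearForm θ x) * Real.exp (linearForm θ x) * u x

/-- `F(u) = -∫_P log det(u_ij) e^θ dx + L(u)`. -/
def reducedFunctional (θ : Fin n → ℝ) (u : EuclideanSpace ℝ (Fin n) → ℝ) : ℝ :=
  -(∫ x in P.body, Real.log (realHessian u x).det * Real.exp (linearForm θ x)) + P.linearPart θ u

end FanoPolytope

end

open MeasureTheory
open scoped ComplexOrder

noncomputable section

/-! ## Directional derivatives of smooth functions -/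

namespace SmoothCalculus

set_option linter.unusedSectionVars false

variable {X : Type*} [NormedAddCommGroup X] [NormedSpace ℝ X]

/-! On the open orbit every torus-invariant object is a function of ξ = log|w|². Let f = φ₀ + φ
there. Then ω_φ has coefficients f_ab / (w_a w̄_b), and the K-energy becomes real analysis on ℝⁿ.
The Ricci potential is h = -log det D²f - f up to a constant, the field potential is Θ = θ(Df), the
measure e^Θ ω_φⁿ/n! becomes (2π)ⁿ ρ dξ with ρ = det(D²f) e^{θ(Df)}, and the bracket in the K-energy
is the weighted Laplacian f^{ij} k_ij + θ^i k_i of k = h - Θ (`IsLogMetric.bracket`). The potential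
h is identified by Liouville's theorem for bounded pluriharmonic functions on (ℂ^*)ⁿ. The constant
in Θ is fixed by its normalization, which reads ∫ Θ e^{-f} dξ = 0 and holds for θ(Df) because the
gradient of e^{-f} integrates to zero.

Both sides of the theorem are then compared with the single functional E(f) = ∫ (log det D²f + ⟨ξ,
Df⟩) ρ dξ, called `entropyIntegral`.

Variation of E. Write A = log det D²f + ⟨ξ, Df⟩ and ψ for the time derivative of f. Pointwise, the
time derivative of Aρ is -ψ (weighted Laplacian of k) ρ plus the divergence of ρ times the vector
field dual to (A + 1) dψ + ψ dk (`entropy_variation`). The divergence integrates to zero because all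
terms decay exponentially (`integral_sub_eq_of_conservation`). The decay comes from the
compactification: in the logarithmic coordinates η of the chart at a vertex, f + ∑ η_a is a smooth
function of r_a = e^{η_a/2}, the density ρ carries the factor ∏ r_a², the metric gradient and the
Laplacian have only simple poles in the r_a, and one factor ∏ r_a absorbs them. The other factor
decays like e^{-c|ξ|} on the cone η ≤ 0, and these cones cover ℝⁿ because the normal fan is
complete. Hence the K-energy is (2π)ⁿ/V (E(f) - E(φ₀)) for every path (`modifiedKEnergy_eq`).

Legendre duality. The gradient map x = Df(ξ) is a diffeomorphism onto the interior of P, with Du = ξ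
and D²u = (D²f)⁻¹ at the image point. Substituting it turns E(f) into -∫ log det(u_ij) e^θ + ∫ ⟨x,
Du⟩ e^θ over P (`reducedFunctional_eq`). The second integral is L(u): integrate the derivative of sⁿ
e^{sθ(y)} u(sy) along the rays from the origin to the points y of the facets (`linearPart_eq`). All
facets lie at height one, so the Jacobian of the cone over the i-th facet is 1/|ℓ_i|, which is the
density ⟨ν, x⟩ of dσ. At the boundary only the continuity of u along rays is needed. -/

/-- The derivative of `F` in the direction `v`. -/
def dirDeriv (v : X) (F : X → ℝ) (p : X) : ℝ := fderiv ℝ F p v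

/-- Infinitely differentiable real functions. -/
abbrev Smooth (F : X → ℝ) : Prop := ContDiff ℝ (⊤ : ℕ∞) F

theorem Smooth.diff {F : X → ℝ} (hF : Smooth F) (p : X) : DifferentiableAt ℝ F p :=
  (hF.differentiable (by simp)) p

theorem Smooth.dirDeriv {F : X → ℝ} (hF : Smooth F) (v : X) : Smooth (dirDeriv v F) :=
  (hF.fderiv_right (m := (⊤ : ℕ∞)) (by simp)).clm_apply contDiff_const

theorem dirDeriv_add {F G : X → ℝ} (hF : Smooth F) (hG : Smooth G) (v p : X) :
    dirDeriv v (fun q => F q + G q) p = dirDeriv v F p + dirDeriv v G p := by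
  simp [dirDeriv, fderiv_fun_add (hF.diff p) (hG.diff p)]

theorem dirDeriv_sub {F G : X → ℝ} (hF : Smooth F) (hG : Smooth G) (v p : X) :
    dirDeriv v (fun q => F q - G q) p = dirDeriv v F p - dirDeriv v G p := by
  simp [dirDeriv, fderiv_fun_sub (hF.diff p) (hG.diff p)]

theorem dirDeriv_neg {F : X → ℝ} (v p : X) :
    dirDeriv v (fun q => -F q) p = -dirDeriv v F p := by
  simp [dirDeriv, fderiv_fun_neg]

theorem dirDeriv_mul {F G : X → ℝ} (hF : Smooth F) (hG : Smooth G) (v p : X) :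
    dirDeriv v (fun q => F q * G q) p = dirDeriv v F p * G p + F p * dirDeriv v G p := by
  simp [dirDeriv, fderiv_fun_mul (hF.diff p) (hG.diff p)]
  ring

theorem dirDeriv_const (c : ℝ) (v p : X) : dirDeriv v (fun _ => c) p = 0 := by
  simp [dirDeriv]

theorem dirDeriv_const_mul {F : X → ℝ} (hF : Smooth F) (c : ℝ) (v p : X) :
    dirDeriv v (fun q => c * F q) p = c * dirDeriv v F p := by
  rw [dirDeriv_mul contDiff_const hF, dirDeriv_const]; ring

theorem dirDeriv_sum {ι : Type*} (s : Finset ι) {F : ι → X → ℝ} (hF : ∀ i, Smooth (F i)) (v p : X) :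
    dirDeriv v (fun q => ∑ i ∈ s, F i q) p = ∑ i ∈ s, dirDeriv v (F i) p := by
  simp [dirDeriv, fderiv_fun_sum (fun i _ => (hF i).diff p)]

theorem dirDeriv_exp {F : X → ℝ} (hF : Smooth F) (v p : X) :
    dirDeriv v (fun q => Real.exp (F q)) p = Real.exp (F p) * dirDeriv v F p := by
  simp [dirDeriv, fderiv_exp (hF.diff p)]

theorem dirDeriv_log {F : X → ℝ} (hF : Smooth F) (v p : X) (hp : F p ≠ 0) :
    dirDeriv v (fun q => Real.log (F q)) p = (F p)⁻¹ * dirDeriv v F p := by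
  simp [dirDeriv, fderiv.log (hF.diff p) hp]

theorem dirDeriv_comm {F : X → ℝ} (hF : Smooth F) (v w p : X) :
    dirDeriv v (dirDeriv w F) p = dirDeriv w (dirDeriv v F) p := by
  have h : IsSymmSndFDerivAt ℝ F p :=
    hF.contDiffAt.isSymmSndFDerivAt (by simpa using WithTop.coe_le_coe.2 (le_top (a := (2 : ℕ∞))))
  have hd : DifferentiableAt ℝ (fderiv ℝ F) p :=
    ((hF.fderiv_right (m := (⊤ : ℕ∞)) (by simp)).differentiable (by simp)) p
  have key : ∀ a b : X, dirDeriv a (dirDeriv b F) p = fderiv ℝ (fderiv ℝ F) p a b := by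
    intro a b
    have : dirDeriv b F = fun q => fderiv ℝ F q b := rfl
    rw [dirDeriv, this, fderiv_clm_apply hd (differentiableAt_const b)]
    simp
  rw [key, key, h.eq]

/-! ### Determinants, inverses and Hessians depending smoothly on a point. -/

section Matrix

variable {ι : Type*} [Fintype ι] [DecidableEq ι]

/-- The entries of a matrix-valued function are smooth. -/
abbrev SmoothMat (M : X → Matrix ι ι ℝ) : Prop := ∀ i j, Smooth fun p => M p i j

theorem SmoothMat.det {M : X → Matrix ι ι ℝ} (hM : SmoothMat M) : Smooth fun p => (M p).det := by
  simp only [Matrix.det_apply]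
  exact ContDiff.sum fun σ _ => (contDiff_prod fun i _ => hM _ _).const_smul _

theorem SmoothMat.adjugate {M : X → Matrix ι ι ℝ} (hM : SmoothMat M) :
    SmoothMat fun p => (M p).adjugate := by
  intro i j
  simp only [Matrix.adjugate_apply]
  refine SmoothMat.det (M := fun p => (M p).updateRow j (Pi.single i 1)) fun a b => ?_
  by_cases h : a = j
  · subst h; simpa using contDiff_const
  · simpa [Matrix.updateRow_ne h] using hM a b

theorem SmoothMat.inv {M : X → Matrix ι ι ℝ} (hM : SmoothMat M) (h : ∀ p, (M p).det ≠ 0) :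
    SmoothMat fun p => (M p)⁻¹ := by
  intro i j
  have : (fun p => (M p)⁻¹ i j) = fun p => ((M p).det)⁻¹ * (M p).adjugate i j := by
    ext p; simp [Matrix.inv_def]
  rw [this]
  exact (hM.det.inv h).mul (hM.adjugate i j)

/-- Jacobi's formula. The determinant is affine in each single entry with the cofactor as slope, so
its differential on matrix units is read off along a line; the chain rule through the entries does
the rest. -/
theorem dirDeriv_det {M : X → Matrix ι ι ℝ} (hM : SmoothMat M) (v p : X) :
    dirDeriv v (fun q => (M q).det) p =
      ∑ i, ∑ j, (M p).adjugate j i * dirDeriv v (fun q => M q i j) p := by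
  let dt : (ι → ι → ℝ) → ℝ := fun Z => (Matrix.of Z).det
  have hdt : Smooth dt := SmoothMat.det (M := fun Z : ι → ι → ℝ => Matrix.of Z) fun i j => by
    simpa using contDiff_apply_apply (n := (⊤ : ℕ∞)) ℝ ℝ i j
  have hentry : ∀ (Z : ι → ι → ℝ) (i j : ι),
      fderiv ℝ dt Z (Pi.single i (Pi.single j 1)) = (Matrix.of Z).adjugate j i := by
    intro Z i j
    have h1 := ((hdt.diff Z).hasFDerivAt.hasLineDerivAt
      (Pi.single i (Pi.single j 1) : ι → ι → ℝ)).deriv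
    rw [← h1]
    have h2 : (fun t : ℝ => dt (Z + t • (Pi.single i (Pi.single j 1) : ι → ι → ℝ))) =
        fun t => dt Z + t * (Matrix.of Z).adjugate j i := by
      ext t
      have : Matrix.of (Z + t • (Pi.single i (Pi.single j 1) : ι → ι → ℝ)) =
          (Matrix.of Z).updateRow i ((Matrix.of Z) i + t • (Pi.single j 1 : ι → ℝ)) := by
        ext a b
        by_cases ha : a = i
        · subst ha; simp
        · simp [ha]
      simp only [dt]
      rw [this, Matrix.det_updateRow_add, Matrix.det_updateRow_smul, Matrix.updateRow_eq_self,
        Matrix.adjugate_apply]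
    rw [h2]
    simp
  have hMd : DifferentiableAt ℝ (fun q => fun i j => M q i j) p :=
    differentiableAt_pi.2 fun i => differentiableAt_pi.2 fun j => (hM i j).diff p
  have hc : (fun q => (M q).det) = dt ∘ fun q => fun i j => M q i j := rfl
  rw [dirDeriv, hc, fderiv_comp p (hdt.diff _) hMd]
  have hdec : (fderiv ℝ (fun q => fun i j => M q i j) p) v =
      ∑ i, ∑ j, dirDeriv v (fun q => M q i j) p • Pi.single i (Pi.single j (1 : ℝ)) := by
    ext a b
    have hMd' : ∀ i, DifferentiableAt ℝ (fun q => fun j => M q i j) p :=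
      fun i => differentiableAt_pi.2 fun j => (hM i j).diff p
    rw [fderiv_pi hMd']
    simp only [ContinuousLinearMap.coe_pi']
    rw [fderiv_pi fun j => (hM a j).diff p]
    simp [Finset.sum_apply, Pi.single_apply, dirDeriv]
    simp [Finset.sum_apply, Pi.single_apply, apply_ite, ite_apply]
  rw [ContinuousLinearMap.comp_apply, hdec]
  simp only [map_sum, map_smul, hentry, smul_eq_mul]
  refine Finset.sum_congr rfl fun i _ => Finset.sum_congr rfl fun j _ => mul_comm _ _

theorem dirDeriv_log_det {M : X → Matrix ι ι ℝ} (hM : SmoothMat M) (v p : X)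
    (hp : (M p).det ≠ 0) :
    dirDeriv v (fun q => Real.log (M q).det) p =
      ∑ i, ∑ j, (M p)⁻¹ j i * dirDeriv v (fun q => M q i j) p := by
  rw [dirDeriv_log hM.det v p hp, dirDeriv_det hM, Finset.mul_sum]
  refine Finset.sum_congr rfl fun i _ => ?_
  rw [Finset.mul_sum]
  refine Finset.sum_congr rfl fun j _ => ?_
  simp [Matrix.inv_def]; ring

/-- Differentiate M⁻¹M = 1 entrywise and multiply by M⁻¹ on the right. -/
theorem dirDeriv_inv {M : X → Matrix ι ι ℝ} (hM : SmoothMat M) (h : ∀ p, (M p).det ≠ 0)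
    (v p : X) (a b : ι) :
    dirDeriv v (fun q => (M q)⁻¹ a b) p =
      -∑ c, ∑ d, (M p)⁻¹ a c * dirDeriv v (fun q => M q c d) p * (M p)⁻¹ d b := by
  have hN := hM.inv h
  let dN : Matrix ι ι ℝ := Matrix.of fun i j => dirDeriv v (fun q => (M q)⁻¹ i j) p
  let dM : Matrix ι ι ℝ := Matrix.of fun i j => dirDeriv v (fun q => M q i j) p
  have h1 : dN * M p + (M p)⁻¹ * dM = 0 := by
    ext i j
    have hid : (fun q => ∑ k, (M q)⁻¹ i k * M q k j) = fun _ => (1 : Matrix ι ι ℝ) i j := by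
      ext q
      rw [← Matrix.nonsing_inv_mul (M q) (isUnit_iff_ne_zero.2 (h q)), Matrix.mul_apply]
    have h2 := dirDeriv_sum Finset.univ (F := fun k q => (M q)⁻¹ i k * M q k j)
      (fun k => (hN i k).mul (hM k j)) v p
    rw [hid, dirDeriv_const] at h2
    simp only [dirDeriv_mul (hN _ _) (hM _ _), Finset.sum_add_distrib] at h2
    simpa [Matrix.mul_apply, dN, dM] using h2.symm
  have h3 : dN = -((M p)⁻¹ * dM * (M p)⁻¹) := by
    have : dN * M p * (M p)⁻¹ = -((M p)⁻¹ * dM) * (M p)⁻¹ := by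
      rw [eq_neg_of_add_eq_zero_left h1]
    rwa [Matrix.mul_assoc, Matrix.mul_nonsing_inv _ (isUnit_iff_ne_zero.2 (h p)), Matrix.mul_one,
      Matrix.neg_mul] at this
  have h4 := congrFun (congrFun h3 a) b
  simp only [dN, Matrix.of_apply, Matrix.neg_apply, Matrix.mul_apply, Finset.sum_mul, dM] at h4
  rw [h4, Finset.sum_comm]

/-- The matrix of second derivatives of `f` in the directions `e`. -/
def hessMat (e : ι → X) (f : X → ℝ) (p : X) : Matrix ι ι ℝ :=
  Matrix.of fun i j => dirDeriv (e i) (dirDeriv (e j) f) p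

theorem hessMat_smooth (e : ι → X) {f : X → ℝ} (hf : Smooth f) : SmoothMat (hessMat e f) :=
  fun i j => (hf.dirDeriv (e j)).dirDeriv (e i)

theorem hessMat_symm (e : ι → X) {f : X → ℝ} (hf : Smooth f) (p : X) (i j : ι) :
    hessMat e f p i j = hessMat e f p j i := dirDeriv_comm hf _ _ _

theorem hessMat_inv_symm (e : ι → X) {f : X → ℝ} (hf : Smooth f) (p : X) (i j : ι) :
    (hessMat e f p)⁻¹ i j = (hessMat e f p)⁻¹ j i := by
  have h : (hessMat e f p).transpose = hessMat e f p := by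
    ext a b; exact hessMat_symm e hf p b a
  have h2 := Matrix.transpose_nonsing_inv (hessMat e f p)
  rw [h] at h2
  exact congrFun (congrFun h2 j) i

/-! ### The divergence identity for the weighted density -/

section Energy

variable (e : ι → X) (θ : ι → ℝ) (f : X → ℝ)

/-- `log det D²f`. -/
def logDet (p : X) : ℝ := Real.log (hessMat e f p).det

/-- `θ(Df)`. -/
def momentTheta (p : X) : ℝ := ∑ i, θ i * dirDeriv (e i) f p

/-- The density `det (D²f) e^{θ(Df)}`. -/
def rho (p : X) : ℝ := Real.exp (logDet e f p + momentTheta e θ f p)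

/-- The Ricci potential `-log det D²f - f`. -/
def ricciPot (p : X) : ℝ := -logDet e f p - f p

/-- The weighted Laplacian `f^{ij} χ_{ij} + θ^i χ_i`. -/
def weightedLaplacian (χ : X → ℝ) (p : X) : ℝ :=
  (∑ i, ∑ j, (hessMat e f p)⁻¹ i j * hessMat e χ p i j) + ∑ i, θ i * dirDeriv (e i) χ p

variable {e θ f}

theorem logDet_smooth (hf : Smooth f) (hd : ∀ p, (hessMat e f p).det ≠ 0) :
    Smooth (logDet e f) := (hessMat_smooth e hf).det.log hd

theorem momentTheta_smooth (hf : Smooth f) : Smooth (momentTheta e θ f) :=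
  ContDiff.sum fun i _ => contDiff_const.mul (hf.dirDeriv (e i))

theorem rho_smooth (hf : Smooth f) (hd : ∀ p, (hessMat e f p).det ≠ 0) :
    Smooth (rho e θ f) := ((logDet_smooth hf hd).add (momentTheta_smooth hf)).exp

theorem ricciPot_smooth (hf : Smooth f) (hd : ∀ p, (hessMat e f p).det ≠ 0) :
    Smooth (ricciPot e f) := (logDet_smooth hf hd).neg.sub hf

theorem dirDeriv_logDet (hf : Smooth f) (hd : ∀ p, (hessMat e f p).det ≠ 0) (v p : X) :
    dirDeriv v (logDet e f) p =
      ∑ i, ∑ j, (hessMat e f p)⁻¹ i j * dirDeriv v (fun q => hessMat e f q i j) p := by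
  unfold logDet
  rw [dirDeriv_log_det (hessMat_smooth e hf) v p (hd p)]
  refine Finset.sum_congr rfl fun i _ => Finset.sum_congr rfl fun j _ => ?_
  rw [hessMat_inv_symm e hf]

theorem dirDeriv_momentTheta (hf : Smooth f) (v p : X) :
    dirDeriv v (momentTheta e θ f) p = ∑ i, θ i * dirDeriv v (dirDeriv (e i) f) p := by
  unfold momentTheta
  rw [dirDeriv_sum _ (fun i => contDiff_const.mul (hf.dirDeriv (e i)))]
  refine Finset.sum_congr rfl fun i _ => dirDeriv_const_mul (hf.dirDeriv (e i)) _ _ _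

theorem dirDeriv_rho (hf : Smooth f) (hd : ∀ p, (hessMat e f p).det ≠ 0) (v p : X) :
    dirDeriv v (rho e θ f) p =
      rho e θ f p * (dirDeriv v (logDet e f) p + dirDeriv v (momentTheta e θ f) p) := by
  unfold rho
  rw [dirDeriv_exp ((logDet_smooth hf hd).add (momentTheta_smooth hf)),
    dirDeriv_add (logDet_smooth hf hd) (momentTheta_smooth hf)]

/-- Third derivatives of f are totally symmetric, so the divergence of the inverse Hessian collapses
to a logarithmic derivative of det D²f. In the weighted divergence it cancels the derivative of the
determinant in ρ. -/
theorem sum_dirDeriv_inv (hf : Smooth f) (hd : ∀ p, (hessMat e f p).det ≠ 0) (p : X) (a : ι) :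
    ∑ b, dirDeriv (e b) (fun q => (hessMat e f q)⁻¹ a b) p =
      -∑ c, (hessMat e f p)⁻¹ a c * dirDeriv (e c) (logDet e f) p := by
  simp only [dirDeriv_inv (hessMat_smooth e hf) hd, dirDeriv_logDet hf hd]
  rw [Finset.sum_neg_distrib, neg_inj, Finset.sum_comm]
  refine Finset.sum_congr rfl fun c _ => ?_
  rw [Finset.mul_sum]
  refine Finset.sum_congr rfl fun b _ => ?_
  rw [Finset.mul_sum]
  refine Finset.sum_congr rfl fun d _ => ?_
  have : dirDeriv (e b) (fun q => hessMat e f q c d) p =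
      dirDeriv (e c) (fun q => hessMat e f q b d) p :=
    dirDeriv_comm (hf.dirDeriv (e d)) _ _ _
  rw [this, hessMat_inv_symm e hf p d b]
  ring

/-- The differential of θ(Df) is the Hessian applied to θ, and the inverse Hessian undoes it: θ(Df)
is the Hamiltonian of the constant field θ. -/
theorem sum_momentTheta_inv (hf : Smooth f) (hd : ∀ p, (hessMat e f p).det ≠ 0) (p : X) (a : ι) :
    ∑ b, dirDeriv (e b) (momentTheta e θ f) p * (hessMat e f p)⁻¹ a b = θ a := by
  simp only [dirDeriv_momentTheta hf]
  have h : ∀ i, ∑ b, (hessMat e f p)⁻¹ a b * hessMat e f p b i = (1 : Matrix ι ι ℝ) a i := by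
    intro i
    rw [← Matrix.nonsing_inv_mul _ (isUnit_iff_ne_zero.2 (hd p)), Matrix.mul_apply]
  calc _ = ∑ i, θ i * ∑ b, (hessMat e f p)⁻¹ a b * hessMat e f p b i := by
        simp only [Finset.sum_mul, Finset.mul_sum]
        rw [Finset.sum_comm]
        refine Finset.sum_congr rfl fun i _ => Finset.sum_congr rfl fun b _ => ?_
        simp only [hessMat, Matrix.of_apply]; ring
    _ = θ a := by simp [h, Matrix.one_apply]

/-- The weighted divergence of the vector field dual to `∑ F_a dξ_a`. -/
theorem weighted_divergence (hf : Smooth f) (hd : ∀ p, (hessMat e f p).det ≠ 0)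
    {F : ι → X → ℝ} (hF : ∀ a, Smooth (F a)) (p : X) :
    ∑ b, dirDeriv (e b) (fun q => rho e θ f q * ∑ a, (hessMat e f q)⁻¹ a b * F a q) p =
      rho e θ f p * ((∑ a, ∑ b, (hessMat e f p)⁻¹ a b * dirDeriv (e b) (F a) p)
        + ∑ a, θ a * F a p) := by
  have hN := (hessMat_smooth e hf).inv hd
  have hterm : ∀ b, dirDeriv (e b) (fun q => rho e θ f q * ∑ a, (hessMat e f q)⁻¹ a b * F a q) p =
      rho e θ f p * ∑ a, ((dirDeriv (e b) (logDet e f) p * (hessMat e f p)⁻¹ a b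
        + dirDeriv (e b) (momentTheta e θ f) p * (hessMat e f p)⁻¹ a b
        + dirDeriv (e b) (fun q => (hessMat e f q)⁻¹ a b) p) * F a p
        + (hessMat e f p)⁻¹ a b * dirDeriv (e b) (F a) p) := by
    intro b
    rw [dirDeriv_mul (rho_smooth hf hd) (ContDiff.sum fun a _ => (hN a b).mul (hF a)),
      dirDeriv_rho hf hd, dirDeriv_sum _ (fun a => (hN a b).mul (hF a))]
    simp only [dirDeriv_mul (hN _ _) (hF _)]
    rw [mul_assoc, ← mul_add, Finset.mul_sum, ← Finset.sum_add_distrib]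
    congr 1
    refine Finset.sum_congr rfl fun a _ => ?_
    ring
  simp only [hterm]
  rw [← Finset.mul_sum, Finset.sum_comm]
  congr 1
  rw [← Finset.sum_add_distrib]
  refine Finset.sum_congr rfl fun a _ => ?_
  -- The coefficient of F_a collects the derivatives of log det, of θ(Df) and of the inverse
  -- Hessian. The first and the last cancel, which leaves θ_a.
  rw [Finset.sum_add_distrib, ← Finset.sum_mul, Finset.sum_add_distrib, Finset.sum_add_distrib,
    sum_momentTheta_inv hf hd, sum_dirDeriv_inv hf hd]
  have : ∑ b, dirDeriv (e b) (logDet e f) p * (hessMat e f p)⁻¹ a b =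
      ∑ c, (hessMat e f p)⁻¹ a c * dirDeriv (e c) (logDet e f) p :=
    Finset.sum_congr rfl fun _ _ => mul_comm _ _
  rw [this]; ring

variable (e θ f)

/-- The density of the reduced functional in logarithmic coordinates: `log det D²f + ⟨ξ, Df⟩`. -/
def entropyDensity (ξ : ι → X → ℝ) (p : X) : ℝ :=
  logDet e f p + ∑ i, ξ i p * dirDeriv (e i) f p

/-- The covector field whose dual is the flux in the variation formula. -/
def fluxForm (ξ : ι → X → ℝ) (ψ : X → ℝ) (a : ι) (p : X) : ℝ :=
  (entropyDensity e f ξ p + 1) * dirDeriv (e a) ψ p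
    + ψ p * dirDeriv (e a) (fun q => ricciPot e f q - momentTheta e θ f q) p

variable {e θ f}

theorem entropyDensity_smooth (hf : Smooth f) (hd : ∀ p, (hessMat e f p).det ≠ 0)
    {ξ : ι → X → ℝ} (hξ : ∀ i, Smooth (ξ i)) : Smooth (entropyDensity e f ξ) :=
  (logDet_smooth hf hd).add (ContDiff.sum fun i _ => (hξ i).mul (hf.dirDeriv (e i)))

theorem fluxForm_smooth (hf : Smooth f) (hd : ∀ p, (hessMat e f p).det ≠ 0)
    {ξ : ι → X → ℝ} (hξ : ∀ i, Smooth (ξ i)) {ψ : X → ℝ} (hψ : Smooth ψ) (a : ι) :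
    Smooth (fluxForm e θ f ξ ψ a) :=
  (((entropyDensity_smooth hf hd hξ).add contDiff_const).mul (hψ.dirDeriv _)).add
    (hψ.mul (Smooth.dirDeriv ((ricciPot_smooth hf hd).sub (momentTheta_smooth hf)) _))

/-- The first variation of the entropy in the direction `τ`, up to a divergence. -/
theorem entropy_variation (hf : Smooth f) (hd : ∀ p, (hessMat e f p).det ≠ 0)
    {ξ : ι → X → ℝ} (hξ : ∀ i, Smooth (ξ i)) (τ : X)
    (hξe : ∀ i j p, dirDeriv (e i) (ξ j) p = if i = j then 1 else 0)
    (hξτ : ∀ j p, dirDeriv τ (ξ j) p = 0) (p : X) :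
    dirDeriv τ (fun q => entropyDensity e f ξ q * rho e θ f q) p =
      -(dirDeriv τ f p * weightedLaplacian e θ f
          (fun q => ricciPot e f q - momentTheta e θ f q) p * rho e θ f p)
      + ∑ b, dirDeriv (e b) (fun q => rho e θ f q *
          ∑ a, (hessMat e f q)⁻¹ a b * fluxForm e θ f ξ (dirDeriv τ f) a q) p := by
  set ψ := dirDeriv τ f with hψdef
  have hψ : Smooth ψ := hf.dirDeriv τ
  have hA := entropyDensity_smooth hf hd hξ
  have hL := logDet_smooth (e := e) hf hd
  have hT : Smooth (momentTheta e θ f) := momentTheta_smooth hf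
  have hk : Smooth (fun q => ricciPot e f q - momentTheta e θ f q) :=
    (ricciPot_smooth hf hd).sub hT
  have hfi : ∀ i, Smooth (dirDeriv (e i) f) := fun i => hf.dirDeriv _
  rw [weighted_divergence hf hd (fluxForm_smooth hf hd hξ hψ)]
  -- Derivatives commute, so varying the Hessian of f in the direction τ gives the Hessian of ψ.
  have hcomm3 : ∀ i j, dirDeriv τ (fun q => hessMat e f q i j) p = hessMat e ψ p i j := by
    intro i j
    have h1 : dirDeriv τ (fun q => hessMat e f q i j) p =
        dirDeriv (e i) (dirDeriv τ (dirDeriv (e j) f)) p := dirDeriv_comm (hfi j) _ _ _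
    rw [h1]
    have h2 : dirDeriv τ (dirDeriv (e j) f) = dirDeriv (e j) ψ := by
      ext q; exact dirDeriv_comm hf _ _ _
    rw [h2]; rfl
  have hLτ : dirDeriv τ (logDet e f) p = ∑ i, ∑ j, (hessMat e f p)⁻¹ i j * hessMat e ψ p i j := by
    rw [dirDeriv_logDet hf hd]; simp only [hcomm3]
  have hcomm2 : ∀ i, dirDeriv τ (dirDeriv (e i) f) p = dirDeriv (e i) ψ p :=
    fun i => dirDeriv_comm hf _ _ _
  have hTτ : dirDeriv τ (momentTheta e θ f) p = ∑ i, θ i * dirDeriv (e i) ψ p := by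
    rw [dirDeriv_momentTheta hf]; simp only [hcomm2]
  have hAτ : dirDeriv τ (entropyDensity e f ξ) p =
      (∑ i, ∑ j, (hessMat e f p)⁻¹ i j * hessMat e ψ p i j)
        + ∑ i, ξ i p * dirDeriv (e i) ψ p := by
    unfold entropyDensity
    rw [dirDeriv_add hL (ContDiff.sum fun i _ => (hξ i).mul (hfi i)), hLτ,
      dirDeriv_sum _ (fun i => (hξ i).mul (hfi i))]
    simp only [dirDeriv_mul (hξ _) (hfi _), hξτ, hcomm2, zero_mul, zero_add]
  -- Differentiating ⟨ξ, Df⟩ yields D²f ξ and an extra Df; the latter is absorbed with log det D²f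
  -- into the gradient of the Ricci potential.
  have hAb : ∀ b, dirDeriv (e b) (entropyDensity e f ξ) p =
      -dirDeriv (e b) (fun q => ricciPot e f q - momentTheta e θ f q) p
        - dirDeriv (e b) (momentTheta e θ f) p + ∑ i, ξ i p * hessMat e f p b i := by
    intro b
    unfold entropyDensity
    rw [dirDeriv_add hL (ContDiff.sum fun i _ => (hξ i).mul (hfi i)),
      dirDeriv_sum _ (fun i => (hξ i).mul (hfi i)), dirDeriv_sub (ricciPot_smooth hf hd) hT]
    unfold ricciPot
    rw [dirDeriv_sub hL.neg hf, dirDeriv_neg]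
    simp only [dirDeriv_mul (hξ _) (hfi _), hξe, ite_mul, one_mul, zero_mul,
      Finset.sum_add_distrib, Finset.sum_ite_eq, Finset.mem_univ, if_true]
    simp only [hessMat, Matrix.of_apply]
    ring
  have hFb : ∀ a b, dirDeriv (e b) (fluxForm e θ f ξ ψ a) p =
      dirDeriv (e b) (entropyDensity e f ξ) p * dirDeriv (e a) ψ p
        + (entropyDensity e f ξ p + 1) * hessMat e ψ p a b
        + dirDeriv (e b) ψ p * dirDeriv (e a) (fun q => ricciPot e f q - momentTheta e θ f q) p
        + ψ p * hessMat e (fun q => ricciPot e f q - momentTheta e θ f q) p a b := by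
    intro a b
    unfold fluxForm
    rw [dirDeriv_add ((hA.add contDiff_const).mul (hψ.dirDeriv _)) (hψ.mul (hk.dirDeriv _)),
      dirDeriv_mul (hA.add contDiff_const) (hψ.dirDeriv _),
      dirDeriv_mul hψ (hk.dirDeriv _), dirDeriv_add hA contDiff_const, dirDeriv_const,
      hessMat_symm e hψ, hessMat_symm e hk]
    simp only [hessMat, Matrix.of_apply]
    ring
  rw [dirDeriv_mul hA (rho_smooth hf hd), dirDeriv_rho hf hd, hLτ, hTτ, hAτ]
  have hinv : ∀ a i, ∑ b, (hessMat e f p)⁻¹ a b * hessMat e f p b i = (1 : Matrix ι ι ℝ) a i := by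
    intro a i
    rw [← Matrix.nonsing_inv_mul _ (isUnit_iff_ne_zero.2 (hd p)), Matrix.mul_apply]
  -- the gradient of the entropy density paired with `dψ`
  have hS : ∑ a, ∑ b, (hessMat e f p)⁻¹ a b * dirDeriv (e b) (fluxForm e θ f ξ ψ a) p =
      (entropyDensity e f ξ p + 1) * (∑ i, ∑ j, (hessMat e f p)⁻¹ i j * hessMat e ψ p i j)
      + ψ p * (∑ i, ∑ j, (hessMat e f p)⁻¹ i j *
          hessMat e (fun q => ricciPot e f q - momentTheta e θ f q) p i j)
      - (∑ a, θ a * dirDeriv (e a) ψ p) + ∑ a, ξ a p * dirDeriv (e a) ψ p := by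
    -- The pairing of dψ with dk, where k is the Ricci potential minus θ(Df), arises once from dA
    -- with a minus sign and once from ψ dk. It cancels because the inverse Hessian is symmetric.
    have hsymm : ∑ a, ∑ b, (hessMat e f p)⁻¹ a b * (dirDeriv (e b) ψ p *
          dirDeriv (e a) (fun q => ricciPot e f q - momentTheta e θ f q) p) =
        ∑ a, ∑ b, (hessMat e f p)⁻¹ a b * (dirDeriv (e b)
          (fun q => ricciPot e f q - momentTheta e θ f q) p * dirDeriv (e a) ψ p) := by
      rw [Finset.sum_comm]
      refine Finset.sum_congr rfl fun a _ => Finset.sum_congr rfl fun b _ => ?_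
      rw [hessMat_inv_symm e hf, mul_comm (dirDeriv (e a) ψ p)]
    -- Here and in `h2`, the derivatives of ψ along θ and along ξ are rewritten as pairings by the
    -- inverse Hessian, so that they match the remaining terms of dA.
    have h1 : ∑ a, θ a * dirDeriv (e a) ψ p = ∑ a, ∑ b, (hessMat e f p)⁻¹ a b *
        (dirDeriv (e b) (momentTheta e θ f) p * dirDeriv (e a) ψ p) := by
      refine Finset.sum_congr rfl fun a _ => ?_
      rw [← sum_momentTheta_inv (θ := θ) hf hd p a, Finset.sum_mul]
      refine Finset.sum_congr rfl fun b _ => ?_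
      ring
    have h2 : ∑ a, ξ a p * dirDeriv (e a) ψ p = ∑ a, ∑ b, (hessMat e f p)⁻¹ a b *
        ((∑ i, ξ i p * hessMat e f p b i) * dirDeriv (e a) ψ p) := by
      refine Finset.sum_congr rfl fun a _ => ?_
      calc _ = (∑ i, ξ i p * ∑ b, (hessMat e f p)⁻¹ a b * hessMat e f p b i)
            * dirDeriv (e a) ψ p := by simp [hinv, Matrix.one_apply]
        _ = _ := by
          simp only [Finset.mul_sum, Finset.sum_mul]
          rw [Finset.sum_comm]
          refine Finset.sum_congr rfl fun b _ => Finset.sum_congr rfl fun i _ => ?_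
          ring
    simp only [hFb, hAb]
    rw [h1, h2]
    simp only [mul_add, Finset.sum_add_distrib, add_mul, sub_mul, mul_sub, Finset.sum_sub_distrib,
      hsymm]
    simp only [neg_mul, mul_neg, Finset.sum_neg_distrib, Finset.mul_sum]
    have e1 : ∀ (c : ℝ) (M : Matrix ι ι ℝ), ∑ i, ∑ j, (hessMat e f p)⁻¹ i j * (c * M i j) =
        ∑ i, ∑ j, c * ((hessMat e f p)⁻¹ i j * M i j) := fun c M =>
      Finset.sum_congr rfl fun i _ => Finset.sum_congr rfl fun j _ => by ring
    simp only [e1]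
    ring
  rw [hS]
  have hF : ∑ a, θ a * fluxForm e θ f ξ ψ a p =
      (entropyDensity e f ξ p + 1) * (∑ a, θ a * dirDeriv (e a) ψ p)
      + ψ p * ∑ a, θ a * dirDeriv (e a)
          (fun q => ricciPot e f q - momentTheta e θ f q) p := by
    simp only [fluxForm, mul_add, Finset.sum_add_distrib, Finset.mul_sum]
    congr 1 <;> refine Finset.sum_congr rfl fun i _ => ?_ <;> ring
  rw [hF]
  simp only [weightedLaplacian]
  ring

end Energy

end Matrix

end SmoothCalculus

/-! ## Conservation laws with integrable flux -/

namespace SmoothCalculus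

set_option linter.unusedSectionVars false

variable {ι : Type*} [Fintype ι] [DecidableEq ι]

/-- The time direction in `ℝ × ℝ^ι`. -/
def timeDir : ℝ × (ι → ℝ) := (1, 0)

/-- The coordinate directions of `ℝ^ι` in `ℝ × ℝ^ι`. -/
def spaceDir (i : ι) : ℝ × (ι → ℝ) := (0, Pi.single i 1)

theorem hasDerivAt_time_slice {Q : ℝ × (ι → ℝ) → ℝ} (hQ : Smooth Q) (s : ℝ) (ξ : ι → ℝ) :
    HasDerivAt (fun t => Q (t, ξ)) (dirDeriv timeDir Q (s, ξ)) s := by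
  have h := (hQ.diff (s, ξ)).hasFDerivAt.comp_hasDerivAt s
    ((hasDerivAt_id s).prodMk (hasDerivAt_const s ξ))
  exact h

theorem fderiv_space_slice {E : Type*} [NormedAddCommGroup E] [NormedSpace ℝ E] {Q : ℝ × E → ℝ}
    (hQ : Smooth Q) (s : ℝ) (ξ v : E) :
    fderiv ℝ (fun η => Q (s, η)) ξ v = dirDeriv (0, v) Q (s, ξ) := by
  have h := (hQ.diff (s, ξ)).hasFDerivAt.comp ξ
    ((hasFDerivAt_const s ξ).prodMk (hasFDerivAt_id ξ))
  have h2 : HasFDerivAt (fun η => Q (s, η)) _ ξ := h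
  rw [h2.fderiv]; rfl

theorem smooth_space_slice {E : Type*} [NormedAddCommGroup E] [NormedSpace ℝ E] {Q : ℝ × E → ℝ}
    (hQ : Smooth Q) (s : ℝ) :
    Smooth fun η => Q (s, η) := hQ.comp (contDiff_const.prodMk contDiff_id)

/-! ### Testing a conservation law against a compactly supported function. -/

section Cutoff

variable {χ : (ι → ℝ) → ℝ} (hχ : Smooth χ) (hχc : HasCompactSupport χ)
include hχ hχc

theorem integrable_cutoff_mul {J : (ι → ℝ) → ℝ} (hJ : Continuous J) :
    Integrable fun ξ => χ ξ * J ξ :=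
  (hχ.continuous.mul hJ).integrable_of_hasCompactSupport hχc.mul_right

theorem integral_cutoff_mul_fderiv {w : (ι → ℝ) → ℝ} (hw : Smooth w) (v : ι → ℝ) :
    ∫ ξ, χ ξ * fderiv ℝ w ξ v = -∫ ξ, fderiv ℝ χ ξ v * w ξ := by
  have h1 : Continuous fun ξ => fderiv ℝ w ξ v := (hw.dirDeriv v).continuous
  have h2 : Continuous fun ξ => fderiv ℝ χ ξ v := (hχ.dirDeriv v).continuous
  refine integral_mul_fderiv_eq_neg_fderiv_mul_of_integrable ?_
    (integrable_cutoff_mul hχ hχc h1) (integrable_cutoff_mul hχ hχc hw.continuous)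
    (fun x _ => hχ.diff x) (fun x _ => hw.diff x)
  exact (h2.mul hw.continuous).integrable_of_hasCompactSupport
    ((hχc.fderiv_apply ℝ v).mul_right)

/-- The conservation law tested against a compactly supported function. -/
theorem cutoff_conservation {Q J : ℝ × (ι → ℝ) → ℝ} {W : ι → ℝ × (ι → ℝ) → ℝ}
    (hQ : Smooth Q) (hJ : Continuous J) (hW : ∀ b, Smooth (W b))
    (h : ∀ p, dirDeriv timeDir Q p = -J p + ∑ b, dirDeriv (spaceDir b) (W b) p)
    {S : ℝ} (hS : 0 ≤ S) :
    ∫ ξ, χ ξ * (Q (S, ξ) - Q (0, ξ)) =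
      -(∫ s in (0 : ℝ)..S, ∫ ξ, χ ξ * J (s, ξ))
        - ∫ s in (0 : ℝ)..S, ∑ b, ∫ ξ, fderiv ℝ χ ξ (Pi.single b 1) * W b (s, ξ) := by
  have hdQ : Continuous (dirDeriv timeDir Q) := (hQ.dirDeriv _).continuous
  have hpoint : ∀ ξ, χ ξ * (Q (S, ξ) - Q (0, ξ)) =
      ∫ s in (0 : ℝ)..S, χ ξ * dirDeriv timeDir Q (s, ξ) := by
    intro ξ
    rw [intervalIntegral.integral_const_mul]
    congr 1
    exact (intervalIntegral.integral_eq_sub_of_hasDerivAt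
      (fun s _ => hasDerivAt_time_slice hQ s ξ)
      ((by fun_prop : Continuous fun s => dirDeriv timeDir Q (s, ξ)).intervalIntegrable 0 S)).symm
  have hswap : ∫ ξ, χ ξ * (Q (S, ξ) - Q (0, ξ)) =
      ∫ s in (0 : ℝ)..S, ∫ ξ, χ ξ * dirDeriv timeDir Q (s, ξ) := by
    simp only [hpoint, intervalIntegral.integral_of_le hS]
    rw [integral_integral_swap]
    have hK : IsCompact (tsupport χ ×ˢ Set.Icc (0 : ℝ) S) := hχc.isCompact.prod isCompact_Icc
    have hcont : Continuous fun z : (ι → ℝ) × ℝ => χ z.1 * dirDeriv timeDir Q (z.2, z.1) :=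
      (hχ.continuous.comp continuous_fst).mul
        (hdQ.comp (continuous_snd.prodMk continuous_fst))
    have h1 := hcont.continuousOn.integrableOn_compact (μ := volume) hK
    -- Off the support of χ the integrand vanishes, so integrability over the compact product
    -- extends to the whole strip and Fubini applies.
    have h2 : IntegrableOn (fun z : (ι → ℝ) × ℝ => χ z.1 * dirDeriv timeDir Q (z.2, z.1))
        (Set.univ ×ˢ Set.Icc (0 : ℝ) S) volume := by
      refine h1.of_forall_sdiff_eq_zero (MeasurableSet.univ.prod measurableSet_Icc) ?_
      rintro ⟨ξ, s⟩ ⟨⟨-, hs⟩, hn⟩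
      have : ξ ∉ tsupport χ := fun hξ => hn ⟨hξ, hs⟩
      simp [image_eq_zero_of_notMem_tsupport this]
    have h3 := h2.mono_set (Set.prod_mono_right (s := Set.univ) (Set.Ioc_subset_Icc_self))
    rw [IntegrableOn, Measure.volume_eq_prod, ← Measure.prod_restrict, Measure.restrict_univ] at h3
    exact h3
  have hinner : ∀ s, ∫ ξ, χ ξ * dirDeriv timeDir Q (s, ξ) =
      -(∫ ξ, χ ξ * J (s, ξ)) - ∑ b, ∫ ξ, fderiv ℝ χ ξ (Pi.single b 1) * W b (s, ξ) := by
    intro s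
    have hJs : Continuous fun ξ => J (s, ξ) := by fun_prop
    have hWs : ∀ b, Smooth fun ξ => W b (s, ξ) := fun b => smooth_space_slice (hW b) s
    have hWd : ∀ b, Continuous fun ξ => fderiv ℝ (fun η => W b (s, η)) ξ (Pi.single b 1) :=
      fun b => ((hWs b).dirDeriv _).continuous
    have : ∀ ξ, χ ξ * dirDeriv timeDir Q (s, ξ) = -(χ ξ * J (s, ξ)) +
        ∑ b, χ ξ * fderiv ℝ (fun η => W b (s, η)) ξ (Pi.single b 1) := by
      intro ξ
      rw [h, mul_add, Finset.mul_sum, mul_neg]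
      congr 1
      refine Finset.sum_congr rfl fun b _ => ?_
      rw [fderiv_space_slice (hW b)]; rfl
    simp only [this]
    have hneg : Integrable fun ξ => -(χ ξ * J (s, ξ)) := (integrable_cutoff_mul hχ hχc hJs).neg
    rw [integral_add hneg
      (integrable_finsetSum _ fun b _ => integrable_cutoff_mul hχ hχc (hWd b)),
      integral_neg, integral_finsetSum _ fun b _ => integrable_cutoff_mul hχ hχc (hWd b)]
    simp only [integral_cutoff_mul_fderiv hχ hχc (hWs _), Finset.sum_neg_distrib]
    ring
  have hJint : IntervalIntegrable (fun s => ∫ ξ, χ ξ * J (s, ξ)) volume 0 S := by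
    apply Continuous.intervalIntegrable
    exact continuous_parametric_integral_of_continuous (μ := volume)
      (f := fun s ξ => χ ξ * J (s, ξ)) (by
        have := hχ.continuous
        fun_prop) hχc.isCompact |>.congr fun s => by
        refine setIntegral_eq_integral_of_forall_compl_eq_zero fun ξ hξ => ?_
        simp [image_eq_zero_of_notMem_tsupport hξ]
  have hWint : IntervalIntegrable
      (fun s => ∑ b, ∫ ξ, fderiv ℝ χ ξ (Pi.single b 1) * W b (s, ξ)) volume 0 S := by
    apply Continuous.intervalIntegrable
    refine continuous_finsetSum _ fun b _ => ?_
    have hc : HasCompactSupport fun ξ => fderiv ℝ χ ξ (Pi.single b 1) := hχc.fderiv_apply ℝ _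
    exact continuous_parametric_integral_of_continuous (μ := volume)
      (f := fun s ξ => fderiv ℝ χ ξ (Pi.single b 1) * W b (s, ξ)) (by
        have h1 : Continuous fun ξ => fderiv ℝ χ ξ (Pi.single b 1) :=
          (hχ.dirDeriv (Pi.single b 1)).continuous
        have h2 := (hW b).continuous
        fun_prop) hc.isCompact |>.congr fun s => by
        refine setIntegral_eq_integral_of_forall_compl_eq_zero fun ξ hξ => ?_
        simp [image_eq_zero_of_notMem_tsupport hξ]
  have hneg : IntervalIntegrable (fun s => -∫ ξ, χ ξ * J (s, ξ)) volume 0 S := hJint.neg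
  rw [hswap, ← intervalIntegral.integral_neg, ← intervalIntegral.integral_sub hneg hWint]
  exact intervalIntegral.integral_congr fun s _ => hinner s

end Cutoff

/-- A conservation law `∂_s Q = -J + div W` with uniformly integrable `Q`, `J`, `W`. -/
theorem integral_sub_eq_of_conservation {Q J : ℝ × (ι → ℝ) → ℝ} {W : ι → ℝ × (ι → ℝ) → ℝ}
    (hQ : Smooth Q) (hJ : Continuous J) (hW : ∀ b, Smooth (W b))
    (h : ∀ p, dirDeriv timeDir Q p = -J p + ∑ b, dirDeriv (spaceDir b) (W b) p)
    {S : ℝ} (hS : 0 ≤ S) {g : (ι → ℝ) → ℝ} (hg : Integrable g)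
    (hQg : ∀ s ∈ Set.Icc 0 S, ∀ ξ, |Q (s, ξ)| ≤ g ξ)
    (hJg : ∀ s ∈ Set.Icc 0 S, ∀ ξ, |J (s, ξ)| ≤ g ξ)
    (hWg : ∀ b, ∀ s ∈ Set.Icc 0 S, ∀ ξ, |W b (s, ξ)| ≤ g ξ) :
    (∫ ξ, Q (S, ξ)) - ∫ ξ, Q (0, ξ) = -∫ s in (0 : ℝ)..S, ∫ ξ, J (s, ξ) := by
  obtain ⟨χ, hχ1, hχs, hχc, hχr⟩ : ∃ χ : (ι → ℝ) → ℝ, (∀ ξ ∈ Metric.closedBall 0 1, χ ξ = 1) ∧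
      Smooth χ ∧ HasCompactSupport χ ∧ ∀ ξ, χ ξ ∈ Set.Icc (0 : ℝ) 1 := by
    let b : ContDiffBump (0 : ι → ℝ) := ⟨1, 2, by norm_num, by norm_num⟩
    exact ⟨b, fun ξ hξ => b.one_of_mem_closedBall hξ, b.contDiff, b.hasCompactSupport,
      fun ξ => ⟨b.nonneg, b.le_one⟩⟩
  obtain ⟨M, hM⟩ : ∃ M, ∀ ξ, ‖fderiv ℝ χ ξ‖ ≤ M := by
    have hc : Continuous (fderiv ℝ χ) := hχs.continuous_fderiv (by simp)
    exact hc.bounded_above_of_compact_support (hχc.fderiv ℝ)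
  have hM0 : 0 ≤ M := (norm_nonneg _).trans (hM 0)
  -- The cutoffs χ(c_k ξ) equal one on the balls of radius 1/c_k, and their gradients are at most M
  -- c_k. The flux term is therefore bounded by c_k times a fixed integral.
  let c : ℕ → ℝ := fun k => ((k : ℝ) + 1)⁻¹
  have hc0 : ∀ k, 0 < c k := fun k => by positivity
  let χk : ℕ → (ι → ℝ) → ℝ := fun k ξ => χ (c k • ξ)
  have hχks : ∀ k, Smooth (χk k) := fun k => hχs.comp (contDiff_const_smul _)
  have hχkc : ∀ k, HasCompactSupport (χk k) := fun k => hχc.comp_smul (hc0 k).ne'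
  have hχkd : ∀ k ξ v, ‖v‖ ≤ 1 → |fderiv ℝ (χk k) ξ v| ≤ M * c k := by
    intro k ξ v hv
    have h1 : HasFDerivAt (χk k) ((fderiv ℝ χ (c k • ξ)).comp
        (c k • ContinuousLinearMap.id ℝ (ι → ℝ))) ξ :=
      (hχs.diff _).hasFDerivAt.comp ξ ((hasFDerivAt_id ξ).const_smul (c k))
    rw [h1.fderiv]
    simp only [ContinuousLinearMap.comp_apply, _root_.smul_apply,
      ContinuousLinearMap.id_apply, map_smul, smul_eq_mul, abs_mul, abs_of_pos (hc0 k)]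
    rw [mul_comm]
    refine mul_le_mul_of_nonneg_right ?_ (hc0 k).le
    · calc |fderiv ℝ χ (c k • ξ) v| ≤ ‖fderiv ℝ χ (c k • ξ)‖ * ‖v‖ :=
          (fderiv ℝ χ (c k • ξ)).le_opNorm v
        _ ≤ M * 1 := by gcongr; exact hM _
        _ = M := mul_one _
  have hck : Filter.Tendsto c Filter.atTop (nhds 0) := by
    simpa [c] using tendsto_one_div_add_atTop_nhds_zero_nat (𝕜 := ℝ)
  have hχlim : ∀ ξ, Filter.Tendsto (fun k => χk k ξ) Filter.atTop (nhds 1) := by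
    intro ξ
    have h0 : Filter.Tendsto (fun k => c k • ξ) Filter.atTop (nhds (0 : ι → ℝ)) := by
      simpa using hck.smul_const ξ
    have h1 := (hχs.continuous.tendsto 0).comp h0
    rw [hχ1 0 (by simp)] at h1
    exact h1
  have hχab : ∀ k ξ, |χk k ξ| ≤ 1 := fun k ξ => by
    rw [abs_of_nonneg (hχr _).1]; exact (hχr _).2
  have hg0 : ∀ ξ, 0 ≤ g ξ := fun ξ => (abs_nonneg _).trans (hQg 0 ⟨le_rfl, hS⟩ ξ)
  have hQi : ∀ s ∈ Set.Icc 0 S, Integrable fun ξ => Q (s, ξ) := fun s hs =>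
    hg.mono' ((smooth_space_slice hQ s).continuous.aestronglyMeasurable)
      (Filter.Eventually.of_forall fun ξ => hQg s hs ξ)
  -- left-hand side
  have hL : Filter.Tendsto (fun k => ∫ ξ, χk k ξ * (Q (S, ξ) - Q (0, ξ))) Filter.atTop
      (nhds (∫ ξ, (Q (S, ξ) - Q (0, ξ)))) := by
    refine tendsto_integral_of_dominated_convergence (fun ξ => g ξ + g ξ) (fun k => ?_)
      (hg.add hg) (fun k => Filter.Eventually.of_forall fun ξ => ?_)
      (Filter.Eventually.of_forall fun ξ => ?_)
    · exact ((hχks k).continuous.mul ((smooth_space_slice hQ S).continuous.sub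
        (smooth_space_slice hQ 0).continuous)).aestronglyMeasurable
    · rw [Real.norm_eq_abs, abs_mul]
      calc _ ≤ 1 * |Q (S, ξ) - Q (0, ξ)| := by gcongr; exact hχab k ξ
        _ ≤ |Q (S, ξ)| + |Q (0, ξ)| := by rw [one_mul]; exact abs_sub _ _
        _ ≤ _ := add_le_add (hQg S ⟨hS, le_rfl⟩ ξ) (hQg 0 ⟨le_rfl, hS⟩ ξ)
    · simpa using (hχlim ξ).mul_const (Q (S, ξ) - Q (0, ξ))
  -- source term
  have hJl : Filter.Tendsto (fun k => ∫ s in (0 : ℝ)..S, ∫ ξ, χk k ξ * J (s, ξ)) Filter.atTop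
      (nhds (∫ s in (0 : ℝ)..S, ∫ ξ, J (s, ξ))) := by
    have hb : ∀ k, ∀ s ∈ Set.Icc 0 S, ∀ ξ, ‖χk k ξ * J (s, ξ)‖ ≤ g ξ := by
      intro k s hs ξ
      rw [Real.norm_eq_abs, abs_mul]
      calc _ ≤ 1 * |J (s, ξ)| := by gcongr; exact hχab k ξ
        _ ≤ g ξ := by rw [one_mul]; exact hJg s hs ξ
    refine intervalIntegral.tendsto_integral_filter_of_dominated_convergence (fun _ => ∫ ξ, g ξ)
      (Filter.Eventually.of_forall fun k => ?_)
      (Filter.Eventually.of_forall fun k => Filter.Eventually.of_forall fun s hs => ?_)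
      intervalIntegrable_const (Filter.Eventually.of_forall fun s hs => ?_)
    · refine Continuous.aestronglyMeasurable ?_
      exact continuous_parametric_integral_of_continuous (μ := volume)
        (f := fun s ξ => χk k ξ * J (s, ξ)) (by
          have := (hχks k).continuous
          fun_prop) (hχkc k).isCompact |>.congr fun s => by
          refine setIntegral_eq_integral_of_forall_compl_eq_zero fun ξ hξ => ?_
          simp [image_eq_zero_of_notMem_tsupport hξ]
    · rw [Set.uIoc_of_le hS] at hs
      exact norm_integral_le_of_norm_le hg (Filter.Eventually.of_forall
        fun ξ => hb k s ⟨hs.1.le, hs.2⟩ ξ)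
    · rw [Set.uIoc_of_le hS] at hs
      refine tendsto_integral_of_dominated_convergence g (fun k => ?_) hg
        (fun k => Filter.Eventually.of_forall fun ξ => hb k s ⟨hs.1.le, hs.2⟩ ξ)
        (Filter.Eventually.of_forall fun ξ => ?_)
      · have := (hχks k).continuous
        exact (by fun_prop : Continuous fun ξ => χk k ξ * J (s, ξ)).aestronglyMeasurable
      · simpa using (hχlim ξ).mul_const (J (s, ξ))
  -- flux term
  have hWl : Filter.Tendsto (fun k => ∫ s in (0 : ℝ)..S,
      ∑ b, ∫ ξ, fderiv ℝ (χk k) ξ (Pi.single b 1) * W b (s, ξ)) Filter.atTop (nhds 0) := by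
    have hb : ∀ k, ‖∫ s in (0 : ℝ)..S, ∑ b, ∫ ξ, fderiv ℝ (χk k) ξ (Pi.single b 1) * W b (s, ξ)‖
        ≤ (Fintype.card ι * (M * ∫ ξ, g ξ) * |S - 0|) * c k := by
      intro k
      have h1 := intervalIntegral.norm_integral_le_of_norm_le_const (a := 0) (b := S)
        (f := fun s => ∑ b, ∫ ξ, fderiv ℝ (χk k) ξ (Pi.single b 1) * W b (s, ξ))
        (C := Fintype.card ι * (M * c k * ∫ ξ, g ξ)) (fun s hs => by
          rw [Set.uIoc_of_le hS] at hs
          have h2 : ∀ b, ‖∫ ξ, fderiv ℝ (χk k) ξ (Pi.single b 1) * W b (s, ξ)‖ ≤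
              M * c k * ∫ ξ, g ξ := by
            intro b
            rw [← integral_const_mul]
            refine norm_integral_le_of_norm_le (hg.const_mul _)
              (Filter.Eventually.of_forall fun ξ => ?_)
            rw [Real.norm_eq_abs, abs_mul]
            have hv : ‖(Pi.single b 1 : ι → ℝ)‖ ≤ 1 := by
              rw [Pi.norm_single]; simp
            exact mul_le_mul (hχkd k ξ _ hv) (hWg b s ⟨hs.1.le, hs.2⟩ ξ) (abs_nonneg _)
              (mul_nonneg hM0 (hc0 k).le)
          calc _ ≤ ∑ b, ‖∫ ξ, fderiv ℝ (χk k) ξ (Pi.single b 1) * W b (s, ξ)‖ := norm_sum_le _ _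
            _ ≤ ∑ _b : ι, M * c k * ∫ ξ, g ξ := Finset.sum_le_sum fun b _ => h2 b
            _ = _ := by simp)
      refine h1.trans (le_of_eq ?_)
      ring
    refine squeeze_zero_norm hb ?_
    simpa using hck.const_mul (Fintype.card ι * (M * ∫ ξ, g ξ) * |S - 0|)
  have hfin := tendsto_nhds_unique hL ((hJl.neg.sub hWl).congr fun k =>
    (cutoff_conservation (hχks k) (hχkc k) hQ hJ hW h hS).symm)
  rw [integral_sub (hQi S ⟨hS, le_rfl⟩) (hQi 0 ⟨le_rfl, hS⟩)] at hfin
  rw [hfin, sub_zero]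

end SmoothCalculus

/-! ## Functions of the logarithmic coordinates -/

namespace ToricKahler

open SmoothCalculus

set_option linter.unusedSectionVars false

variable {N : Type*} [Fintype N] [DecidableEq N]

/-- The logarithmic coordinates `log |z_a|²`. -/
def logNormSq (z : N → ℂ) (a : N) : ℝ := Real.log (‖z a‖ ^ 2)

/-- The coordinate directions of `ℝ^N`. -/
abbrev stdDir (a : N) : N → ℝ := Pi.single a 1

theorem isOpen_nonvanishing : IsOpen {z : N → ℂ | ∀ a, z a ≠ 0} := by
  have : {z : N → ℂ | ∀ a, z a ≠ 0} = ⋂ a, {z | z a ≠ 0} := by ext; simp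
  rw [this]
  exact isOpen_iInter_of_finite fun a => isOpen_ne.preimage (continuous_apply a)

theorem eventually_nonvanishing {z : N → ℂ} (hz : ∀ a, z a ≠ 0) :
    ∀ᶠ y in nhds z, ∀ a, y a ≠ 0 := isOpen_nonvanishing.mem_nhds hz

theorem hasFDerivAt_logNormSq {z : N → ℂ} (hz : ∀ a, z a ≠ 0) (a : N) :
    HasFDerivAt (fun y : N → ℂ => logNormSq y a)
      ((‖z a‖ ^ 2)⁻¹ • ((2 * (z a).re) • Complex.reCLM + (2 * (z a).im) • Complex.imCLM).comp
        (ContinuousLinearMap.proj (R := ℝ) (φ := fun _ : N => ℂ) a)) z := by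
  have h0 : HasFDerivAt (fun c : ℂ => ‖c‖ ^ 2)
      ((2 * (z a).re) • Complex.reCLM + (2 * (z a).im) • Complex.imCLM) (z a) := by
    have h1 := (Complex.reCLM.hasFDerivAt (x := z a)).pow 2
    have h2 := (Complex.imCLM.hasFDerivAt (x := z a)).pow 2
    have h3 := h1.add h2
    refine (h3.congr_fderiv ?_).congr_of_eventuallyEq (Filter.Eventually.of_forall fun c => ?_)
    · simp [two_mul]
    · simp only [Complex.sq_norm, Complex.normSq_apply, Pi.add_apply,
        Complex.reCLM_apply, Complex.imCLM_apply]
      ring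
  have h1 : HasFDerivAt (fun y : N → ℂ => ‖y a‖ ^ 2) _ z :=
    HasFDerivAt.comp (f := fun y : N → ℂ => y a) z h0 (hasFDerivAt_apply a z)
  exact h1.log (by simpa using hz a)

theorem differentiableAt_logNormSq {z : N → ℂ} (hz : ∀ a, z a ≠ 0) :
    DifferentiableAt ℝ (logNormSq (N := N)) z :=
  differentiableAt_pi.2 fun a => (hasFDerivAt_logNormSq hz a).differentiableAt

theorem fderiv_comp_logNormSq {z : N → ℂ} (hz : ∀ a, z a ≠ 0) {k : (N → ℝ) → ℝ} (hk : Smooth k)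
    (a : N) (c : ℂ) :
    fderiv ℝ (fun y => (k (logNormSq y) : ℂ)) z (Pi.single a c) =
      (dirDeriv (stdDir a) k (logNormSq z) * ((‖z a‖ ^ 2)⁻¹ *
        (2 * (z a).re * c.re + 2 * (z a).im * c.im)) : ℝ) := by
  have h1 : HasFDerivAt (fun y : N → ℂ => logNormSq y)
      (ContinuousLinearMap.pi fun b => ((‖z b‖ ^ 2)⁻¹ • ((2 * (z b).re) • Complex.reCLM +
        (2 * (z b).im) • Complex.imCLM).comp
        (ContinuousLinearMap.proj (R := ℝ) (φ := fun _ : N => ℂ) b))) z :=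
    hasFDerivAt_pi.2 fun b => hasFDerivAt_logNormSq hz b
  have h2 : HasFDerivAt (fun y => (k (logNormSq y) : ℂ)) _ z :=
    Complex.ofRealCLM.hasFDerivAt.comp z ((hk.diff (logNormSq z)).hasFDerivAt.comp z h1)
  rw [h2.fderiv]
  simp only [ContinuousLinearMap.comp_apply, Complex.ofRealCLM_apply]
  congr 1
  have : (ContinuousLinearMap.pi fun b => ((‖z b‖ ^ 2)⁻¹ • ((2 * (z b).re) • Complex.reCLM +
        (2 * (z b).im) • Complex.imCLM).comp
        (ContinuousLinearMap.proj (R := ℝ) (φ := fun _ : N => ℂ) b))) (Pi.single a c) =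
      ((‖z a‖ ^ 2)⁻¹ * (2 * (z a).re * c.re + 2 * (z a).im * c.im)) • stdDir a := by
    ext b
    by_cases h : b = a
    · subst h; simp; ring
    · simp [Pi.single_eq_of_ne h]
  rw [this, map_smul, smul_eq_mul, mul_comm]
  rfl

/-- On functions of log|z|² the operator z_a ∂/∂z_a acts as the real derivative ∂/∂ξ_a, since x - iy
over |z|² is 1/z. -/
theorem dz_comp_logNormSq {z : N → ℂ} (hz : ∀ a, z a ≠ 0) {k : (N → ℝ) → ℝ} (hk : Smooth k)
    (a : N) :
    dz (fun y => (k (logNormSq y) : ℂ)) a z = dirDeriv (stdDir a) k (logNormSq z) / z a := by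
  unfold dz
  rw [fderiv_comp_logNormSq hz hk, fderiv_comp_logNormSq hz hk]
  have h1 : (starRingEnd ℂ) (z a) ≠ 0 := by simpa using hz a
  have h2 : (((‖z a‖ : ℂ)) ^ 2)⁻¹ * ((z a).re - Complex.I * (z a).im) = (z a)⁻¹ := by
    have : ((z a).re - Complex.I * (z a).im : ℂ) = (starRingEnd ℂ) (z a) := by
      apply Complex.ext <;> simp
    rw [this, ← Complex.mul_conj', mul_inv, mul_assoc, inv_mul_cancel₀ h1, mul_one]
  rw [div_eq_mul_inv _ (z a), ← h2]
  simp only [Complex.one_re, Complex.one_im, Complex.I_re, Complex.I_im]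
  push_cast
  ring

theorem dzbar_comp_logNormSq {z : N → ℂ} (hz : ∀ a, z a ≠ 0) {k : (N → ℝ) → ℝ} (hk : Smooth k)
    (a : N) :
    dzbar (fun y => (k (logNormSq y) : ℂ)) a z =
      dirDeriv (stdDir a) k (logNormSq z) / (starRingEnd ℂ) (z a) := by
  unfold dzbar
  rw [fderiv_comp_logNormSq hz hk, fderiv_comp_logNormSq hz hk]
  have h1 : z a ≠ 0 := hz a
  have h2 : (((‖z a‖ : ℂ)) ^ 2)⁻¹ * ((z a).re + Complex.I * (z a).im) =
      ((starRingEnd ℂ) (z a))⁻¹ := by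
    have : ((z a).re + Complex.I * (z a).im : ℂ) = z a := by
      apply Complex.ext <;> simp
    rw [this, ← Complex.mul_conj', mul_inv, mul_comm (z a)⁻¹, mul_assoc, inv_mul_cancel₀ h1,
      mul_one]
  rw [div_eq_mul_inv _ ((starRingEnd ℂ) (z a)), ← h2]
  simp only [Complex.one_re, Complex.one_im, Complex.I_re, Complex.I_im]
  push_cast
  ring

theorem dz_congr {F G : (N → ℂ) → ℂ} {z : N → ℂ} (h : F =ᶠ[nhds z] G) (a : N) :
    dz F a z = dz G a z := by unfold dz; rw [h.fderiv_eq]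

theorem dzbar_congr {F G : (N → ℂ) → ℂ} {z : N → ℂ} (h : F =ᶠ[nhds z] G) (a : N) :
    dzbar F a z = dzbar G a z := by unfold dzbar; rw [h.fderiv_eq]

theorem complexHessian_congr {F G : (N → ℂ) → ℝ} {z : N → ℂ} (h : F =ᶠ[nhds z] G) :
    complexHessian F z = complexHessian G z := by
  ext a b
  simp only [complexHessian, Matrix.of_apply]
  refine dz_congr (h.eventuallyEq_nhds.mono fun y hy => dzbar_congr ?_ b) a
  exact hy.mono fun x hx => by simp only [hx]

theorem dz_mul {F G : (N → ℂ) → ℂ} {z : N → ℂ} (hF : DifferentiableAt ℝ F z)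
    (hG : DifferentiableAt ℝ G z) (a : N) :
    dz (fun y => F y * G y) a z = dz F a z * G z + F z * dz G a z := by
  unfold dz
  rw [fderiv_fun_mul hF hG]
  simp only [_root_.add_apply, _root_.smul_apply, smul_eq_mul]
  ring

/-- A holomorphic function of one coordinate. -/
theorem dz_comp_apply {p : ℂ → ℂ} {p' : ℂ} {z : N → ℂ} (b : N) (hp : HasDerivAt p p' (z b)) (a : N) :
    dz (fun y => p (y b)) a z = if a = b then p' else 0 := by
  have h : HasFDerivAt (fun y : N → ℂ => p (y b)) _ z :=
    HasFDerivAt.comp (f := fun y : N → ℂ => y b) z (hp.hasFDerivAt.restrictScalars ℝ)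
      (hasFDerivAt_apply b z)
  unfold dz
  rw [h.fderiv]
  by_cases hab : a = b
  · subst hab
    simp
    linear_combination (-p' / 2) * Complex.I_mul_I
  · simp [hab]

/-- An antiholomorphic function of one coordinate. -/
theorem dz_comp_conj_apply {p : ℂ → ℂ} {p' : ℂ} {z : N → ℂ} (b : N)
    (hp : HasDerivAt p p' ((starRingEnd ℂ) (z b))) (a : N) :
    dz (fun y => p ((starRingEnd ℂ) (y b))) a z = 0 := by
  have h : HasFDerivAt (fun y : N → ℂ => p ((starRingEnd ℂ) (y b))) _ z :=
    HasFDerivAt.comp (f := fun y : N → ℂ => (starRingEnd ℂ) (y b)) z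
      (hp.hasFDerivAt.restrictScalars ℝ)
      (HasFDerivAt.comp (f := fun y : N → ℂ => y b) z Complex.conjCLE.hasFDerivAt
        (hasFDerivAt_apply b z))
  unfold dz
  rw [h.fderiv]
  by_cases hab : a = b
  · subst hab
    simp
    linear_combination p' * Complex.I_mul_I
  · simp [Pi.single_eq_of_ne (Ne.symm hab)]

theorem differentiableAt_comp_logNormSq {z : N → ℂ} (hz : ∀ a, z a ≠ 0) {k : (N → ℝ) → ℝ}
    (hk : Smooth k) : DifferentiableAt ℝ (fun y => (k (logNormSq y) : ℂ)) z :=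
  Complex.ofRealCLM.differentiableAt.comp z
    ((hk.diff (logNormSq z)).comp z (differentiableAt_logNormSq hz))

theorem differentiableAt_conj_inv {z : N → ℂ} {b : N} (hz : z b ≠ 0) :
    DifferentiableAt ℝ (fun y : N → ℂ => ((starRingEnd ℂ) (y b))⁻¹) z := by
  have h : DifferentiableAt ℝ (fun y : N → ℂ => (starRingEnd ℂ) (y b)) z :=
    Complex.conjCLE.differentiableAt.comp z (differentiableAt_apply b z)
  exact h.fun_inv (by simpa using hz)

theorem dz_conj_inv {z : N → ℂ} {b : N} (hz : z b ≠ 0) (a : N) :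
    dz (fun y : N → ℂ => ((starRingEnd ℂ) (y b))⁻¹) a z = 0 :=
  dz_comp_conj_apply (p := fun c => c⁻¹) b (hasDerivAt_inv (by simpa using hz)) a

theorem dz_comp_logNormSq_mul_conj_inv {z : N → ℂ} (hz : ∀ a, z a ≠ 0) {k : (N → ℝ) → ℝ}
    (hk : Smooth k) (a b : N) :
    dz (fun y => (k (logNormSq y) : ℂ) * ((starRingEnd ℂ) (y b))⁻¹) a z =
      dirDeriv (stdDir a) k (logNormSq z) / z a * ((starRingEnd ℂ) (z b))⁻¹ := by
  rw [dz_mul (differentiableAt_comp_logNormSq hz hk) (differentiableAt_conj_inv (hz b)),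
    dz_comp_logNormSq hz hk, dz_conj_inv (hz b), mul_zero, add_zero]

/-- The first derivative brings out 1/z̄_b, which is antiholomorphic and hence passes through
∂/∂z_a. Only the real function is differentiated again. -/
theorem complexHessian_comp_logNormSq {z : N → ℂ} (hz : ∀ a, z a ≠ 0) {k : (N → ℝ) → ℝ}
    (hk : Smooth k) (a b : N) :
    complexHessian (fun y => k (logNormSq y)) z a b =
      (z a)⁻¹ * (hessMat stdDir k (logNormSq z) a b : ℂ) * ((starRingEnd ℂ) (z b))⁻¹ := by
  simp only [complexHessian, Matrix.of_apply]
  have : (dzbar (fun y => (k (logNormSq y) : ℂ)) b) =ᶠ[nhds z]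
      fun y => (dirDeriv (stdDir b) k (logNormSq y) : ℂ) * ((starRingEnd ℂ) (y b))⁻¹ :=
    (eventually_nonvanishing hz).mono fun y hy => by
      rw [dzbar_comp_logNormSq hy hk, div_eq_mul_inv]
  rw [dz_congr this, dz_comp_logNormSq_mul_conj_inv hz (hk.dirDeriv _)]
  simp only [hessMat, Matrix.of_apply]
  ring

/-! ### Curvature quantities of an invariant metric in logarithmic coordinates. -/

section Metric

variable {f : (N → ℝ) → ℝ} {g : (N → ℂ) → Matrix N N ℂ}

/-- The metric with coefficients `f_{ab} / (z_a z̄_b)` in the coordinates `z`. -/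
def IsLogMetric (f : (N → ℝ) → ℝ) (g : (N → ℂ) → Matrix N N ℂ) : Prop :=
  ∀ z : N → ℂ, (∀ a, z a ≠ 0) → ∀ a b,
    g z a b = (z a)⁻¹ * (hessMat stdDir f (logNormSq z) a b : ℂ) * ((starRingEnd ℂ) (z b))⁻¹

theorem IsLogMetric.eq_diagonal (hg : IsLogMetric f g) {z : N → ℂ} (hz : ∀ a, z a ≠ 0) :
    g z = Matrix.diagonal (fun a => (z a)⁻¹) *
      (hessMat stdDir f (logNormSq z)).map Complex.ofReal *
      Matrix.diagonal (fun a => ((starRingEnd ℂ) (z a))⁻¹) := by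
  ext a b
  rw [hg z hz, Matrix.mul_diagonal, Matrix.diagonal_mul, Matrix.map_apply]

theorem IsLogMetric.det (hg : IsLogMetric f g) {z : N → ℂ} (hz : ∀ a, z a ≠ 0) :
    (g z).det = (((hessMat stdDir f (logNormSq z)).det * ∏ a, (‖z a‖ ^ 2)⁻¹ : ℝ) : ℂ) := by
  rw [hg.eq_diagonal hz, Matrix.det_mul, Matrix.det_mul, Matrix.det_diagonal,
    Matrix.det_diagonal]
  have : ((hessMat stdDir f (logNormSq z)).map Complex.ofReal).det =
      ((hessMat stdDir f (logNormSq z)).det : ℂ) :=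
    (RingHom.map_det Complex.ofRealHom _).symm
  rw [this]
  push_cast
  have h2 : ∀ a, (((‖z a‖ : ℂ)) ^ 2)⁻¹ = (z a)⁻¹ * ((starRingEnd ℂ) (z a))⁻¹ := fun a => by
    rw [← Complex.mul_conj', mul_inv]
  simp only [h2, Finset.prod_mul_distrib]
  ring

theorem IsLogMetric.volumeDensity (hg : IsLogMetric f g) {z : N → ℂ} (hz : ∀ a, z a ≠ 0) :
    volumeDensity g z =
      2 ^ Fintype.card N * ((hessMat stdDir f (logNormSq z)).det * ∏ a, (‖z a‖ ^ 2)⁻¹) := by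
  rw [ToricKahler.volumeDensity, hg.det hz, Complex.ofReal_re]

theorem IsLogMetric.inv_apply (hg : IsLogMetric f g) {z : N → ℂ} (hz : ∀ a, z a ≠ 0)
    (hd : (hessMat stdDir f (logNormSq z)).det ≠ 0) (a b : N) :
    (g z)⁻¹ a b = (starRingEnd ℂ) (z a) *
      ((hessMat stdDir f (logNormSq z))⁻¹ a b : ℂ) * z b := by
  have : (g z)⁻¹ = Matrix.diagonal (fun a => (starRingEnd ℂ) (z a)) *
      ((hessMat stdDir f (logNormSq z))⁻¹).map Complex.ofReal *
      Matrix.diagonal (fun a => z a) := by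
    apply Matrix.inv_eq_right_inv
    rw [hg.eq_diagonal hz]
    have h1 : Matrix.diagonal (fun a => ((starRingEnd ℂ) (z a))⁻¹) *
        Matrix.diagonal (fun a => (starRingEnd ℂ) (z a)) = 1 := by
      rw [Matrix.diagonal_mul_diagonal, ← Matrix.diagonal_one]
      congr 1; ext a
      exact inv_mul_cancel₀ (by simpa using hz a)
    have h2 : Matrix.diagonal (fun a => (z a)⁻¹) * Matrix.diagonal (fun a => z a) = 1 := by
      rw [Matrix.diagonal_mul_diagonal, ← Matrix.diagonal_one]
      congr 1; ext a
      exact inv_mul_cancel₀ (hz a)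
    have h3 : (hessMat stdDir f (logNormSq z)).map Complex.ofReal *
        ((hessMat stdDir f (logNormSq z))⁻¹).map Complex.ofReal = 1 := by
      have := congrArg (fun M => Complex.ofRealHom.mapMatrix M)
        (Matrix.mul_nonsing_inv _ (isUnit_iff_ne_zero.2 hd))
      simp only [map_mul, map_one] at this
      exact this
    calc _ = Matrix.diagonal (fun a => (z a)⁻¹) *
          ((hessMat stdDir f (logNormSq z)).map Complex.ofReal *
          ((Matrix.diagonal (fun a => ((starRingEnd ℂ) (z a))⁻¹) *
        Matrix.diagonal (fun a => (starRingEnd ℂ) (z a))) *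
        ((hessMat stdDir f (logNormSq z))⁻¹).map Complex.ofReal)) *
        Matrix.diagonal (fun a => z a) := by simp only [Matrix.mul_assoc]
      _ = 1 := by rw [h1, Matrix.one_mul, h3, Matrix.mul_one, h2]
  rw [this, Matrix.mul_diagonal, Matrix.diagonal_mul, Matrix.map_apply]

/-- Linear functions of log|z|² are pluriharmonic. They occur as the factor ∏|z_a|⁻² of the metric
determinant and as the linear term between the potential on the torus and the one in a chart. -/
theorem hessMat_sub_linear {k : (N → ℝ) → ℝ} (hk : Smooth k) (c : N → ℝ) (x : N → ℝ) :
    hessMat stdDir (fun y => k y - ∑ a, c a * y a) x = hessMat stdDir k x := by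
  have hy : ∀ a, Smooth fun y : N → ℝ => y a := fun a => contDiff_apply ℝ ℝ a
  have hl : Smooth fun y : N → ℝ => ∑ a, c a * y a :=
    ContDiff.sum fun a _ => contDiff_const.mul (hy a)
  have h1 : ∀ (b : N) (y : N → ℝ), dirDeriv (stdDir b) (fun y : N → ℝ => ∑ a, c a * y a) y
      = c b := by
    intro b y
    rw [dirDeriv_sum _ fun a => contDiff_const.mul (hy a)]
    have : ∀ a, dirDeriv (stdDir b) (fun y : N → ℝ => y a) y = if a = b then 1 else 0 := by
      intro a
      rw [dirDeriv, (hasFDerivAt_apply a y).fderiv]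
      simp [Pi.single_apply]
    simp [dirDeriv_const_mul (hy _), this]
  ext a b
  simp only [hessMat, Matrix.of_apply]
  have : dirDeriv (stdDir b) (fun y => k y - ∑ a, c a * y a) =
      fun y => dirDeriv (stdDir b) k y - c b := by
    ext y; rw [dirDeriv_sub hk hl, h1]
  rw [this, dirDeriv_sub (hk.dirDeriv _) contDiff_const, dirDeriv_const, sub_zero]

/-- The determinant of the metric is det D²f times ∏|z_a|⁻². The second factor has a pluriharmonic
logarithm and drops out. -/
theorem IsLogMetric.ricci (hf : Smooth f) (hpos : ∀ x, 0 < (hessMat stdDir f x).det)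
    (hg : IsLogMetric f g) {z : N → ℂ} (hz : ∀ a, z a ≠ 0) (a b : N) :
    ricci g z a b = -((z a)⁻¹ * (hessMat stdDir (logDet stdDir f) (logNormSq z) a b : ℂ) *
      ((starRingEnd ℂ) (z b))⁻¹) := by
  have hL : Smooth (logDet stdDir f) := logDet_smooth hf fun x => (hpos x).ne'
  have hK : Smooth fun y : N → ℝ => logDet stdDir f y - ∑ a, (1 : ℝ) * y a :=
    hL.sub (ContDiff.sum fun a _ => contDiff_const.mul (contDiff_apply ℝ ℝ a))
  have h : (fun y => Real.log (g y).det.re) =ᶠ[nhds z]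
      fun y => (fun x : N → ℝ => logDet stdDir f x - ∑ a, (1 : ℝ) * x a) (logNormSq y) := by
    refine (eventually_nonvanishing hz).mono fun y hy => ?_
    simp only [hg.det hy, Complex.ofReal_re]
    have hne : ∀ a, (‖y a‖ ^ 2)⁻¹ ≠ 0 := fun a => by simpa using hy a
    rw [Real.log_mul (hpos _).ne' (Finset.prod_ne_zero_iff.2 fun a _ => hne a),
      Real.log_prod fun a _ => hne a]
    simp [logDet, logNormSq, Real.log_inv, sub_eq_add_neg]
  rw [ToricKahler.ricci, Matrix.neg_apply, complexHessian_congr h,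
    complexHessian_comp_logNormSq hz hK, hessMat_sub_linear hL]

theorem IsLogMetric.scalarCurvature (hf : Smooth f) (hpos : ∀ x, 0 < (hessMat stdDir f x).det)
    (hg : IsLogMetric f g) {z : N → ℂ} (hz : ∀ a, z a ≠ 0) :
    scalarCurvature g z = ((-∑ a, ∑ b, (hessMat stdDir f (logNormSq z))⁻¹ a b *
      hessMat stdDir (logDet stdDir f) (logNormSq z) a b : ℝ) : ℂ) := by
  have hL : Smooth (logDet stdDir f) := logDet_smooth hf fun x => (hpos x).ne'
  rw [ToricKahler.scalarCurvature, Matrix.trace]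
  push_cast
  rw [← Finset.sum_neg_distrib]
  refine Finset.sum_congr rfl fun a _ => ?_
  rw [Matrix.diag_apply, Matrix.mul_apply, ← Finset.sum_neg_distrib]
  refine Finset.sum_congr rfl fun b _ => ?_
  rw [hg.inv_apply hz (hpos _).ne', hg.ricci hf hpos hz, hessMat_symm _ hL _ b a]
  have h1 := hz b
  have h3 : (starRingEnd ℂ) (z a) ≠ 0 := by simpa using hz a
  field_simp

/-- Only z_b⁻¹ and the Hessian entry depend on z holomorphically or through its modulus; the
Kronecker term is the derivative of z_b⁻¹. -/
theorem IsLogMetric.dz_apply (hf : Smooth f) (hg : IsLogMetric f g) {z : N → ℂ}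
    (hz : ∀ a, z a ≠ 0) (a b e : N) :
    dz (fun y => g y b e) a z =
      (dirDeriv (stdDir a) (fun x => hessMat stdDir f x b e) (logNormSq z) : ℂ) *
        ((z a)⁻¹ * (z b)⁻¹ * ((starRingEnd ℂ) (z e))⁻¹)
      - (if a = b then 1 else 0) * ((hessMat stdDir f (logNormSq z) b e : ℂ) *
        ((z b)⁻¹ * (z b)⁻¹ * ((starRingEnd ℂ) (z e))⁻¹)) := by
  have hH := hessMat_smooth (stdDir (N := N)) hf b e
  have h : (fun y => g y b e) =ᶠ[nhds z] fun y => (fun c : ℂ => c⁻¹) (y b) *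
      ((hessMat stdDir f (logNormSq y) b e : ℂ) * ((starRingEnd ℂ) (y e))⁻¹) :=
    (eventually_nonvanishing hz).mono fun y hy => by simp only [hg y hy]; ring
  have hinv : DifferentiableAt ℝ (fun y : N → ℂ => (fun c : ℂ => c⁻¹) (y b)) z :=
    DifferentiableAt.fun_inv (differentiableAt_apply b z) (hz b)
  rw [dz_congr h, dz_mul hinv
    ((differentiableAt_comp_logNormSq hz hH).fun_mul (differentiableAt_conj_inv (hz e))),
    dz_comp_apply b (hasDerivAt_inv (hz b)), dz_comp_logNormSq_mul_conj_inv hz hH]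
  have h4 := hz a
  have h5 := hz b
  split_ifs with hab
  · subst hab
    field_simp
    ring
  · field_simp
    ring

/-- The Kronecker term of the Christoffel symbols cancels ∂_a X^a = θ_a. Symmetry of third
derivatives turns what remains into the derivative of log det D²f along θ. -/
theorem IsLogMetric.traceNabla (hf : Smooth f) (hpos : ∀ x, 0 < (hessMat stdDir f x).det)
    (hg : IsLogMetric f g) {z : N → ℂ} (hz : ∀ a, z a ≠ 0) (θ : N → ℝ) :
    traceNabla g (fun w j => (θ j : ℂ) * w j) z =
      ((∑ b, θ b * dirDeriv (stdDir b) (logDet stdDir f) (logNormSq z) : ℝ) : ℂ) := by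
  have hd : ∀ x, (hessMat stdDir f x).det ≠ 0 := fun x => (hpos x).ne'
  set x := logNormSq z with hx
  have h1 : ∀ a, dz (fun y : N → ℂ => (θ a : ℂ) * y a) a z = θ a := by
    intro a
    have := dz_comp_apply (N := N) (z := z) (p := fun c => (θ a : ℂ) * c) a
      ((hasDerivAt_id (z a)).const_mul (θ a : ℂ)) a
    simpa using this
  have hc : ∀ a b, christoffel g a a b z * ((θ b : ℂ) * z b) =
      ((θ b * ∑ e, dirDeriv (stdDir a) (fun y => hessMat stdDir f y b e) x *
        (hessMat stdDir f x)⁻¹ e a : ℝ) : ℂ)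
      - if a = b then ((θ b : ℝ) : ℂ) else 0 := by
    intro a b
    unfold christoffel
    have hterm : ∀ e, dz (fun y => g y b e) a z * (g z)⁻¹ e a =
        (dirDeriv (stdDir a) (fun y => hessMat stdDir f y b e) x *
          (hessMat stdDir f x)⁻¹ e a : ℂ) * (z b)⁻¹
        - (if a = b then (z b)⁻¹ else 0) *
          ((hessMat stdDir f x b e : ℂ) * ((hessMat stdDir f x)⁻¹ e a : ℂ)) := by
      intro e
      rw [hg.dz_apply hf hz, hg.inv_apply hz (hd _), ← hx]
      have h3 : (starRingEnd ℂ) (z e) ≠ 0 := by simpa using hz e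
      have h4 := hz a
      have h5 := hz b
      split_ifs with hab
      · subst hab
        field_simp
      · field_simp
        ring
    simp only [hterm]
    rw [Finset.sum_sub_distrib, ← Finset.sum_mul, ← Finset.mul_sum]
    have hN : ∑ e, (hessMat stdDir f x b e : ℂ) * ((hessMat stdDir f x)⁻¹ e a : ℂ) =
        if b = a then 1 else 0 := by
      have := congrFun (congrFun (Matrix.mul_nonsing_inv _ (isUnit_iff_ne_zero.2 (hd x))) b) a
      rw [Matrix.mul_apply, Matrix.one_apply] at this
      have h6 := congrArg (fun r : ℝ => (r : ℂ)) this
      push_cast at h6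
      rw [h6]
      split_ifs <;> simp
    rw [hN]
    have h5 := hz b
    push_cast
    by_cases hab : a = b
    · subst hab
      simp only [if_true]
      field_simp
    · simp only [hab, if_false]
      field_simp
      ring
  unfold ToricKahler.traceNabla
  simp only [h1, hc, Finset.sum_sub_distrib, Finset.sum_add_distrib]
  simp only [Finset.sum_ite_eq, Finset.mem_univ, if_true]
  -- This is the cancellation of ∂_a X^a with the Kronecker term.
  rw [add_sub_cancel, ← Finset.sum_comm]
  push_cast
  refine Finset.sum_congr rfl fun b _ => ?_
  rw [← Finset.mul_sum, dirDeriv_logDet hf hd]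
  push_cast
  congr 1
  refine Finset.sum_congr rfl fun a _ => Finset.sum_congr rfl fun e _ => ?_
  have : dirDeriv (stdDir a) (fun y => hessMat stdDir f y b e) x =
      dirDeriv (stdDir b) (fun y => hessMat stdDir f y a e) x :=
    dirDeriv_comm (hf.dirDeriv (stdDir e)) _ _ _
  rw [this, hessMat_inv_symm _ hf, mul_comm]

/-- The integrand of the modified K-energy in logarithmic coordinates. -/
theorem IsLogMetric.bracket (hf : Smooth f) (hpos : ∀ x, 0 < (hessMat stdDir f x).det)
    (hg : IsLogMetric f g) {z : N → ℂ} (hz : ∀ a, z a ≠ 0) (θ : N → ℝ) :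
    ToricKahler.scalarCurvature g z - (Fintype.card N : ℂ) - ToricKahler.traceNabla g (fun w j => (θ j : ℂ) * w j) z
      + ((∑ a, θ a * dirDeriv (stdDir a)
          (fun x => ricciPot stdDir f x - momentTheta stdDir θ f x) (logNormSq z) : ℝ) : ℂ) =
      (weightedLaplacian stdDir θ f
        (fun x => ricciPot stdDir f x - momentTheta stdDir θ f x) (logNormSq z) : ℂ) := by
  have hd : ∀ x, (hessMat stdDir f x).det ≠ 0 := fun x => (hpos x).ne'
  have hL : Smooth (logDet stdDir f) := logDet_smooth hf hd
  have hR : Smooth (ricciPot stdDir f) := ricciPot_smooth hf hd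
  have hT : Smooth (momentTheta stdDir θ f) := momentTheta_smooth hf
  rw [hg.scalarCurvature hf hpos hz, hg.traceNabla hf hpos hz]
  set x := logNormSq z
  unfold weightedLaplacian
  -- Tracing this identity with the inverse Hessian produces, term by term, the scalar curvature, -n
  -- and -tr ∇X.
  have hH : ∀ a b, hessMat stdDir (fun x => ricciPot stdDir f x - momentTheta stdDir θ f x) x a b =
      -hessMat stdDir (logDet stdDir f) x a b - hessMat stdDir f x a b
        - ∑ c, θ c * dirDeriv (stdDir c) (fun y => hessMat stdDir f y a b) x := by
    intro a b
    have h1 : dirDeriv (stdDir b) (fun x => ricciPot stdDir f x - momentTheta stdDir θ f x) =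
        fun y => -dirDeriv (stdDir b) (logDet stdDir f) y - dirDeriv (stdDir b) f y
          - ∑ c, θ c * dirDeriv (stdDir b) (dirDeriv (stdDir c) f) y := by
      ext y
      rw [dirDeriv_sub hR hT, dirDeriv_momentTheta hf]
      unfold ricciPot
      rw [dirDeriv_sub hL.neg hf, dirDeriv_neg]
    have hs : ∀ c, Smooth fun y => θ c * dirDeriv (stdDir b) (dirDeriv (stdDir c) f) y :=
      fun c => contDiff_const.mul ((hf.dirDeriv _).dirDeriv _)
    simp only [hessMat, Matrix.of_apply]
    rw [h1, dirDeriv_sub ((hL.dirDeriv _).neg.sub (hf.dirDeriv _)) (ContDiff.sum fun c _ => hs c),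
      dirDeriv_sub (hL.dirDeriv _).neg (hf.dirDeriv _), dirDeriv_neg, dirDeriv_sum _ hs]
    congr 1
    refine Finset.sum_congr rfl fun c _ => ?_
    rw [dirDeriv_const_mul ((hf.dirDeriv _).dirDeriv _)]
    congr 1
    have h2 : dirDeriv (stdDir b) (dirDeriv (stdDir c) f) =
        dirDeriv (stdDir c) (dirDeriv (stdDir b) f) := by
      ext y; exact dirDeriv_comm hf _ _ _
    rw [h2]
    exact dirDeriv_comm (hf.dirDeriv _) _ _ _
  have hn : ∑ a, ∑ b, (hessMat stdDir f x)⁻¹ a b * hessMat stdDir f x a b =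
      Fintype.card N := by
    have : ∀ a, ∑ b, (hessMat stdDir f x)⁻¹ a b * hessMat stdDir f x a b = 1 := by
      intro a
      have := congrFun (congrFun (Matrix.nonsing_inv_mul _ (isUnit_iff_ne_zero.2 (hd x))) a) a
      rw [Matrix.mul_apply, Matrix.one_apply_eq] at this
      rw [← this]
      refine Finset.sum_congr rfl fun b _ => ?_
      rw [hessMat_symm _ hf x a b]
    simp [this]
  have hθ : ∑ a, ∑ b, (hessMat stdDir f x)⁻¹ a b *
        ∑ c, θ c * dirDeriv (stdDir c) (fun y => hessMat stdDir f y a b) x =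
      ∑ c, θ c * dirDeriv (stdDir c) (logDet stdDir f) x := by
    simp only [dirDeriv_logDet hf hd, Finset.mul_sum]
    rw [Finset.sum_comm_cycle]
    refine Finset.sum_congr rfl fun c _ => Finset.sum_congr rfl fun a _ =>
      Finset.sum_congr rfl fun b _ => ?_
    ring
  simp only [hH, mul_sub, Finset.sum_sub_distrib, mul_neg, Finset.sum_neg_distrib, hn, hθ]
  push_cast
  ring

end Metric

end ToricKahler

/-! ## Combinatorics of Fano polytopes and their toric manifolds -/

namespace FanoPolytope

open ToricKahler SmoothCalculus

variable {n d : ℕ} (P : FanoPolytope n d)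

theorem isClosed_body : IsClosed P.body := by
  have : P.body = ⋂ i, {x | ∑ j, x j * (P.normal i j : ℝ) ≤ 1} := by
    ext x; simp [body]
  rw [this]
  exact isClosed_iInter fun i => isClosed_le (by fun_prop) continuous_const

theorem isCompact_body : IsCompact P.body :=
  Metric.isCompact_of_isClosed_isBounded P.isClosed_body P.bounded

theorem convex_body : Convex ℝ P.body := by
  intro x hx y hy a b ha hb hab i
  have h : ∑ j, (a • x + b • y) j * (P.normal i j : ℝ) =
      a * ∑ j, x j * (P.normal i j : ℝ) + b * ∑ j, y j * (P.normal i j : ℝ) := by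
    simp only [PiLp.add_apply, PiLp.smul_apply, smul_eq_mul, Finset.mul_sum,
      ← Finset.sum_add_distrib]
    exact Finset.sum_congr rfl fun j _ => by ring
  rw [h]
  nlinarith [mul_le_mul_of_nonneg_left (hx i) ha, mul_le_mul_of_nonneg_left (hy i) hb]

/-- Expand a standard basis vector in the ℤ-basis of normals. The sign in the definition makes the
edges point into P. -/
theorem sum_edge_mul_normal (v : P.Vertex) (j k : Fin n) :
    ∑ a, P.edge v a j * P.normal a.1 k = if j = k then -1 else 0 := by
  have h := congrFun ((P.normalBasis v).sum_repr (Pi.single j 1)) k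
  simp only [Finset.sum_apply, Pi.smul_apply, smul_eq_mul] at h
  have hb : ∀ a, P.normalBasis v a = P.normal a.1 := fun a => by simp [normalBasis]
  simp only [hb] at h
  simp only [edge, neg_mul, Finset.sum_neg_distrib, h, Pi.single_apply]
  by_cases hjk : j = k
  · simp [hjk]
  · simp [hjk, Ne.symm hjk]

theorem sum_edge_mul_normal' (v : P.Vertex) (a b : P.Active v) :
    ∑ j, P.edge v a j * P.normal b.1 j = if a = b then -1 else 0 := by
  have h1 : P.normal b.1 = ∑ j, P.normal b.1 j • Pi.single j (1 : ℤ) := by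
    ext k; simp [Finset.sum_apply, Pi.single_apply]
  have hb : P.normalBasis v b = P.normal b.1 := by simp [normalBasis]
  have h2 := (P.normalBasis v).repr_self_apply b a
  rw [hb, h1] at h2
  simp only [map_sum, map_smul, Finsupp.coe_finsetSum, Finset.sum_apply, Finsupp.coe_smul,
    Pi.smul_apply, smul_eq_mul] at h2
  simp only [edge, neg_mul, Finset.sum_neg_distrib]
  have h3 : ∑ j, (P.normalBasis v).repr (Pi.single j 1) a * P.normal b.1 j =
      if b = a then 1 else 0 := by
    rw [← h2]; exact Finset.sum_congr rfl fun j _ => mul_comm _ _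
  rw [h3]
  by_cases hab : a = b
  · simp [hab]
  · simp [hab, Ne.symm hab]

/-- The matrix of the edge vectors at `v`. -/
def edgeMat (v : P.Vertex) : Matrix (P.Active v) (Fin n) ℝ := Matrix.of fun a j => (P.edge v a j : ℝ)

/-- The inverse of the matrix of edge vectors. -/
def normalMat (v : P.Vertex) : Matrix (Fin n) (P.Active v) ℝ :=
  Matrix.of fun j a => -(P.normal a.1 j : ℝ)

theorem edgeMat_mul_normalMat (v : P.Vertex) : P.edgeMat v * P.normalMat v = 1 := by
  ext a b
  have h := congrArg (fun z : ℤ => (z : ℝ)) (P.sum_edge_mul_normal' v a b)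
  push_cast at h
  simp only [Matrix.mul_apply, edgeMat, normalMat, Matrix.of_apply, mul_neg,
    Finset.sum_neg_distrib, h, Matrix.one_apply]
  split_ifs <;> simp

theorem normalMat_mul_edgeMat (v : P.Vertex) : P.normalMat v * P.edgeMat v = 1 := by
  ext j k
  have h := congrArg (fun z : ℤ => (z : ℝ)) (P.sum_edge_mul_normal v k j)
  push_cast at h
  have h2 : ∑ a : P.Active v, (P.normal a.1 j : ℝ) * (P.edge v a k : ℝ) =
      ∑ a : P.Active v, (P.edge v a k : ℝ) * (P.normal a.1 j : ℝ) :=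
    Finset.sum_congr rfl fun a _ => mul_comm _ _
  simp only [Matrix.mul_apply, edgeMat, normalMat, Matrix.of_apply, neg_mul,
    Finset.sum_neg_distrib, h2, h, Matrix.one_apply]
  by_cases hjk : j = k
  · simp [hjk]
  · simp [hjk, Ne.symm hjk]

/-- The logarithmic coordinates of the chart at `v`. -/
def edgeCoord (v : P.Vertex) (ξ : Fin n → ℝ) : P.Active v → ℝ := (P.edgeMat v).mulVec ξ

theorem normalMat_mulVec_edgeCoord (v : P.Vertex) (ξ : Fin n → ℝ) :
    (P.normalMat v).mulVec (P.edgeCoord v ξ) = ξ := by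
  rw [edgeCoord, Matrix.mulVec_mulVec, normalMat_mul_edgeMat, Matrix.one_mulVec]

/-- This is where the anticanonical normalization enters: every facet through v is at height one, so
inserting ⟨v, ℓ_a⟩ = 1 and using duality recovers -v. -/
theorem sum_edge (v : P.Vertex) (j : Fin n) : ∑ a, (P.edge v a j : ℝ) = -v.1 j := by
  have h : ∀ k, ∑ a, (P.edge v a j : ℝ) * (P.normal a.1 k : ℝ) = if j = k then -1 else 0 := by
    intro k
    have h := congrArg (fun z : ℤ => (z : ℝ)) (P.sum_edge_mul_normal v j k)
    push_cast at h
    exact h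
  calc ∑ a, (P.edge v a j : ℝ) = ∑ a, (P.edge v a j : ℝ) * ∑ k, v.1 k * (P.normal a.1 k : ℝ) := by
        refine Finset.sum_congr rfl fun a _ => ?_
        rw [a.2, mul_one]
    _ = ∑ k, v.1 k * ∑ a, (P.edge v a j : ℝ) * (P.normal a.1 k : ℝ) := by
        simp only [Finset.mul_sum]
        rw [Finset.sum_comm]
        exact Finset.sum_congr rfl fun k _ => Finset.sum_congr rfl fun a _ => by ring
    _ = -v.1 j := by simp [h]

theorem sum_edgeCoord (v : P.Vertex) (ξ : Fin n → ℝ) :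
    ∑ a, P.edgeCoord v ξ a = -∑ j, ξ j * v.1 j := by
  simp only [edgeCoord, Matrix.mulVec, dotProduct, edgeMat, Matrix.of_apply]
  rw [Finset.sum_comm, ← Finset.sum_neg_distrib]
  refine Finset.sum_congr rfl fun j _ => ?_
  rw [← Finset.sum_mul, sum_edge]; ring

/-- A vertex is recovered from the set of facets through it: its edges are dual to their normals,
and they sum to minus the vertex. -/
instance finite_vertex : Finite P.Vertex := by
  classical
  refine Finite.of_injective (β := Finset (Fin d))
    (fun v => Finset.univ.filter fun i => ∑ j, v.1 j * (P.normal i j : ℝ) = 1) ?_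
  intro v v' h
  have hiff : ∀ i, ∑ j, v.1 j * (P.normal i j : ℝ) = 1 ↔ ∑ j, v'.1 j * (P.normal i j : ℝ) = 1 := by
    intro i
    have := Finset.ext_iff.1 h i
    simpa using this
  apply Subtype.ext
  ext j
  have h1 : ∀ k, ∑ a, (P.edge v a j : ℝ) * (P.normal a.1 k : ℝ) = if j = k then -1 else 0 := by
    intro k
    have h := congrArg (fun z : ℤ => (z : ℝ)) (P.sum_edge_mul_normal v j k)
    push_cast at h
    exact h
  have h2 : ∑ a, (P.edge v a j : ℝ) = -v'.1 j := by
    calc ∑ a, (P.edge v a j : ℝ)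
        = ∑ a, (P.edge v a j : ℝ) * ∑ k, v'.1 k * (P.normal a.1 k : ℝ) := by
          refine Finset.sum_congr rfl fun a _ => ?_
          rw [(hiff a.1).1 a.2, mul_one]
      _ = ∑ k, v'.1 k * ∑ a, (P.edge v a j : ℝ) * (P.normal a.1 k : ℝ) := by
          simp only [Finset.mul_sum]
          rw [Finset.sum_comm]
          exact Finset.sum_congr rfl fun k _ => Finset.sum_congr rfl fun a _ => by ring
      _ = -v'.1 j := by simp [h1]
  have := P.sum_edge v j
  linarith

/-- The support of the normal fan: every linear form is maximal on `P` at a vertex. -/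
theorem exists_edgeCoord_nonpos (ξ : Fin n → ℝ) :
    ∃ v : P.Vertex, (∀ a, P.edgeCoord v ξ a ≤ 0) ∧
      ∀ x ∈ P.body, ∑ j, ξ j * x j ≤ ∑ j, ξ j * v.1 j := by
  let l : StrongDual ℝ (EuclideanSpace ℝ (Fin n)) :=
    ∑ j, ξ j • (EuclideanSpace.proj j : EuclideanSpace ℝ (Fin n) →L[ℝ] ℝ)
  have hl : ∀ x, l x = ∑ j, ξ j * x j := fun x => by simp [l]
  -- The face of P on which ξ is maximal is exposed, so any extreme point of it is a vertex of P.
  let A : Set (EuclideanSpace ℝ (Fin n)) := {x ∈ P.body | ∀ y ∈ P.body, l y ≤ l x}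
  have hA : IsExposed ℝ P.body A := fun _ => ⟨l, rfl⟩
  have hAc : IsCompact A := hA.isCompact P.isCompact_body
  have h0 : P.body.Nonempty := ⟨0, fun i => by simp⟩
  obtain ⟨x0, hx0, hmax⟩ := P.isCompact_body.exists_isMaxOn h0 l.continuous.continuousOn
  obtain ⟨v, hv⟩ := hAc.extremePoints_nonempty ⟨x0, hx0, fun y hy => hmax hy⟩
  have hvA : v ∈ A := hv.1
  have hvE : v ∈ Set.extremePoints ℝ P.body := hA.isExtreme.extremePoints_subset_extremePoints hv
  refine ⟨⟨v, hvE⟩, ?_, fun x hx => ?_⟩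
  · set V : P.Vertex := ⟨v, hvE⟩
    intro a
    let ev : EuclideanSpace ℝ (Fin n) := WithLp.toLp 2 fun j => (P.edge V a j : ℝ)
    have hev : ∀ i, ∀ ε : ℝ, ∑ j, (v + ε • ev) j * (P.normal i j : ℝ) =
        ∑ j, v j * (P.normal i j : ℝ) + ε * ∑ j, (P.edge V a j : ℝ) * (P.normal i j : ℝ) := by
      intro i ε
      rw [Finset.mul_sum, ← Finset.sum_add_distrib]
      refine Finset.sum_congr rfl fun j _ => ?_
      simp [ev]; ring
    -- A short move along an edge stays in P: active constraints do not increase and inactive ones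
    -- are strict. Maximality of ξ at v then forces the edge coordinate to be nonpositive.
    have hnear : ∀ᶠ ε in nhdsWithin (0 : ℝ) (Set.Ioi 0), v + ε • ev ∈ P.body := by
      have : ∀ i, ∀ᶠ ε in nhdsWithin (0 : ℝ) (Set.Ioi 0),
          ∑ j, (v + ε • ev) j * (P.normal i j : ℝ) ≤ 1 := by
        intro i
        simp only [hev]
        by_cases hi : ∑ j, v j * (P.normal i j : ℝ) = 1
        · filter_upwards [self_mem_nhdsWithin] with ε hε
          have h := congrArg (fun z : ℤ => (z : ℝ)) (P.sum_edge_mul_normal' V a ⟨i, hi⟩)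
          push_cast at h
          rw [hi, h]
          have hε' : (0 : ℝ) < ε := hε
          split_ifs <;> linarith
        · have hlt : ∑ j, v j * (P.normal i j : ℝ) < 1 := lt_of_le_of_ne (hvA.1 i) hi
          have hc : Filter.Tendsto (fun ε : ℝ => ∑ j, v j * (P.normal i j : ℝ) +
              ε * ∑ j, (P.edge V a j : ℝ) * (P.normal i j : ℝ)) (nhds 0)
              (nhds (∑ j, v j * (P.normal i j : ℝ) +
              0 * ∑ j, (P.edge V a j : ℝ) * (P.normal i j : ℝ))) :=
            (by fun_prop : Continuous fun ε : ℝ => ∑ j, v j * (P.normal i j : ℝ) +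
              ε * ∑ j, (P.edge V a j : ℝ) * (P.normal i j : ℝ)).tendsto 0
          rw [zero_mul, add_zero] at hc
          exact ((hc.eventually (gt_mem_nhds hlt)).filter_mono nhdsWithin_le_nhds).mono
            fun _ h => h.le
      exact (Filter.eventually_all.2 this).mono fun ε h i => h i
    obtain ⟨ε, hεb, hε⟩ := (hnear.and self_mem_nhdsWithin).exists
    have h := hvA.2 _ hεb
    rw [map_add, map_smul, smul_eq_mul] at h
    have h1 : l ev = P.edgeCoord V ξ a := by
      rw [hl]
      simp only [edgeCoord, Matrix.mulVec, dotProduct, edgeMat, Matrix.of_apply, ev]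
      exact Finset.sum_congr rfl fun j _ => mul_comm _ _
    rw [h1] at h
    have hε' : (0 : ℝ) < ε := hε
    nlinarith
  · have := hvA.2 x hx
    rwa [hl, hl] at this

/-- On a cone η ≤ 0 the sum of the |η_a| equals -∑ η_a, and the inverse coordinate change bounds ξ
by it. Finitely many vertices give a common constant. This is the rate of exponential decay in all
later estimates. -/
theorem exists_sum_edgeCoord_le : ∃ c > 0, ∀ (v : P.Vertex) (ξ : Fin n → ℝ),
    (∀ a, P.edgeCoord v ξ a ≤ 0) → ∑ a, P.edgeCoord v ξ a ≤ -(c * ‖ξ‖) := by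
  have h1 : ∀ v : P.Vertex, ∃ K > 0, ∀ ξ : Fin n → ℝ, (∀ a, P.edgeCoord v ξ a ≤ 0) →
      ‖ξ‖ ≤ K * -∑ a, P.edgeCoord v ξ a := by
    intro v
    -- The entries of the inverse matrix bound the norm; the summand 1 keeps the constant positive.
    refine ⟨1 + ∑ j, ∑ a, |P.normalMat v j a|, by positivity, fun ξ hξ => ?_⟩
    have hs0 : 0 ≤ -∑ a, P.edgeCoord v ξ a := by
      rw [← Finset.sum_neg_distrib]
      exact Finset.sum_nonneg fun a _ => by linarith [hξ a]
    refine (pi_norm_le_iff_of_nonneg (by positivity)).2 fun j => ?_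
    nth_rw 1 [← P.normalMat_mulVec_edgeCoord v ξ]
    rw [Real.norm_eq_abs, Matrix.mulVec, dotProduct]
    calc |∑ a, P.normalMat v j a * P.edgeCoord v ξ a|
        ≤ ∑ a, |P.normalMat v j a * P.edgeCoord v ξ a| := Finset.abs_sum_le_sum_abs _ _
      _ ≤ ∑ a, |P.normalMat v j a| * -∑ a, P.edgeCoord v ξ a := by
          refine Finset.sum_le_sum fun a _ => ?_
          rw [abs_mul, abs_of_nonpos (hξ a)]
          refine mul_le_mul_of_nonneg_left ?_ (abs_nonneg _)
          rw [← Finset.sum_neg_distrib]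
          exact Finset.single_le_sum (f := fun a => -P.edgeCoord v ξ a)
            (fun b _ => by linarith [hξ b]) (Finset.mem_univ a)
      _ = (∑ a, |P.normalMat v j a|) * -∑ a, P.edgeCoord v ξ a := by rw [Finset.sum_mul]
      _ ≤ _ := by
          refine mul_le_mul_of_nonneg_right ?_ hs0
          have : ∑ a, |P.normalMat v j a| ≤ ∑ j, ∑ a, |P.normalMat v j a| :=
            Finset.single_le_sum (f := fun j => ∑ a, |P.normalMat v j a|)
              (fun j _ => by positivity) (Finset.mem_univ j)
          linarith
  choose K hK0 hK using h1
  obtain ⟨M, hM⟩ := (Set.finite_range K).bddAbove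
  have hKM : ∀ v, K v ≤ M := fun v => hM ⟨v, rfl⟩
  have hM0 : 0 < M := (hK0 P.nonempty_vertex.some).trans_le (hKM _)
  refine ⟨M⁻¹, by positivity, fun v ξ hξ => ?_⟩
  have hs0 : 0 ≤ -∑ a, P.edgeCoord v ξ a := by
    rw [← Finset.sum_neg_distrib]
    exact Finset.sum_nonneg fun a _ => by linarith [hξ a]
  have h2 : ‖ξ‖ ≤ M * -∑ a, P.edgeCoord v ξ a :=
    (hK v ξ hξ).trans (mul_le_mul_of_nonneg_right (hKM v) hs0)
  have h3 : M⁻¹ * ‖ξ‖ ≤ M⁻¹ * (M * -∑ a, P.edgeCoord v ξ a) :=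
    mul_le_mul_of_nonneg_left h2 (by positivity)
  rw [← mul_assoc, inv_mul_cancel₀ hM0.ne', one_mul] at h3
  linarith

/-! ### Charts and the open orbit -/

theorem monomial_ne_zero (v : P.Vertex) {w : Fin n → ℂ} (hw : ∀ j, w j ≠ 0) (a : P.Active v) :
    P.monomial v w a ≠ 0 := Finset.prod_ne_zero_iff.2 fun j _ => zpow_ne_zero _ (hw j)

theorem monomial_mul (v : P.Vertex) (w w' : Fin n → ℂ) (a : P.Active v) :
    P.monomial v (fun j => w j * w' j) a = P.monomial v w a * P.monomial v w' a := by
  simp [monomial, mul_zpow, Finset.prod_mul_distrib]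

/-- The homogeneous coordinates of the chart at `v`. -/
def homCoord (v : P.Vertex) (y : P.Active v → ℂ) (i : Fin d) : ℂ :=
  if h : ∑ j, v.1 j * (P.normal i j : ℝ) = 1 then y ⟨i, h⟩ else 1

theorem prod_zpow_sum {ι κ : Type*} [Fintype ι] [Fintype κ] {w : κ → ℂ} (hw : ∀ k, w k ≠ 0)
    (p : ι → κ → ℤ) (q : ι → ℤ) :
    ∏ a, (∏ k, w k ^ p a k) ^ q a = ∏ k, w k ^ ∑ a, p a k * q a := by
  simp only [← Finset.prod_zpow, ← zpow_mul]
  rw [Finset.prod_comm]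
  refine Finset.prod_congr rfl fun k _ => ?_
  rw [Finset.prod_congr rfl fun a _ => rfl]
  induction (Finset.univ : Finset ι) using Finset.cons_induction with
  | empty => simp
  | cons a s ha ih => rw [Finset.prod_cons, Finset.sum_cons, ih, zpow_add₀ (hw k)]

theorem prod_homCoord (v : P.Vertex) (y : P.Active v → ℂ) (j : Fin n) :
    ∏ i, P.homCoord v y i ^ P.normal i j = ∏ a : P.Active v, y a ^ P.normal a.1 j := by
  rw [← Fintype.prod_subtype_mul_prod_subtype
    (fun i => ∑ j, v.1 j * (P.normal i j : ℝ) = 1)]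
  have h1 : ∏ i : {i : Fin d // ¬∑ j, v.1 j * (P.normal i j : ℝ) = 1},
      P.homCoord v y i ^ P.normal i j = 1 :=
    Finset.prod_eq_one fun i _ => by rw [homCoord, dif_neg i.2, one_zpow]
  rw [h1, mul_one]
  refine Finset.prod_congr rfl fun a _ => ?_
  rw [homCoord, dif_pos a.2]

theorem prod_homCoord_monomial (v : P.Vertex) {w : Fin n → ℂ} (hw : ∀ j, w j ≠ 0) (j : Fin n) :
    ∏ i, P.homCoord v (P.monomial v w) i ^ P.normal i j = (w j)⁻¹ := by
  rw [prod_homCoord]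
  simp only [monomial]
  rw [prod_zpow_sum hw]
  simp only [P.sum_edge_mul_normal]
  rw [Finset.prod_eq_single j (fun k _ hk => by simp [hk]) (by simp)]
  simp

theorem homCoord_ne_zero (v : P.Vertex) {y : P.Active v → ℂ} (hy : ∀ a, y a ≠ 0) (i : Fin d) :
    P.homCoord v y i ≠ 0 := by
  unfold homCoord
  split_ifs
  · exact hy _
  · exact one_ne_zero

/-- The ratio of the two systems of homogeneous coordinates lies in the group of the quotient,
because in both charts the invariant monomials ∏ x_i^{ℓ_ij} equal w_j⁻¹. -/
theorem chart_monomial_eq (v v' : P.Vertex) {w : Fin n → ℂ} (hw : ∀ j, w j ≠ 0) :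
    P.chart v (P.monomial v w) = P.chart v' (P.monomial v' w) := by
  apply Quotient.sound
  have h1 := P.homCoord_ne_zero v (P.monomial_ne_zero v hw)
  have h2 := P.homCoord_ne_zero v' (P.monomial_ne_zero v' hw)
  refine ⟨fun i => Units.mk0 (P.homCoord v' (P.monomial v' w) i / P.homCoord v (P.monomial v w) i)
    (div_ne_zero (h2 i) (h1 i)), fun j => ?_, fun i => ?_⟩
  · apply Units.ext
    push_cast
    simp only [Units.val_mk0, div_zpow, Finset.prod_div_distrib, P.prod_homCoord_monomial _ hw]
    exact div_self (inv_ne_zero (hw j))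
  · simp only [Units.val_mk0]
    exact (div_mul_cancel₀ _ (h1 i)).symm

theorem orbit_eq_chart (v : P.Vertex) {w : Fin n → ℂ} (hw : ∀ j, w j ≠ 0) :
    P.orbit w = P.chart v (P.monomial v w) := P.chart_monomial_eq _ v hw

/-- The point of the torus with coordinates `y` in the chart at `v`. -/
def torusPoint (v : P.Vertex) (y : P.Active v → ℂ) (j : Fin n) : ℂ :=
  ∏ a, y a ^ (-P.normal a.1 j)

theorem torusPoint_ne_zero (v : P.Vertex) {y : P.Active v → ℂ} (hy : ∀ a, y a ≠ 0) (j : Fin n) :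
    P.torusPoint v y j ≠ 0 := Finset.prod_ne_zero_iff.2 fun a _ => zpow_ne_zero _ (hy a)

theorem monomial_torusPoint (v : P.Vertex) {y : P.Active v → ℂ} (hy : ∀ a, y a ≠ 0) :
    P.monomial v (P.torusPoint v y) = y := by
  ext a
  simp only [monomial, torusPoint]
  rw [prod_zpow_sum hy]
  have h : ∀ b : P.Active v, ∑ j, -P.normal b.1 j * P.edge v a j = if a = b then 1 else 0 := by
    intro b
    have := P.sum_edge_mul_normal' v a b
    simp only [neg_mul, Finset.sum_neg_distrib]
    rw [Finset.sum_congr rfl fun j _ => mul_comm (P.normal b.1 j) (P.edge v a j), this]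
    split_ifs <;> simp
  simp only [h]
  rw [Finset.prod_eq_single a (fun b _ hb => by simp [Ne.symm hb]) (by simp)]
  simp

theorem logNormSq_monomial (v : P.Vertex) {w : Fin n → ℂ} (hw : ∀ j, w j ≠ 0) :
    logNormSq (P.monomial v w) = P.edgeCoord v (logNormSq w) := by
  ext a
  simp only [logNormSq, monomial, norm_prod, norm_zpow, edgeCoord, Matrix.mulVec, dotProduct,
    edgeMat, Matrix.of_apply, Real.log_pow]
  rw [Real.log_prod fun j _ => zpow_ne_zero _ (norm_ne_zero_iff.2 (hw j)), Finset.mul_sum]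
  refine Finset.sum_congr rfl fun j _ => ?_
  rw [Real.log_zpow]; ring

theorem logNormSq_torusPoint (v : P.Vertex) {y : P.Active v → ℂ} (hy : ∀ a, y a ≠ 0) :
    logNormSq (P.torusPoint v y) = (P.normalMat v).mulVec (logNormSq y) := by
  nth_rw 2 [← P.monomial_torusPoint v hy]
  rw [P.logNormSq_monomial v (P.torusPoint_ne_zero v hy), normalMat_mulVec_edgeCoord]

/-- The positive real point of `ℂ^N` with given logarithmic coordinates. -/
def expPoint {N : Type*} (η : N → ℝ) (a : N) : ℂ := (Real.exp (η a / 2) : ℂ)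

theorem expPoint_ne_zero {N : Type*} (η : N → ℝ) (a : N) : expPoint η a ≠ 0 := by
  simp [expPoint, Complex.exp_ne_zero]

theorem logNormSq_expPoint {N : Type*} (η : N → ℝ) : logNormSq (expPoint η) = η := by
  ext a
  simp only [logNormSq, expPoint, Complex.norm_real, Real.norm_eq_abs, Real.abs_exp, Real.log_pow,
    Real.log_exp]
  push_cast; ring

theorem monomial_expPoint (v : P.Vertex) (ξ : Fin n → ℝ) :
    P.monomial v (expPoint ξ) = expPoint (P.edgeCoord v ξ) := by
  ext a
  simp only [monomial, expPoint, edgeCoord, Matrix.mulVec, dotProduct, edgeMat, Matrix.of_apply]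
  have h : ∀ j, ((Real.exp (ξ j / 2) : ℝ) : ℂ) ^ P.edge v a j =
      ((Real.exp ((P.edge v a j : ℝ) * ξ j / 2) : ℝ) : ℂ) := by
    intro j
    rw [← Complex.ofReal_zpow, ← Real.rpow_intCast, ← Real.exp_mul]
    congr 2; ring
  simp only [h]
  rw [← Complex.ofReal_prod, ← Real.exp_sum, Finset.sum_div]

/-- Polar decomposition: w arises from the positive point with the same moduli by rotating through
its arguments. Invariance is demanded only where no coordinate vanishes, since the potential of the
metric is controlled only there. -/
theorem apply_orbit_eq {F : P.Manifold → ℝ}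
    (hF : ∀ v s y, (∀ a, y a ≠ 0) → F (P.chart v (P.rotate v s y)) = F (P.chart v y))
    {w : Fin n → ℂ} (hw : ∀ j, w j ≠ 0) :
    F (P.orbit w) = F (P.orbit (expPoint (logNormSq w))) := by
  let v := P.nonempty_vertex.some
  let s : Fin n → Circle := fun j => Circle.exp (w j).arg
  have hs : (fun j => ((s j : Circle) : ℂ) * expPoint (logNormSq w) j) = w := by
    ext j
    have h1 : expPoint (logNormSq w) j = ‖w j‖ := by
      simp only [expPoint, logNormSq, Real.log_pow]
      congr 1
      push_cast
      rw [mul_div_cancel_left₀ _ (two_ne_zero), Real.exp_log (norm_pos_iff.2 (hw j))]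
    rw [h1]
    simp only [s, Circle.coe_exp]
    rw [mul_comm, Complex.norm_mul_exp_arg_mul_I]
  have h2 : P.monomial v w = P.rotate v s (P.monomial v (expPoint (logNormSq w))) := by
    ext a
    nth_rw 1 [← hs]
    rw [monomial_mul]; rfl
  rw [P.orbit_eq_chart v hw, P.orbit_eq_chart v (expPoint_ne_zero _), h2,
    hF _ _ _ (P.monomial_ne_zero v (expPoint_ne_zero _))]

/-! ### Potentials on the torus and in the charts. -/

variable {P}

/-- The local Kähler potential of `ω_φ` in the chart at `v`. -/
def localPot (g : P.KahlerMetric) (φ : P.Manifold → ℝ) (v : P.Vertex) (y : P.Active v → ℂ) : ℝ :=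
  g.weight v y + φ (P.chart v y)

/-- The potential of `ω_φ` in the logarithmic coordinates `ξ ∈ ℝⁿ`. -/
def torusPot (g : P.KahlerMetric) (φ : P.Manifold → ℝ) (ξ : Fin n → ℝ) : ℝ :=
  logPotential g φ (WithLp.toLp 2 ξ)

theorem torusPot_eq (g : P.KahlerMetric) (φ : P.Manifold → ℝ) (ξ : Fin n → ℝ) :
    torusPot g φ ξ = g.pot (P.orbit (expPoint ξ)) + φ (P.orbit (expPoint ξ)) := rfl

/-- Invariance is assumed for the local weights; the correction ∑ log|y_a|² depends only on the
moduli and is invariant as well. -/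
theorem KahlerMetric.pot_rotate (g : P.KahlerMetric) (v : P.Vertex) (s : Fin n → Circle)
    (y : P.Active v → ℂ) (hy : ∀ a, y a ≠ 0) :
    g.pot (P.chart v (P.rotate v s y)) = g.pot (P.chart v y) := by
  have hs : ∀ a, P.monomial v (fun j => ((s j : Circle) : ℂ)) a ≠ 0 :=
    P.monomial_ne_zero v fun j => Circle.coe_ne_zero _
  have hn : ∀ a, ‖P.rotate v s y a‖ = ‖y a‖ := by
    intro a
    simp [rotate, monomial, norm_prod, norm_zpow, Circle.norm_coe]
  have h1 := g.weight_eq v y hy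
  have h2 := g.weight_eq v (P.rotate v s y) fun a => mul_ne_zero (hs a) (hy a)
  rw [g.invariant, h1] at h2
  simp only [hn] at h2
  linarith

theorem pot_orbit (g : P.KahlerMetric) {φ : P.Manifold → ℝ} (hφ : P.IsTorusInvariant φ)
    {w : Fin n → ℂ} (hw : ∀ j, w j ≠ 0) :
    g.pot (P.orbit w) + φ (P.orbit w) = torusPot g φ (logNormSq w) := by
  rw [torusPot_eq, P.apply_orbit_eq (F := g.pot) (fun v s y hy => g.pot_rotate v s y hy) hw,
    P.apply_orbit_eq (F := φ) (fun v s y _ => hφ v s y) hw]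

theorem localPot_eq (g : P.KahlerMetric) {φ : P.Manifold → ℝ} (hφ : P.IsTorusInvariant φ)
    (v : P.Vertex) {y : P.Active v → ℂ} (hy : ∀ a, y a ≠ 0) :
    localPot g φ v y =
      torusPot g φ ((P.normalMat v).mulVec (logNormSq y)) + ∑ a, logNormSq y a := by
  rw [← P.logNormSq_torusPoint v hy, ← pot_orbit g hφ (P.torusPoint_ne_zero v hy),
    P.orbit_eq_chart v (P.torusPoint_ne_zero v hy), P.monomial_torusPoint v hy, localPot,
    g.weight_eq v y hy]
  simp only [logNormSq]
  ring

/-- The change of frame from ∂_y to w∂_w multiplies the squared norm by ∏|y_a|². So up to a linear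
function of ξ, the potential is a smooth function of e^{η_a/2}. -/
theorem torusPot_eq_localPot (g : P.KahlerMetric) (φ : P.Manifold → ℝ) (v : P.Vertex)
    (ξ : Fin n → ℝ) :
    torusPot g φ ξ =
      localPot g φ v (expPoint (P.edgeCoord v ξ)) - ∑ a, P.edgeCoord v ξ a := by
  rw [torusPot_eq, P.orbit_eq_chart v (expPoint_ne_zero ξ), monomial_expPoint, localPot,
    g.weight_eq v _ (expPoint_ne_zero _)]
  have : ∑ a, Real.log (‖expPoint (P.edgeCoord v ξ) a‖ ^ 2) = ∑ a, P.edgeCoord v ξ a :=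
    Finset.sum_congr rfl fun a _ => congrFun (logNormSq_expPoint (P.edgeCoord v ξ)) a
  rw [this]; ring

end FanoPolytope

/-! ## Integration over the torus in logarithmic coordinates -/

namespace ToricKahler

open SmoothCalculus

set_option linter.unusedSectionVars false

variable {N : Type*} [Fintype N] [DecidableEq N]

/-- Substitute r_i = e^{ξ_i/2}: each Jacobian factor r_i/2 cancels r_i⁻¹ and leaves 1/2. -/
theorem integral_pi_Ioi_log {E : Type*} [NormedAddCommGroup E] [NormedSpace ℝ E]
    (H : (N → ℝ) → E) :
    ∫ r in Set.univ.pi fun _ : N => Set.Ioi (0 : ℝ), (∏ i, (r i)⁻¹) • H (fun i => Real.log (r i ^ 2))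
      = (2⁻¹ : ℝ) ^ Fintype.card N • ∫ ξ, H ξ := by
  let e : (N → ℝ) → N → ℝ := fun ξ i => Real.exp (ξ i / 2)
  let e' : (N → ℝ) → (N → ℝ) →L[ℝ] (N → ℝ) := fun ξ => ContinuousLinearMap.pi fun i =>
    ((Real.exp (ξ i / 2) / 2) • ContinuousLinearMap.id ℝ ℝ).comp
      (ContinuousLinearMap.proj (R := ℝ) (φ := fun _ : N => ℝ) i)
  have he : ∀ ξ ∈ (Set.univ : Set (N → ℝ)), HasFDerivWithinAt e (e' ξ) Set.univ ξ := by
    intro ξ _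
    refine (hasFDerivAt_pi.2 fun i => ?_).hasFDerivWithinAt
    have h1 : HasFDerivAt (fun t : ℝ => Real.exp (t / 2))
        ((Real.exp (ξ i / 2) / 2) • ContinuousLinearMap.id ℝ ℝ) (ξ i) := by
      have := (((hasDerivAt_id (ξ i)).div_const 2).exp).hasFDerivAt
      refine this.congr_fderiv ?_
      ext; simp; ring
    exact HasFDerivAt.comp (f := fun η : N → ℝ => η i) ξ h1 (hasFDerivAt_apply i ξ)
  have hinj : Set.InjOn e Set.univ := by
    intro ξ _ η _ h
    ext i
    have := congrFun h i
    simp only [e, Real.exp_eq_exp] at this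
    linarith
  have him : e '' Set.univ = Set.univ.pi fun _ : N => Set.Ioi (0 : ℝ) := by
    ext r
    simp only [Set.image_univ, Set.mem_range, Set.mem_pi, Set.mem_univ, true_imp_iff, Set.mem_Ioi]
    constructor
    · rintro ⟨ξ, rfl⟩ i
      exact Real.exp_pos _
    · intro hr
      refine ⟨fun i => 2 * Real.log (r i), ?_⟩
      ext i
      simp [e, Real.exp_log (hr i)]
  have hdet : ∀ ξ, (e' ξ).det = ∏ i, (Real.exp (ξ i / 2) / 2) := by
    intro ξ
    rw [ContinuousLinearMap.det_pi]
    simp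
  rw [← him, integral_image_eq_integral_abs_det_fderiv_smul volume MeasurableSet.univ he hinj,
    Measure.restrict_univ, ← integral_smul]
  congr 1
  ext ξ
  have h1 : (fun i => Real.log (e ξ i ^ 2)) = ξ := by
    ext i
    simp only [e, Real.log_pow, Real.log_exp]
    push_cast; ring
  rw [h1, smul_smul, hdet, abs_of_pos (Finset.prod_pos fun i _ => by positivity),
    ← Finset.prod_mul_distrib]
  congr 1
  have : ∀ i, Real.exp (ξ i / 2) / 2 * (e ξ i)⁻¹ = 2⁻¹ := fun i => by
    simp only [e]
    field_simp [(Real.exp_pos (ξ i / 2)).ne']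
  simp [this]

/-- In polar coordinates every variable contributes 2π from the angle and 1/2 from the logarithmic
radius, hence π. No integrability is required. -/
theorem integral_torus_comp_logNormSq {E : Type*} [NormedAddCommGroup E] [NormedSpace ℝ E]
    (H : (N → ℝ) → E) :
    ∫ w in {w : N → ℂ | ∀ a, w a ≠ 0}, (∏ a, (‖w a‖ ^ 2)⁻¹) • H (logNormSq w) =
      Real.pi ^ Fintype.card N • ∫ ξ, H ξ := by
  -- Off the torus some ‖w a‖ is zero, and the convention 0⁻¹ = 0 makes the integrand vanish there.
  have h0 : ∫ w in {w : N → ℂ | ∀ a, w a ≠ 0}, (∏ a, (‖w a‖ ^ 2)⁻¹) • H (logNormSq w) =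
      ∫ w : N → ℂ, (∏ a, (‖w a‖ ^ 2)⁻¹) • H (logNormSq w) := by
    refine setIntegral_eq_integral_of_forall_compl_eq_zero fun w hw => ?_
    obtain ⟨a, ha⟩ : ∃ a, w a = 0 := by simpa using hw
    rw [Finset.prod_eq_zero (Finset.mem_univ a) (by simp [ha]), zero_smul]
  rw [h0, ← Complex.integral_comp_pi_polarCoord_symm]
  let K : (N → ℝ) → E := fun r => (∏ i, (r i)⁻¹) • H (fun i => Real.log (r i ^ 2))
  have hmeas : MeasurableSet (Set.univ.pi fun _ : N => Complex.polarCoord.target) := by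
    rw [Complex.polarCoord_target]
    exact MeasurableSet.univ_pi fun _ => measurableSet_Ioi.prod measurableSet_Ioo
  have h1 : ∀ p ∈ (Set.univ.pi fun _ : N => Complex.polarCoord.target),
      (∏ i, (p i).1) • (∏ a, (‖Complex.polarCoord.symm (p a)‖ ^ 2)⁻¹) •
        H (logNormSq fun i => Complex.polarCoord.symm (p i)) = K (fun i => (p i).1) := by
    intro p hp
    have hpos : ∀ i, 0 < (p i).1 := fun i => by
      have := hp i (Set.mem_univ i)
      rw [Complex.polarCoord_target] at this
      exact this.1
    have hn : ∀ i, ‖Complex.polarCoord.symm (p i)‖ = (p i).1 := fun i => by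
      rw [Complex.norm_polarCoord_symm, abs_of_pos (hpos i)]
    have hl : (logNormSq fun i => Complex.polarCoord.symm (p i)) =
        fun i => Real.log ((p i).1 ^ 2) := by
      ext i; simp only [logNormSq, hn]
    rw [hl, smul_smul, ← Finset.prod_mul_distrib]
    simp only [hn, K]
    congr 1
    refine Finset.prod_congr rfl fun i _ => ?_
    have := (hpos i).ne'
    field_simp
  rw [setIntegral_congr_fun hmeas h1]
  let A := MeasurableEquiv.arrowProdEquivProdArrow ℝ ℝ N
  have hA : MeasurePreserving A := volume_measurePreserving_arrowProdEquivProdArrow ℝ ℝ N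
  have hset : (Set.univ.pi fun _ : N => Complex.polarCoord.target) =
      A ⁻¹' ((Set.univ.pi fun _ : N => Set.Ioi (0 : ℝ)) ×ˢ
        (Set.univ.pi fun _ : N => Set.Ioo (-Real.pi) Real.pi)) := by
    ext p
    simp only [Set.mem_pi, Set.mem_univ, true_imp_iff, Complex.polarCoord_target, Set.mem_prod,
      Set.mem_preimage]
    exact forall_and
  have h2 : (fun p : N → ℝ × ℝ => K fun i => (p i).1) =
      fun p => (fun z : (N → ℝ) × (N → ℝ) => K z.1) (A p) := rfl
  rw [h2, hset]
  refine (hA.setIntegral_preimage_emb A.measurableEmbedding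
    (fun z : (N → ℝ) × (N → ℝ) => K z.1) _).trans ?_
  rw [Measure.volume_eq_prod, ← Measure.prod_restrict, integral_fun_fst, integral_pi_Ioi_log, smul_smul]
  congr 1
  rw [measureReal_restrict_apply_univ, measureReal_def, volume_pi, Measure.pi_pi]
  simp only [Real.volume_Ioo, Finset.prod_const, Finset.card_univ, ENNReal.toReal_pow]
  rw [ENNReal.toReal_ofReal (by linarith [Real.pi_pos]), ← mul_pow]
  congr 1; ring

end ToricKahler

/-! ## Bounded pluriharmonic functions on the torus -/

namespace ToricKahler

open InnerProductSpace

set_option linter.unusedSectionVars false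

variable {N : Type*} [Fintype N] [DecidableEq N]

theorem two_le_smooth : (2 : WithTop ℕ∞) ≤ ((⊤ : ℕ∞) : WithTop ℕ∞) := by
  simpa using WithTop.coe_le_coe.2 (le_top (a := (2 : ℕ∞)))

theorem hasFDerivAt_update_single (w : N → ℂ) (a : N) (c : ℂ) :
    HasFDerivAt (fun c : ℂ => Function.update w a c)
      (ContinuousLinearMap.single ℝ (fun _ : N => ℂ) a) c := by
  refine (hasFDerivAt_update (𝕜 := ℝ) w c).congr_fderiv ?_
  ext v b
  by_cases h : b = a
  · subst h; simp
  · simp [h]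

/-- A second-order directional derivative. -/
theorem fderiv_fderiv_apply {k : (N → ℂ) → ℝ} {z : N → ℂ} (hk : ContDiffAt ℝ 2 k z)
    (u v : N → ℂ) :
    fderiv ℝ (fun y => fderiv ℝ k y v) z u = fderiv ℝ (fderiv ℝ k) z u v := by
  have h1 : DifferentiableAt ℝ (fderiv ℝ k) z :=
    (hk.fderiv_right (m := 1) (by norm_num)).differentiableAt (by norm_num)
  rw [fderiv_clm_apply h1 (differentiableAt_const v)]
  simp

theorem complexHessian_apply {k : (N → ℂ) → ℝ} {z : N → ℂ} (hk : ContDiffAt ℝ 2 k z) (a b : N) :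
    complexHessian k z a b =
      ((fderiv ℝ (fderiv ℝ k) z (Pi.single a 1) (Pi.single b 1) : ℝ) +
        Complex.I * (fderiv ℝ (fderiv ℝ k) z (Pi.single a 1) (Pi.single b Complex.I) : ℝ) -
        Complex.I * ((fderiv ℝ (fderiv ℝ k) z (Pi.single a Complex.I) (Pi.single b 1) : ℝ) +
        Complex.I * (fderiv ℝ (fderiv ℝ k) z (Pi.single a Complex.I) (Pi.single b Complex.I) : ℝ)))
        / 4 := by
  have h1 : DifferentiableAt ℝ (fderiv ℝ k) z :=
    (hk.fderiv_right (m := 1) (by norm_num)).differentiableAt (by norm_num)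
  have hv : ∀ v : N → ℂ, DifferentiableAt ℝ (fun y => fderiv ℝ k y v) z := fun v =>
    h1.clm_apply (differentiableAt_const v)
  have hev : ∀ᶠ y in nhds z, DifferentiableAt ℝ k y :=
    (hk.eventually (by simp)).mono fun y hy => hy.differentiableAt (by norm_num)
  have h2 : (dzbar (fun y => (k y : ℂ)) b) =ᶠ[nhds z] fun y =>
      ((fderiv ℝ k y (Pi.single b 1) : ℝ) + Complex.I *
        (fderiv ℝ k y (Pi.single b Complex.I) : ℝ)) / 2 := by
    filter_upwards [hev] with y hy
    have : HasFDerivAt (fun y => (k y : ℂ)) (Complex.ofRealCLM.comp (fderiv ℝ k y)) y :=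
      Complex.ofRealCLM.hasFDerivAt.comp y hy.hasFDerivAt
    simp only [dzbar, this.fderiv, ContinuousLinearMap.comp_apply, Complex.ofRealCLM_apply]
  have h3 : ∀ v : N → ℂ, HasFDerivAt (fun y => ((fderiv ℝ k y v : ℝ) : ℂ))
      (Complex.ofRealCLM.comp (fderiv ℝ (fun y => fderiv ℝ k y v) z)) z := fun v =>
    Complex.ofRealCLM.hasFDerivAt.comp z (hv v).hasFDerivAt
  have h4 : HasFDerivAt (fun y => ((fderiv ℝ k y (Pi.single b 1) : ℝ) + Complex.I *
        (fderiv ℝ k y (Pi.single b Complex.I) : ℝ)) / 2) _ z :=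
    ((h3 (Pi.single b 1)).add ((h3 (Pi.single b Complex.I)).const_mul Complex.I)).mul_const
      (2 : ℂ)⁻¹
  simp only [complexHessian, Matrix.of_apply]
  unfold dz
  rw [h2.fderiv_eq, h4.fderiv]
  simp only [_root_.smul_apply, _root_.add_apply, ContinuousLinearMap.comp_apply,
    Complex.ofRealCLM_apply, fderiv_fderiv_apply hk, smul_eq_mul]
  ring

/-- For a = b this is a quarter of the Laplacian in the single variable z_a, which links
pluriharmonic to harmonic. The general entry expresses the metric by real second derivatives. -/
theorem complexHessian_re {k : (N → ℂ) → ℝ} {z : N → ℂ} (hk : ContDiffAt ℝ 2 k z) (a b : N) :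
    (complexHessian k z a b).re = (fderiv ℝ (fderiv ℝ k) z (Pi.single a 1) (Pi.single b 1)
      + fderiv ℝ (fderiv ℝ k) z (Pi.single a Complex.I) (Pi.single b Complex.I)) / 4 := by
  rw [complexHessian_apply hk]
  simp

theorem complexHessian_sub {k l : (N → ℂ) → ℝ} {z : N → ℂ} (hk : ContDiffAt ℝ 2 k z)
    (hl : ContDiffAt ℝ 2 l z) :
    complexHessian (fun y => k y - l y) z = complexHessian k z - complexHessian l z := by
  have hd : ∀ {k : (N → ℂ) → ℝ}, ContDiffAt ℝ 2 k z → DifferentiableAt ℝ (fderiv ℝ k) z :=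
    fun hk => (hk.fderiv_right (m := 1) (by norm_num)).differentiableAt (by norm_num)
  have hev : ∀ {k : (N → ℂ) → ℝ}, ContDiffAt ℝ 2 k z → ∀ᶠ y in nhds z, DifferentiableAt ℝ k y :=
    fun hk => (hk.eventually (by simp)).mono fun y hy => hy.differentiableAt (by norm_num)
  have h1 : fderiv ℝ (fderiv ℝ fun y => k y - l y) z =
      fderiv ℝ (fderiv ℝ k) z - fderiv ℝ (fderiv ℝ l) z := by
    have h2 : (fderiv ℝ fun y => k y - l y) =ᶠ[nhds z] fun y => fderiv ℝ k y - fderiv ℝ l y := by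
      filter_upwards [hev hk, hev hl] with y hy hy'
      exact fderiv_fun_sub hy hy'
    rw [h2.fderiv_eq, fderiv_fun_sub (hd hk) (hd hl)]
  ext a b
  rw [Matrix.sub_apply, complexHessian_apply hk, complexHessian_apply hl,
    complexHessian_apply (hk.sub hl), h1]
  simp only [_root_.sub_apply, Complex.ofReal_sub]
  ring

/-- With all other coordinates frozen, k is a bounded harmonic function on the punctured plane.
Pulled back by the exponential it is bounded and harmonic on ℂ, hence constant by Liouville. -/
theorem apply_update_eq_of_pluriharmonic {k : (N → ℂ) → ℝ}
    (hk : ∀ w, (∀ a, w a ≠ 0) → ContDiffAt ℝ 2 k w)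
    (h0 : ∀ w, (∀ a, w a ≠ 0) → complexHessian k w = 0)
    {M : ℝ} (hb : ∀ w, (∀ a, w a ≠ 0) → |k w| ≤ M)
    {w : N → ℂ} (hw : ∀ a, w a ≠ 0) (a : N) {c : ℂ} (hc : c ≠ 0) :
    k (Function.update w a c) = k w := by
  have hupd : ∀ c : ℂ, c ≠ 0 → ∀ b, Function.update w a c b ≠ 0 := by
    intro c hc b
    by_cases h : b = a
    · subst h; simpa using hc
    · simpa [h] using hw b
  have hι : ∀ c : ℂ, HasFDerivAt (fun c : ℂ => Function.update w a c)
      (ContinuousLinearMap.single ℝ (fun _ : N => ℂ) a) c := by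
    intro c
    exact hasFDerivAt_update_single w a c
  have hιc : ContDiff ℝ (⊤ : ℕ∞) (fun c : ℂ => Function.update w a c) := contDiff_update (𝕜 := ℝ) _ w a
  let q : ℂ → ℝ := fun c => k (Function.update w a c)
  have hq : ∀ c : ℂ, c ≠ 0 → ContDiffAt ℝ 2 q c := fun c hc =>
    ContDiffAt.comp c (hk _ (hupd c hc)) (hιc.contDiffAt.of_le two_le_smooth)
  have hq1 : ∀ c : ℂ, c ≠ 0 → ∀ v, fderiv ℝ q c v =
      fderiv ℝ k (Function.update w a c) (Pi.single a v) := by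
    intro c hc v
    have h := ((hk _ (hupd c hc)).differentiableAt (by norm_num)).hasFDerivAt.comp c (hι c)
    have h' : HasFDerivAt q _ c := h
    rw [h'.fderiv]; rfl
  have hqΔ : ∀ c : ℂ, c ≠ 0 → Laplacian.laplacian q c = 0 := by
    intro c hc
    rw [laplacian_eq_iteratedFDeriv_complexPlane]
    simp only [iteratedFDeriv_two_apply, Matrix.cons_val_zero, Matrix.cons_val_one]
    have h2 : ∀ v : ℂ, fderiv ℝ (fderiv ℝ q) c v v =
        fderiv ℝ (fderiv ℝ k) (Function.update w a c) (Pi.single a v) (Pi.single a v) := by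
      intro v
      have hd : DifferentiableAt ℝ (fderiv ℝ q) c :=
        ((hq c hc).fderiv_right (m := 1) (by norm_num)).differentiableAt (by norm_num)
      have e1 : fderiv ℝ (fderiv ℝ q) c v v = fderiv ℝ (fun y => fderiv ℝ q y v) c v := by
        rw [fderiv_clm_apply hd (differentiableAt_const v)]; simp
      have e2 : (fun y => fderiv ℝ q y v) =ᶠ[nhds c]
          (fun x => fderiv ℝ k x (Pi.single a v)) ∘ fun c => Function.update w a c := by
        filter_upwards [isOpen_ne.mem_nhds hc] with y hy
        exact hq1 y hy v
      have hkd : DifferentiableAt ℝ (fun x => fderiv ℝ k x (Pi.single a v))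
          (Function.update w a c) :=
        (((hk _ (hupd c hc)).fderiv_right (m := 1) (by norm_num)).differentiableAt
          (by norm_num)).clm_apply (differentiableAt_const _)
      rw [e1, e2.fderiv_eq, (hkd.hasFDerivAt.comp c (hι c)).fderiv,
        ContinuousLinearMap.comp_apply, ContinuousLinearMap.single_apply,
        fderiv_fderiv_apply (hk _ (hupd c hc))]
    have h3 := complexHessian_re (hk _ (hupd c hc)) a a
    rw [h0 _ (hupd c hc), Matrix.zero_apply, Complex.zero_re] at h3
    rw [h2, h2]
    linarith
  have hharm : ∀ c : ℂ, c ≠ 0 → HarmonicAt q c := fun c hc =>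
    ⟨hq c hc, by filter_upwards [isOpen_ne.mem_nhds hc] with y hy using hqΔ y hy⟩
  let p : ℂ → ℝ := fun t => q (w a * Complex.exp t)
  have hne : ∀ t, w a * Complex.exp t ≠ 0 := fun t => mul_ne_zero (hw a) (Complex.exp_ne_zero t)
  have hp : HarmonicOnNhd p Set.univ := by
    intro t _
    obtain ⟨R, hR, hball⟩ := Metric.isOpen_iff.1 (isOpen_ne (x := (0 : ℂ))) _ (hne t)
    -- Locally q is the real part of a holomorphic function; composed with the holomorphic map t ↦
    -- w_a e^t, its real part is again harmonic.
    obtain ⟨F, hF, hFq⟩ := HarmonicOnNhd.exists_analyticOnNhd_ball_re_eq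
      (f := q) (z := w a * Complex.exp t) (R := R) fun y hy => hharm y (hball hy)
    have he : AnalyticAt ℂ (fun t => w a * Complex.exp t) t :=
      analyticAt_const.mul analyticAt_cexp
    have hFa : AnalyticAt ℂ (fun t => F (w a * Complex.exp t)) t :=
      AnalyticAt.comp (g := F) (f := fun t => w a * Complex.exp t)
        (hF _ (Metric.mem_ball_self hR)) he
    refine (harmonicAt_congr_nhds ?_).1 hFa.harmonicAt_re
    have := he.continuousAt.preimage_mem_nhds (Metric.ball_mem_nhds _ hR)
    filter_upwards [this] with y hy using hFq hy
  have hpb : Bornology.IsBounded (Set.range p) := by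
    refine (Metric.isBounded_closedBall (x := (0 : ℝ)) (r := M)).subset ?_
    rintro _ ⟨t, rfl⟩
    rw [mem_closedBall_zero_iff, Real.norm_eq_abs]
    exact hb _ (hupd _ (hne t))
  have hconst := bounded_harmonic_on_complex_plane_is_constant p hp hpb
    (Complex.log (c / w a)) 0
  have e1 : w a * Complex.exp (Complex.log (c / w a)) = c := by
    rw [Complex.exp_log (div_ne_zero hc (hw a)), mul_div_cancel₀ _ (hw a)]
  simp only [p, q, e1, Complex.exp_zero, mul_one, Function.update_eq_self] at hconst
  exact hconst

/-- A function on the torus that is invariant under changes of each coordinate is constant. -/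
theorem eq_of_apply_update_eq {α : Type*} {k : (N → ℂ) → α}
    (h : ∀ w, (∀ a, w a ≠ 0) → ∀ (a : N) (c : ℂ), c ≠ 0 → k (Function.update w a c) = k w)
    {w w' : N → ℂ} (hw : ∀ a, w a ≠ 0) (hw' : ∀ a, w' a ≠ 0) : k w = k w' := by
  have key : ∀ s : Finset N, k (fun a => if a ∈ s then w' a else w a) = k w := by
    intro s
    induction s using Finset.induction_on with
    | empty => simp
    | insert b s hb ih =>
      rw [← ih]
      have hne : ∀ a, (fun a => if a ∈ s then w' a else w a) a ≠ 0 := fun a => by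
        dsimp only; split_ifs
        · exact hw' a
        · exact hw a
      rw [← h _ hne b (w' b) (hw' b)]
      congr 1
      ext a
      by_cases hab : a = b
      · subst hab; simp
      · simp [hab]
  have := key Finset.univ
  simpa using this.symm

/-- Liouville's theorem on the torus. -/
theorem eq_of_bounded_pluriharmonic {k : (N → ℂ) → ℝ}
    (hk : ∀ w, (∀ a, w a ≠ 0) → ContDiffAt ℝ 2 k w)
    (h0 : ∀ w, (∀ a, w a ≠ 0) → complexHessian k w = 0)
    {M : ℝ} (hb : ∀ w, (∀ a, w a ≠ 0) → |k w| ≤ M)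
    {w w' : N → ℂ} (hw : ∀ a, w a ≠ 0) (hw' : ∀ a, w' a ≠ 0) : k w = k w' :=
  eq_of_apply_update_eq (fun _ hw a _ hc => apply_update_eq_of_pluriharmonic hk h0 hb hw a hc)
    hw hw'

/-- A real function on the torus with vanishing `∂̄` is constant. -/
theorem eq_of_dzbar_eq_zero {k : (N → ℂ) → ℝ}
    (hk : ∀ w, (∀ a, w a ≠ 0) → DifferentiableAt ℝ k w)
    (h0 : ∀ w, (∀ a, w a ≠ 0) → ∀ b, dzbar (fun y => (k y : ℂ)) b w = 0)
    {w w' : N → ℂ} (hw : ∀ a, w a ≠ 0) (hw' : ∀ a, w' a ≠ 0) : k w = k w' := by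
  refine eq_of_apply_update_eq (fun w hw a c hc => ?_) hw hw'
  -- For a real function, the real and imaginary parts of ∂̄k = 0 are the two real partial
  -- derivatives.
  have hfd : ∀ w, (∀ a, w a ≠ 0) → ∀ v : ℂ, fderiv ℝ k w (Pi.single a v) = 0 := by
    intro w hw v
    have h1 : HasFDerivAt (fun y => (k y : ℂ)) (Complex.ofRealCLM.comp (fderiv ℝ k w)) w :=
      Complex.ofRealCLM.hasFDerivAt.comp w (hk w hw).hasFDerivAt
    have h2 := h0 w hw a
    simp only [dzbar, h1.fderiv, ContinuousLinearMap.comp_apply, Complex.ofRealCLM_apply] at h2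
    have hre := congrArg Complex.re h2
    have him := congrArg Complex.im h2
    simp at hre him
    have : (Pi.single a v : N → ℂ) =
        v.re • (Pi.single a (1 : ℂ) : N → ℂ) + v.im • (Pi.single a Complex.I : N → ℂ) := by
      rw [← Pi.single_smul, ← Pi.single_smul, ← Pi.single_add]
      congr 1
      apply Complex.ext <;> simp
    rw [this, map_add, map_smul, map_smul, hre, him]
    simp
  have hupd : ∀ c : ℂ, c ≠ 0 → ∀ b, Function.update w a c b ≠ 0 := by
    intro c hc b
    by_cases h : b = a
    · subst h; simpa using hc
    · simpa [h] using hw b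
  -- The exponential replaces the punctured plane by ℂ, where a vanishing derivative gives
  -- constancy.
  let p : ℂ → ℝ := fun t => k (Function.update w a (Complex.exp t))
  have hp : ∀ t, HasFDerivAt p (0 : ℂ →L[ℝ] ℝ) t := by
    intro t
    have h1 : HasFDerivAt (fun c : ℂ => Function.update w a c)
      (ContinuousLinearMap.single ℝ (fun _ : N => ℂ) a) (Complex.exp t) := hasFDerivAt_update_single w a _
    have h2 : HasFDerivAt Complex.exp _ t :=
      (Complex.hasDerivAt_exp t).hasFDerivAt.restrictScalars ℝ
    have h3 := ((hk _ (hupd _ (Complex.exp_ne_zero t))).hasFDerivAt.comp _ h1).comp t h2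
    have h4 : HasFDerivAt p _ t := h3
    refine h4.congr_fderiv ?_
    ext v; simp [hfd _ (hupd _ (Complex.exp_ne_zero t))]
  have hconst := is_const_of_fderiv_eq_zero (𝕜 := ℝ) (fun t => (hp t).differentiableAt)
    (fun t => (hp t).fderiv) (Complex.log c) (Complex.log (w a))
  simpa [p, Complex.exp_log hc, Complex.exp_log (hw a)] using hconst

end ToricKahler

/-! ## Toric charts in logarithmic coordinates -/

namespace SmoothCalculus

open Asymptotics Filter

set_option linter.unusedSectionVars false

variable {κ A : Type*} [Fintype κ] [DecidableEq κ] [Fintype A] [DecidableEq A]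

/-- The map `(s, ξ) ↦ (s, e^{η(ξ)/2})`, where `η = B ξ`. -/
def chartMap (B : Matrix A κ ℝ) (p : ℝ × (κ → ℝ)) : ℝ × (A → ℝ) :=
  (p.1, fun a => Real.exp (B.mulVec p.2 a / 2))

/-- A toric chart for a family `f` of convex potentials on `ℝ^κ`: in the coordinates
`r_a = e^{η_a/2}`, `η = Bξ`, the function `f + ∑ η_a` extends smoothly across `r_a = 0`, and the
Hessian of `f` extends to a positive matrix. -/
structure ToricChart (f : ℝ × (κ → ℝ) → ℝ) (A : Type*) [Fintype A] [DecidableEq A] where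
  B : Matrix A κ ℝ
  C : Matrix κ A ℝ
  BC : B * C = 1
  CB : C * B = 1
  F : ℝ × (A → ℝ) → ℝ
  F_smooth : Smooth F
  G : ℝ × (A → ℝ) → Matrix A A ℝ
  G_smooth : SmoothMat G
  G_pos : ∀ q, 0 < (G q).det
  f_eq : ∀ p, f p = F (chartMap B p) - ∑ a, B.mulVec p.2 a
  hess_eq : ∀ p, hessMat spaceDir f p =
    B.transpose * (Matrix.diagonal (chartMap B p).2 * G (chartMap B p) *
      Matrix.diagonal (chartMap B p).2) * B

theorem chartMap_smooth (B : Matrix A κ ℝ) : ContDiff ℝ (⊤ : ℕ∞) (chartMap B) := by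
  refine contDiff_fst.prodMk (contDiff_pi.2 fun a => ?_)
  refine ContDiff.exp ?_
  simp only [Matrix.mulVec, dotProduct]
  refine ContDiff.div_const (ContDiff.sum fun j _ => contDiff_const.mul ?_) 2
  exact (contDiff_apply ℝ ℝ j).comp contDiff_snd

theorem comp_chartMap_smooth (B : Matrix A κ ℝ) {X : ℝ × (A → ℝ) → ℝ} (hX : Smooth X) :
    Smooth fun p => X (chartMap B p) :=
  hX.comp (chartMap_smooth B)

theorem chartMap_pos (B : Matrix A κ ℝ) (p : ℝ × (κ → ℝ)) (a : A) : 0 < (chartMap B p).2 a :=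
  Real.exp_pos _

theorem smooth_snd_apply (a : A) : Smooth fun q : ℝ × (A → ℝ) => q.2 a :=
  (contDiff_apply ℝ ℝ a).comp contDiff_snd

theorem dirDeriv_snd_apply (a : A) (v q : ℝ × (A → ℝ)) :
    dirDeriv v (fun q : ℝ × (A → ℝ) => q.2 a) q = v.2 a := by
  have h : HasFDerivAt (fun q : ℝ × (A → ℝ) => q.2 a)
      ((ContinuousLinearMap.proj (R := ℝ) (φ := fun _ : A => ℝ) a).comp
        (ContinuousLinearMap.snd ℝ ℝ (A → ℝ))) q :=
    ((ContinuousLinearMap.proj (R := ℝ) (φ := fun _ : A => ℝ) a).comp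
        (ContinuousLinearMap.snd ℝ ℝ (A → ℝ))).hasFDerivAt
  rw [dirDeriv, h.fderiv]; rfl

theorem dirDeriv_comp_chartMap (B : Matrix A κ ℝ) {X : ℝ × (A → ℝ) → ℝ} (hX : Smooth X)
    (v p : ℝ × (κ → ℝ)) :
    dirDeriv v (fun q => X (chartMap B q)) p = v.1 * dirDeriv timeDir X (chartMap B p) +
      ∑ a, B.mulVec v.2 a * (2⁻¹ * (chartMap B p).2 a * dirDeriv (spaceDir a) X (chartMap B p)) := by
  have h1 : HasFDerivAt (chartMap B) ((ContinuousLinearMap.fst ℝ ℝ (κ → ℝ)).prod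
      (ContinuousLinearMap.pi fun a => (2⁻¹ * (chartMap B p).2 a) •
        ((ContinuousLinearMap.proj (R := ℝ) (φ := fun _ : A => ℝ) a).comp
          ((Matrix.mulVecLin B).toContinuousLinearMap.comp
            (ContinuousLinearMap.snd ℝ ℝ (κ → ℝ)))))) p := by
    refine hasFDerivAt_fst.prodMk (hasFDerivAt_pi.2 fun a => ?_)
    have h2 : HasFDerivAt (fun q : ℝ × (κ → ℝ) => B.mulVec q.2 a)
        ((ContinuousLinearMap.proj (R := ℝ) (φ := fun _ : A => ℝ) a).comp
          ((Matrix.mulVecLin B).toContinuousLinearMap.comp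
            (ContinuousLinearMap.snd ℝ ℝ (κ → ℝ)))) p :=
      ((ContinuousLinearMap.proj (R := ℝ) (φ := fun _ : A => ℝ) a).comp
          ((Matrix.mulVecLin B).toContinuousLinearMap.comp
            (ContinuousLinearMap.snd ℝ ℝ (κ → ℝ)))).hasFDerivAt
    refine ((h2.mul_const (2⁻¹ : ℝ)).exp).congr_fderiv ?_
    simp only [chartMap, div_eq_mul_inv, smul_smul]
    rw [mul_comm]
  have h3 : HasFDerivAt (fun q => X (chartMap B q)) _ p := (hX.diff _).hasFDerivAt.comp p h1
  rw [dirDeriv, h3.fderiv, ContinuousLinearMap.comp_apply]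
  have h4 : ((ContinuousLinearMap.fst ℝ ℝ (κ → ℝ)).prod
      (ContinuousLinearMap.pi fun a => (2⁻¹ * (chartMap B p).2 a) •
        ((ContinuousLinearMap.proj (R := ℝ) (φ := fun _ : A => ℝ) a).comp
          ((Matrix.mulVecLin B).toContinuousLinearMap.comp
            (ContinuousLinearMap.snd ℝ ℝ (κ → ℝ)))))) v =
      v.1 • timeDir + ∑ a, (B.mulVec v.2 a * (2⁻¹ * (chartMap B p).2 a)) • spaceDir a := by
    refine Prod.ext ?_ ?_
    · simp [timeDir, spaceDir, Prod.fst_sum]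
    · ext b
      simp [timeDir, spaceDir, Prod.snd_sum, Finset.sum_apply, Pi.single_apply]
      ring
  rw [h4, map_add, map_smul, map_sum]
  simp only [map_smul, smul_eq_mul, mul_assoc]
  rfl

namespace ToricChart

variable {f : ℝ × (κ → ℝ) → ℝ} (ch : ToricChart f A)

/-- The first derivatives in the direction of `ξ_j`, in the coordinates of the chart. -/
def grad (j : κ) (X : ℝ × (A → ℝ) → ℝ) (q : ℝ × (A → ℝ)) : ℝ :=
  ∑ a, ch.B a j * (2⁻¹ * q.2 a * dirDeriv (spaceDir a) X q)

theorem grad_smooth {X : ℝ × (A → ℝ) → ℝ} (hX : Smooth X) (j : κ) : Smooth (ch.grad j X) :=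
  ContDiff.sum fun a _ => contDiff_const.mul
    ((contDiff_const.mul (smooth_snd_apply a)).mul (hX.dirDeriv _))

theorem dirDeriv_space {X : ℝ × (A → ℝ) → ℝ} (hX : Smooth X) (j : κ) (p : ℝ × (κ → ℝ)) :
    dirDeriv (spaceDir j) (fun q => X (chartMap ch.B q)) p = ch.grad j X (chartMap ch.B p) := by
  rw [dirDeriv_comp_chartMap _ hX]
  simp [spaceDir, grad, Matrix.mulVec_single]

theorem dirDeriv_time {X : ℝ × (A → ℝ) → ℝ} (hX : Smooth X) (p : ℝ × (κ → ℝ)) :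
    dirDeriv timeDir (fun q => X (chartMap ch.B q)) p =
      dirDeriv timeDir X (chartMap ch.B p) := by
  rw [dirDeriv_comp_chartMap _ hX]
  simp [timeDir]

/-- The logarithmic coordinates are linear. -/
theorem sum_mulVec_smooth : Smooth fun p : ℝ × (κ → ℝ) => ∑ a, ch.B.mulVec p.2 a := by
  simp only [Matrix.mulVec, dotProduct]
  exact ContDiff.sum fun a _ => ContDiff.sum fun j _ => contDiff_const.mul (smooth_snd_apply j)

theorem dirDeriv_sum_mulVec (v p : ℝ × (κ → ℝ)) :
    dirDeriv v (fun p : ℝ × (κ → ℝ) => ∑ a, ch.B.mulVec p.2 a) p = ∑ a, ch.B.mulVec v.2 a := by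
  have hs : ∀ a, Smooth fun p : ℝ × (κ → ℝ) => ch.B.mulVec p.2 a := fun a => by
    simp only [Matrix.mulVec, dotProduct]
    exact ContDiff.sum fun j _ => contDiff_const.mul (smooth_snd_apply j)
  rw [dirDeriv_sum _ hs]
  refine Finset.sum_congr rfl fun a _ => ?_
  simp only [Matrix.mulVec, dotProduct]
  rw [dirDeriv_sum _ fun j => contDiff_const.mul (smooth_snd_apply j)]
  refine Finset.sum_congr rfl fun j _ => ?_
  rw [dirDeriv_const_mul (smooth_snd_apply j), dirDeriv_snd_apply]

include ch in
theorem smooth : Smooth f := by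
  have : f = fun p => ch.F (chartMap ch.B p) - ∑ a, ch.B.mulVec p.2 a := funext ch.f_eq
  rw [this]
  exact (ch.F_smooth.comp (chartMap_smooth _)).sub ch.sum_mulVec_smooth

/-- The moment map in the chart. -/
def momentF (j : κ) (q : ℝ × (A → ℝ)) : ℝ := ch.grad j ch.F q - ∑ a, ch.B a j

theorem momentF_smooth (j : κ) : Smooth (ch.momentF j) :=
  (ch.grad_smooth ch.F_smooth j).sub contDiff_const

theorem dirDeriv_f (j : κ) (p : ℝ × (κ → ℝ)) :
    dirDeriv (spaceDir j) f p = ch.momentF j (chartMap ch.B p) := by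
  have h0 : dirDeriv (spaceDir j) f p = dirDeriv (spaceDir j)
      (fun p => ch.F (chartMap ch.B p) - ∑ a, ch.B.mulVec p.2 a) p :=
    congrArg (fun h => dirDeriv (spaceDir j) h p) (funext ch.f_eq)
  rw [h0, dirDeriv_sub (comp_chartMap_smooth _ ch.F_smooth) ch.sum_mulVec_smooth,
    ch.dirDeriv_space ch.F_smooth, ch.dirDeriv_sum_mulVec, momentF]
  simp [spaceDir, Matrix.mulVec_single]

theorem dirDeriv_time_f (p : ℝ × (κ → ℝ)) :
    dirDeriv timeDir f p = dirDeriv timeDir ch.F (chartMap ch.B p) := by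
  have h0 : dirDeriv timeDir f p = dirDeriv timeDir
      (fun p => ch.F (chartMap ch.B p) - ∑ a, ch.B.mulVec p.2 a) p :=
    congrArg (fun h => dirDeriv timeDir h p) (funext ch.f_eq)
  rw [h0, dirDeriv_sub (comp_chartMap_smooth _ ch.F_smooth) ch.sum_mulVec_smooth,
    ch.dirDeriv_time ch.F_smooth, ch.dirDeriv_sum_mulVec]
  simp [timeDir]

/-- `e^{∑ η_a / 2} = ∏ r_a`. -/
def weight (p : ℝ × (κ → ℝ)) : ℝ := ∏ a, (chartMap ch.B p).2 a

theorem weight_pos (p : ℝ × (κ → ℝ)) : 0 < ch.weight p :=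
  Finset.prod_pos fun a _ => chartMap_pos _ _ a

theorem log_weight_sq (p : ℝ × (κ → ℝ)) :
    Real.log (ch.weight p ^ 2) = ∑ a, ch.B.mulVec p.2 a := by
  rw [Real.log_pow, weight, Real.log_prod fun a _ => (chartMap_pos _ _ a).ne', Finset.mul_sum]
  refine Finset.sum_congr rfl fun a _ => ?_
  simp only [chartMap, Real.log_exp]
  push_cast; ring

/-- The square of the determinant of the linear change of coordinates. -/
def vol : ℝ := (ch.B * ch.B.transpose).det

theorem det_hess (p : ℝ × (κ → ℝ)) :
    (hessMat spaceDir f p).det = ch.vol * (ch.weight p ^ 2 * (ch.G (chartMap ch.B p)).det) := by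
  have h1 : ∀ K : Matrix A A ℝ, (ch.B.transpose * K * ch.B).det = ch.vol * K.det := by
    intro K
    -- B has rows and columns indexed by different types, so it has no determinant of its own. Its
    -- square enters as det(BBᵀ), through conjugation by the mutually inverse matrices B and C.
    have h3 : ch.B.transpose * K * ch.B = ch.C * (ch.B * ch.B.transpose * K) * ch.B := by
      rw [Matrix.mul_assoc ch.B, ← Matrix.mul_assoc ch.C, ch.CB, Matrix.one_mul]
    rw [h3, Matrix.det_conj_of_mul_eq_one ch.CB ch.BC, Matrix.det_mul, vol]
  rw [ch.hess_eq, h1, Matrix.det_mul, Matrix.det_mul, Matrix.det_diagonal, weight]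
  ring

/-- A Gram determinant is nonnegative, and BBᵀ is invertible with inverse CᵀC. -/
theorem vol_pos : 0 < ch.vol := by
  have h1 : ch.vol * (ch.C.transpose * ch.C).det = 1 := by
    rw [vol, ← Matrix.det_mul]
    have : ch.B * ch.B.transpose * (ch.C.transpose * ch.C) = 1 := by
      have hC : ch.B.transpose * ch.C.transpose = 1 := by
        rw [← Matrix.transpose_mul, ch.CB, Matrix.transpose_one]
      rw [Matrix.mul_assoc, ← Matrix.mul_assoc ch.B.transpose, hC, Matrix.one_mul, ch.BC]
    rw [this, Matrix.det_one]
  have h2 : 0 ≤ ch.vol := by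
    have := (Matrix.posSemidef_self_mul_conjTranspose ch.B).det_nonneg
    rwa [Matrix.conjTranspose_eq_transpose_of_trivial] at this
  rcases h2.lt_or_eq with h | h
  · exact h
  · rw [← h, zero_mul] at h1; norm_num at h1

include ch in
theorem det_hess_pos (p : ℝ × (κ → ℝ)) : 0 < (hessMat spaceDir f p).det := by
  rw [ch.det_hess]
  exact mul_pos ch.vol_pos (mul_pos (pow_pos (ch.weight_pos p) 2) (ch.G_pos _))

theorem logDet_eq (p : ℝ × (κ → ℝ)) :
    logDet spaceDir f p = Real.log ch.vol + ∑ a, ch.B.mulVec p.2 a +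
      Real.log (ch.G (chartMap ch.B p)).det := by
  rw [logDet, ch.det_hess, Real.log_mul ch.vol_pos.ne'
    (mul_pos (pow_pos (ch.weight_pos p) 2) (ch.G_pos _)).ne',
    Real.log_mul (pow_pos (ch.weight_pos p) 2).ne' (ch.G_pos _).ne', log_weight_sq]
  ring

/-- The Ricci potential in the chart. -/
def ricciF (q : ℝ × (A → ℝ)) : ℝ := -Real.log ch.vol - Real.log (ch.G q).det - ch.F q

theorem ricciF_smooth : Smooth ch.ricciF :=
  (contDiff_const.sub (ch.G_smooth.det.log fun q => (ch.G_pos q).ne')).sub ch.F_smooth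

/-- The linear term ∑ η_a of log det D²f cancels against the one in f, so the Ricci potential
extends smoothly across r_a = 0. This is the anticanonical condition once more. -/
theorem ricciPot_eq (p : ℝ × (κ → ℝ)) :
    ricciPot spaceDir f p = ch.ricciF (chartMap ch.B p) := by
  rw [ricciPot, ch.logDet_eq, ch.f_eq, ricciF]; ring

/-- The potential of the field in the chart. -/
def thetaF (θ : κ → ℝ) (q : ℝ × (A → ℝ)) : ℝ := ∑ j, θ j * ch.momentF j q

theorem thetaF_smooth (θ : κ → ℝ) : Smooth (ch.thetaF θ) :=
  ContDiff.sum fun j _ => contDiff_const.mul (ch.momentF_smooth j)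

theorem momentTheta_eq (θ : κ → ℝ) (p : ℝ × (κ → ℝ)) :
    momentTheta spaceDir θ f p = ch.thetaF θ (chartMap ch.B p) := by
  simp only [momentTheta, thetaF, ch.dirDeriv_f]

theorem rho_eq (θ : κ → ℝ) (p : ℝ × (κ → ℝ)) :
    rho spaceDir θ f p = ch.vol * (ch.weight p ^ 2 * (ch.G (chartMap ch.B p)).det) *
      Real.exp (ch.thetaF θ (chartMap ch.B p)) := by
  rw [rho, Real.exp_add, logDet, Real.exp_log (ch.det_hess_pos p), ch.det_hess, ch.momentTheta_eq]

theorem inv_hess (p : ℝ × (κ → ℝ)) :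
    (hessMat spaceDir f p)⁻¹ = ch.C * (Matrix.diagonal (fun a => ((chartMap ch.B p).2 a)⁻¹) *
      (ch.G (chartMap ch.B p))⁻¹ * Matrix.diagonal (fun a => ((chartMap ch.B p).2 a)⁻¹)) *
      ch.C.transpose := by
  set r := (chartMap ch.B p).2 with hr
  apply Matrix.inv_eq_right_inv
  rw [ch.hess_eq, ← hr]
  have hdi : Matrix.diagonal r * Matrix.diagonal (fun a => (r a)⁻¹) = 1 := by
    rw [Matrix.diagonal_mul_diagonal, ← Matrix.diagonal_one]
    congr 1; ext a
    exact mul_inv_cancel₀ (chartMap_pos _ _ a).ne'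
  have hG : ch.G (chartMap ch.B p) * (ch.G (chartMap ch.B p))⁻¹ = 1 :=
    Matrix.mul_nonsing_inv _ (isUnit_iff_ne_zero.2 (ch.G_pos _).ne')
  have hC : ch.B.transpose * ch.C.transpose = 1 := by
    rw [← Matrix.transpose_mul, ch.CB, Matrix.transpose_one]
  calc _ = ch.B.transpose * (Matrix.diagonal r * (ch.G (chartMap ch.B p) * (Matrix.diagonal r *
        (ch.B * ch.C) * Matrix.diagonal (fun a => (r a)⁻¹)) * (ch.G (chartMap ch.B p))⁻¹) *
        Matrix.diagonal (fun a => (r a)⁻¹)) * ch.C.transpose := by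
        simp only [Matrix.mul_assoc]
    _ = 1 := by
        rw [ch.BC, Matrix.mul_one, hdi, Matrix.mul_one, hG, Matrix.mul_one, hdi, Matrix.mul_one, hC]

/-- The gradient of a chart function with respect to the metric. -/
theorem sum_inv_mul_dirDeriv {X : ℝ × (A → ℝ) → ℝ} (hX : Smooth X) (p : ℝ × (κ → ℝ)) (b : κ) :
    ∑ j, (hessMat spaceDir f p)⁻¹ b j * dirDeriv (spaceDir j) (fun q => X (chartMap ch.B q)) p =
      ∑ a, ch.C b a * (((chartMap ch.B p).2 a)⁻¹ *
        ∑ c, (ch.G (chartMap ch.B p))⁻¹ a c * (2⁻¹ * dirDeriv (spaceDir c) X (chartMap ch.B p))) := by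
  set r := (chartMap ch.B p).2 with hr
  let x : A → ℝ := fun c => 2⁻¹ * dirDeriv (spaceDir c) X (chartMap ch.B p)
  have h1 : (fun j => dirDeriv (spaceDir j) (fun q => X (chartMap ch.B q)) p) =
      ch.B.transpose.mulVec ((Matrix.diagonal r).mulVec x) := by
    ext j
    rw [ch.dirDeriv_space hX, grad]
    simp only [Matrix.mulVec, dotProduct, Matrix.transpose_apply]
    refine Finset.sum_congr rfl fun a _ => ?_
    rw [Finset.sum_eq_single a (fun c _ hc => by simp [Matrix.diagonal_apply_ne' _ hc]) (by simp)]
    simp only [Matrix.diagonal_apply_eq, x, ← hr]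
    ring
  have h2 : ∑ j, (hessMat spaceDir f p)⁻¹ b j *
      dirDeriv (spaceDir j) (fun q => X (chartMap ch.B q)) p =
      ((hessMat spaceDir f p)⁻¹).mulVec
        (fun j => dirDeriv (spaceDir j) (fun q => X (chartMap ch.B q)) p) b := rfl
  have hdi : Matrix.diagonal (fun a => (r a)⁻¹) * Matrix.diagonal r = 1 := by
    rw [Matrix.diagonal_mul_diagonal, ← Matrix.diagonal_one]
    congr 1; ext a
    exact inv_mul_cancel₀ (chartMap_pos _ _ a).ne'
  have hC : ch.C.transpose * ch.B.transpose = 1 := by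
    rw [← Matrix.transpose_mul, ch.BC, Matrix.transpose_one]
  have h3 : (hessMat spaceDir f p)⁻¹ * (ch.B.transpose * Matrix.diagonal r) =
      ch.C * (Matrix.diagonal (fun a => (r a)⁻¹) * (ch.G (chartMap ch.B p))⁻¹) := by
    rw [ch.inv_hess, ← hr]
    calc _ = ch.C * (Matrix.diagonal (fun a => (r a)⁻¹) * ((ch.G (chartMap ch.B p))⁻¹ *
          (Matrix.diagonal (fun a => (r a)⁻¹) *
          (ch.C.transpose * ch.B.transpose) * Matrix.diagonal r))) := by
          simp only [Matrix.mul_assoc]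
      _ = _ := by rw [hC, Matrix.mul_one, hdi, Matrix.mul_one]
  rw [h2, h1, Matrix.mulVec_mulVec, Matrix.mulVec_mulVec, Matrix.mul_assoc, h3, ← Matrix.mulVec_mulVec,
    ← Matrix.mulVec_mulVec]
  simp only [Matrix.mulVec, dotProduct, x]
  refine Finset.sum_congr rfl fun a _ => ?_
  congr 1
  rw [Finset.sum_eq_single a (fun c _ hc => by simp [Matrix.diagonal_apply_ne' _ hc]) (by simp)]
  simp only [Matrix.diagonal_apply_eq]

/-- The derivative in η_a is r_a/2 times the derivative in r_a. Differentiating the factor r_a a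
second time produces the diagonal term; after r_a r_b is taken out, it has only a simple pole. -/
theorem hessMat_comp_chartMap {X : ℝ × (A → ℝ) → ℝ} (hX : Smooth X) (p : ℝ × (κ → ℝ)) :
    hessMat spaceDir (fun q => X (chartMap ch.B q)) p = ch.B.transpose * Matrix.of (fun a b =>
      (chartMap ch.B p).2 a * (chartMap ch.B p).2 b * (4⁻¹ *
        (dirDeriv (spaceDir a) (dirDeriv (spaceDir b) X) (chartMap ch.B p) + if a = b then
          ((chartMap ch.B p).2 a)⁻¹ * dirDeriv (spaceDir a) X (chartMap ch.B p) else 0))) * ch.B := by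
  ext i j
  simp only [hessMat, Matrix.of_apply]
  have h1 : dirDeriv (spaceDir j) (fun q => X (chartMap ch.B q)) =
      fun p => ch.grad j X (chartMap ch.B p) := funext fun p => ch.dirDeriv_space hX j p
  rw [h1, ch.dirDeriv_space (ch.grad_smooth hX j)]
  set q := chartMap ch.B p with hq
  have h2 : ∀ a, dirDeriv (spaceDir a) (ch.grad j X) q = ∑ b, ch.B b j * (2⁻¹ *
      ((if a = b then dirDeriv (spaceDir a) X q else 0) +
        q.2 b * dirDeriv (spaceDir a) (dirDeriv (spaceDir b) X) q)) := by
    intro a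
    have hs : ∀ b, Smooth fun q : ℝ × (A → ℝ) => 2⁻¹ * q.2 b := fun b =>
      contDiff_const.mul (smooth_snd_apply b)
    unfold grad
    rw [dirDeriv_sum _ fun b => contDiff_const.mul ((hs b).mul (hX.dirDeriv _))]
    refine Finset.sum_congr rfl fun b _ => ?_
    rw [dirDeriv_const_mul ((hs b).mul (hX.dirDeriv _)), dirDeriv_mul (hs b) (hX.dirDeriv _),
      dirDeriv_const_mul (smooth_snd_apply b), dirDeriv_snd_apply]
    congr 1
    by_cases hab : a = b
    · subst hab; simp [spaceDir]; ring
    · simp [spaceDir, hab]; ring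
  simp only [grad, h2, Matrix.mul_apply, Matrix.transpose_apply, Matrix.of_apply, Finset.sum_mul,
    Finset.mul_sum]
  rw [Finset.sum_comm]
  refine Finset.sum_congr rfl fun b _ => Finset.sum_congr rfl fun a _ => ?_
  by_cases hab : a = b
  · subst hab
    have : q.2 a ≠ 0 := (chartMap_pos _ _ a).ne'
    simp only [if_true]
    field_simp
    ring
  · simp only [hab, if_false]
    ring

/-- The Laplacian of a chart function. -/
theorem sum_inv_mul_hess {X : ℝ × (A → ℝ) → ℝ} (hX : Smooth X) (p : ℝ × (κ → ℝ)) :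
    ∑ i, ∑ j, (hessMat spaceDir f p)⁻¹ i j *
      hessMat spaceDir (fun q => X (chartMap ch.B q)) p i j =
      ∑ a, ∑ b, (ch.G (chartMap ch.B p))⁻¹ a b * (4⁻¹ *
        (dirDeriv (spaceDir b) (dirDeriv (spaceDir a) X) (chartMap ch.B p) + if b = a then
          ((chartMap ch.B p).2 b)⁻¹ * dirDeriv (spaceDir b) X (chartMap ch.B p) else 0)) := by
  have hXs : Smooth fun q => X (chartMap ch.B q) := hX.comp (chartMap_smooth _)
  have h1 : ∑ i, ∑ j, (hessMat spaceDir f p)⁻¹ i j *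
      hessMat spaceDir (fun q => X (chartMap ch.B q)) p i j =
      ((hessMat spaceDir f p)⁻¹ * hessMat spaceDir (fun q => X (chartMap ch.B q)) p).trace := by
    simp only [Matrix.trace, Matrix.diag_apply, Matrix.mul_apply]
    refine Finset.sum_congr rfl fun i _ => Finset.sum_congr rfl fun j _ => ?_
    rw [hessMat_symm _ hXs p i j]
  rw [h1, ch.inv_hess, ch.hessMat_comp_chartMap hX]
  set r := (chartMap ch.B p).2 with hr
  set M : Matrix A A ℝ := Matrix.of (fun a b => r a * r b * (4⁻¹ *
        (dirDeriv (spaceDir a) (dirDeriv (spaceDir b) X) (chartMap ch.B p) + if a = b then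
          (r a)⁻¹ * dirDeriv (spaceDir a) X (chartMap ch.B p) else 0))) with hM
  have hC : ch.C.transpose * ch.B.transpose = 1 := by
    rw [← Matrix.transpose_mul, ch.BC, Matrix.transpose_one]
  set K := Matrix.diagonal (fun a => (r a)⁻¹) * (ch.G (chartMap ch.B p))⁻¹ *
    Matrix.diagonal (fun a => (r a)⁻¹) with hK
  have h2 : (ch.C * K * ch.C.transpose * (ch.B.transpose * M * ch.B)).trace = (K * M).trace := by
    have : ch.C * K * ch.C.transpose * (ch.B.transpose * M * ch.B) =
        ch.C * (K * (ch.C.transpose * ch.B.transpose) * M * ch.B) := by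
      simp only [Matrix.mul_assoc]
    rw [this, hC, Matrix.mul_one, Matrix.trace_mul_comm, Matrix.mul_assoc, ch.BC, Matrix.mul_one]
  rw [h2, Matrix.trace]
  refine Finset.sum_congr rfl fun a _ => ?_
  rw [Matrix.diag_apply, Matrix.mul_apply]
  refine Finset.sum_congr rfl fun b _ => ?_
  rw [hK, Matrix.mul_diagonal, Matrix.diagonal_mul, hM, Matrix.of_apply]
  have ha : r a ≠ 0 := (chartMap_pos _ _ a).ne'
  have hb : r b ≠ 0 := (chartMap_pos _ _ b).ne'
  by_cases hab : b = a
  · subst hab; simp only [if_true]; field_simp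
  · simp only [hab, if_false]; field_simp

end ToricChart

end SmoothCalculus

/-! ## Decay in toric charts -/

namespace SmoothCalculus

open Asymptotics Filter

set_option linter.unusedSectionVars false

variable {κ A : Type*} [Fintype κ] [DecidableEq κ] [Fintype A] [DecidableEq A]

namespace ToricChart

variable {f : ℝ × (κ → ℝ) → ℝ} (ch : ToricChart f A)

/-- The part of `[0, S] × ℝ^κ` where the chart coordinates satisfy `r_a ≤ 1`. -/
def cone (S : ℝ) : Set (ℝ × (κ → ℝ)) := {p | p.1 ∈ Set.Icc 0 S ∧ ∀ a, ch.B.mulVec p.2 a ≤ 0}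

variable {S : ℝ}

/-- The cone is mapped into the compact set [0, S] × [0, 1]^A, on which a continuous function is
bounded. -/
theorem comp_chartMap_isBigO {X : ℝ × (A → ℝ) → ℝ} (hX : Continuous X) :
    (fun p => X (chartMap ch.B p)) =O[𝓟 (ch.cone S)] fun _ => (1 : ℝ) := by
  have hK : IsCompact (Set.Icc 0 S ×ˢ Set.Icc (0 : A → ℝ) 1) := isCompact_Icc.prod isCompact_Icc
  obtain ⟨K, hK⟩ := hK.exists_bound_of_continuousOn hX.continuousOn
  refine isBigO_principal.2 ⟨K, fun p hp => ?_⟩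
  rw [norm_one, mul_one]
  refine hK _ ⟨hp.1, fun a => (chartMap_pos _ _ a).le, fun a => ?_⟩
  simp only [chartMap, Pi.one_apply, Real.exp_le_one_iff]
  linarith [hp.2 a]

theorem one_isBigO : (fun _ : ℝ × (κ → ℝ) => (1 : ℝ)) =O[𝓟 (ch.cone S)] fun p => 1 + ‖p.2‖ := by
  refine IsBigO.of_bound 1 (Eventually.of_forall fun p => ?_)
  rw [norm_one, one_mul, Real.norm_of_nonneg (by positivity)]
  linarith [norm_nonneg p.2]

theorem coord_isBigO (j : κ) :
    (fun p : ℝ × (κ → ℝ) => p.2 j) =O[𝓟 (ch.cone S)] fun p => 1 + ‖p.2‖ := by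
  refine IsBigO.of_bound 1 (Eventually.of_forall fun p => ?_)
  rw [one_mul, Real.norm_of_nonneg (r := 1 + ‖p.2‖) (by positivity)]
  linarith [norm_le_pi_norm p.2 j]

theorem sum_mulVec_isBigO :
    (fun p : ℝ × (κ → ℝ) => ∑ a, ch.B.mulVec p.2 a) =O[𝓟 (ch.cone S)] fun p => 1 + ‖p.2‖ := by
  simp only [Matrix.mulVec, dotProduct]
  exact IsBigO.fun_sum fun a _ => IsBigO.fun_sum fun j _ => (ch.coord_isBigO j).const_mul_left _

theorem weight_isBigO : ch.weight =O[𝓟 (ch.cone S)] fun _ => (1 : ℝ) :=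
  ch.comp_chartMap_isBigO (X := fun q => ∏ a, q.2 a) (by fun_prop)

/-- One factor ∏ r_a cancels one pole r_a⁻¹ and leaves a polynomial. -/
theorem weight_mul_inv_isBigO (a : A) :
    (fun p => ch.weight p * ((chartMap ch.B p).2 a)⁻¹) =O[𝓟 (ch.cone S)] fun _ => (1 : ℝ) := by
  have h : (fun p => ch.weight p * ((chartMap ch.B p).2 a)⁻¹) =
      fun p => ∏ c ∈ Finset.univ.erase a, (chartMap ch.B p).2 c := by
    funext p
    rw [weight, ← Finset.mul_prod_erase _ _ (Finset.mem_univ a), mul_comm ((chartMap ch.B p).2 a),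
      mul_assoc, mul_inv_cancel₀ (chartMap_pos _ _ a).ne', mul_one]
  rw [h]
  exact ch.comp_chartMap_isBigO (X := fun q => ∏ c ∈ Finset.univ.erase a, q.2 c) (by fun_prop)

theorem logDet_isBigO : logDet spaceDir f =O[𝓟 (ch.cone S)] fun p => 1 + ‖p.2‖ := by
  rw [show logDet spaceDir f = _ from funext ch.logDet_eq]
  refine (((isBigO_const_const _ one_ne_zero _).trans ch.one_isBigO).add
    ch.sum_mulVec_isBigO).add ((ch.comp_chartMap_isBigO
      (X := fun q => Real.log (ch.G q).det) ?_).trans ch.one_isBigO)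
  exact (ch.G_smooth.det.log fun q => (ch.G_pos q).ne').continuous

/-- The moments Df are bounded, so both log det D²f and ⟨ξ, Df⟩ grow at most linearly. -/
theorem entropyDensity_isBigO :
    entropyDensity spaceDir f (fun j p => p.2 j) =O[𝓟 (ch.cone S)] fun p => 1 + ‖p.2‖ := by
  refine ch.logDet_isBigO.add (IsBigO.fun_sum fun j _ => ?_)
  simp only [ch.dirDeriv_f]
  simpa using (ch.coord_isBigO j).mul (ch.comp_chartMap_isBigO (ch.momentF_smooth j).continuous)

/-- The density relative to the square of the weight. -/
def rhoF (θ : κ → ℝ) (q : ℝ × (A → ℝ)) : ℝ :=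
  ch.vol * (ch.G q).det * Real.exp (ch.thetaF θ q)

theorem rhoF_continuous (θ : κ → ℝ) : Continuous (ch.rhoF θ) :=
  (continuous_const.mul ch.G_smooth.det.continuous).mul
    (ch.thetaF_smooth θ).continuous.rexp

/-- The density carries the weight twice: one copy absorbs the poles of gradients and Laplacians,
the other remains as the exponentially decaying majorant. -/
theorem rho_eq_rhoF (θ : κ → ℝ) (p : ℝ × (κ → ℝ)) :
    rho spaceDir θ f p = ch.rhoF θ (chartMap ch.B p) * ch.weight p * ch.weight p := by
  rw [ch.rho_eq, rhoF]; ring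

theorem invG_continuous (a b : A) : Continuous fun q => (ch.G q)⁻¹ a b :=
  (SmoothMat.inv ch.G_smooth fun q => (ch.G_pos q).ne') a b |>.continuous

theorem weight_mul_gradient_isBigO {X : ℝ × (A → ℝ) → ℝ} (hX : Smooth X) (b : κ) :
    (fun p => ch.weight p * ∑ j, (hessMat spaceDir f p)⁻¹ b j *
      dirDeriv (spaceDir j) (fun q => X (chartMap ch.B q)) p) =O[𝓟 (ch.cone S)]
      fun _ => (1 : ℝ) := by
  have h0 : (fun p => ch.weight p * ∑ j, (hessMat spaceDir f p)⁻¹ b j *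
      dirDeriv (spaceDir j) (fun q => X (chartMap ch.B q)) p) = fun p => ∑ a, ch.C b a *
        ((ch.weight p * ((chartMap ch.B p).2 a)⁻¹) * ∑ c, (ch.G (chartMap ch.B p))⁻¹ a c *
          (2⁻¹ * dirDeriv (spaceDir c) X (chartMap ch.B p))) := by
    funext p
    rw [ch.sum_inv_mul_dirDeriv hX, Finset.mul_sum]
    exact Finset.sum_congr rfl fun a _ => by ring
  rw [h0]
  refine IsBigO.fun_sum fun a _ => ?_
  have h1 := (ch.weight_mul_inv_isBigO (S := S) a).mul (ch.comp_chartMap_isBigO (S := S)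
    (X := fun q => ∑ c, (ch.G q)⁻¹ a c * (2⁻¹ * dirDeriv (spaceDir c) X q)) (by
      refine continuous_finsetSum _ fun c _ => (ch.invG_continuous a c).mul ?_
      exact continuous_const.mul (hX.dirDeriv _).continuous))
  exact (h1.const_mul_left (ch.C b a)).congr (fun p => rfl) (fun p => by ring)

theorem weight_mul_hessian_isBigO {X : ℝ × (A → ℝ) → ℝ} (hX : Smooth X) :
    (fun p => ch.weight p * ∑ i, ∑ j, (hessMat spaceDir f p)⁻¹ i j *
      hessMat spaceDir (fun q => X (chartMap ch.B q)) p i j) =O[𝓟 (ch.cone S)]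
      fun _ => (1 : ℝ) := by
  simp only [ch.sum_inv_mul_hess hX, Finset.mul_sum]
  refine IsBigO.fun_sum fun a _ => IsBigO.fun_sum fun b _ => ?_
  have hb : ∀ {Y : ℝ × (A → ℝ) → ℝ}, Smooth Y → (fun p => Y (chartMap ch.B p))
      =O[𝓟 (ch.cone S)] fun _ => (1 : ℝ) := fun hY => ch.comp_chartMap_isBigO hY.continuous
  have h1 := ch.weight_isBigO.mul (hb ((hX.dirDeriv (spaceDir a)).dirDeriv (spaceDir b)))
  have h2 : (fun p => if b = a then ch.weight p * ((chartMap ch.B p).2 b)⁻¹ *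
      dirDeriv (spaceDir b) X (chartMap ch.B p) else 0) =O[𝓟 (ch.cone S)]
      fun _ => (1 : ℝ) * 1 := by
    by_cases hab : b = a
    · simp only [hab, if_true]
      exact (ch.weight_mul_inv_isBigO a).mul (hb (hX.dirDeriv _))
    · simp only [hab, if_false]
      exact isBigO_zero _ _
  refine ((ch.comp_chartMap_isBigO (ch.invG_continuous a b)).mul
    ((h1.add h2).const_mul_left 4⁻¹)).congr (fun p => ?_) (fun p => by ring)
  by_cases hab : b = a
  · simp only [hab, if_true]; ring
  · simp only [hab, if_false]; ring

/-- The difference of the Ricci potential and the potential of the field. -/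
theorem ricciPot_sub_momentTheta_eq (θ : κ → ℝ) :
    (fun q => ricciPot spaceDir f q - momentTheta spaceDir θ f q) =
      fun q => (fun q => ch.ricciF q - ch.thetaF θ q) (chartMap ch.B q) :=
  funext fun p => by rw [ch.ricciPot_eq, ch.momentTheta_eq]

theorem entropy_isBigO (θ : κ → ℝ) :
    (fun p => entropyDensity spaceDir f (fun j p => p.2 j) p * rho spaceDir θ f p)
      =O[𝓟 (ch.cone S)] fun p => (1 + ‖p.2‖) * ch.weight p := by
  refine ((ch.entropyDensity_isBigO.mul (ch.comp_chartMap_isBigO (ch.rhoF_continuous θ))).mul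
    (ch.weight_isBigO.mul (isBigO_refl ch.weight _))).congr (fun p => ?_) (fun p => by ring)
  rw [ch.rho_eq_rhoF]; ring

theorem logDet_rho_isBigO (θ : κ → ℝ) :
    (fun p => logDet spaceDir f p * rho spaceDir θ f p)
      =O[𝓟 (ch.cone S)] fun p => (1 + ‖p.2‖) * ch.weight p := by
  refine ((ch.logDet_isBigO.mul (ch.comp_chartMap_isBigO (ch.rhoF_continuous θ))).mul
    (ch.weight_isBigO.mul (isBigO_refl ch.weight _))).congr (fun p => ?_) (fun p => by ring)
  rw [ch.rho_eq_rhoF]; ring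

theorem laplacian_isBigO (θ : κ → ℝ) :
    (fun p => dirDeriv timeDir f p * weightedLaplacian spaceDir θ f
      (fun q => ricciPot spaceDir f q - momentTheta spaceDir θ f q) p * rho spaceDir θ f p)
      =O[𝓟 (ch.cone S)] fun p => (1 + ‖p.2‖) * ch.weight p := by
  have hX : Smooth fun q => ch.ricciF q - ch.thetaF θ q := ch.ricciF_smooth.sub (ch.thetaF_smooth θ)
  have h1 := ch.weight_mul_hessian_isBigO (S := S) hX
  have h2 : (fun p => ch.weight p * ∑ j, θ j * ch.grad j (fun q => ch.ricciF q - ch.thetaF θ q)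
      (chartMap ch.B p)) =O[𝓟 (ch.cone S)] fun _ => (1 : ℝ) * 1 := by
    refine ch.weight_isBigO.mul (ch.comp_chartMap_isBigO (X := fun q => ∑ j, θ j *
      ch.grad j (fun q => ch.ricciF q - ch.thetaF θ q) q) ?_)
    exact continuous_finsetSum _ fun j _ => continuous_const.mul (ch.grad_smooth hX j).continuous
  rw [one_mul] at h2
  have h3 := ch.comp_chartMap_isBigO (S := S) (ch.F_smooth.dirDeriv timeDir).continuous
  refine (((h3.mul (ch.comp_chartMap_isBigO (ch.rhoF_continuous θ))).mul (h1.add h2)).mul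
    (ch.one_isBigO.mul (isBigO_refl ch.weight _))).congr (fun p => ?_) (fun p => by ring)
  rw [ch.ricciPot_sub_momentTheta_eq θ, ch.rho_eq_rhoF, weightedLaplacian, ch.dirDeriv_time_f]
  simp only [ch.dirDeriv_space hX]
  ring

/-- The flux consists of metric gradients of ψ and of k, with coefficients of at most linear growth.
One copy of the weight in ρ bounds these gradients. -/
theorem flux_isBigO (θ : κ → ℝ) (b : κ) :
    (fun q => rho spaceDir θ f q * ∑ a, (hessMat spaceDir f q)⁻¹ a b *
      fluxForm spaceDir θ f (fun j p => p.2 j) (dirDeriv timeDir f) a q)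
      =O[𝓟 (ch.cone S)] fun p => (1 + ‖p.2‖) * ch.weight p := by
  have hX : Smooth fun q => ch.ricciF q - ch.thetaF θ q := ch.ricciF_smooth.sub (ch.thetaF_smooth θ)
  have hψ : dirDeriv timeDir f = fun p => dirDeriv timeDir ch.F (chartMap ch.B p) :=
    funext ch.dirDeriv_time_f
  have h1 := ch.weight_mul_gradient_isBigO (S := S) hX b
  have h2 := ch.weight_mul_gradient_isBigO (S := S) (ch.F_smooth.dirDeriv timeDir) b
  have h3 := ch.comp_chartMap_isBigO (S := S) (ch.F_smooth.dirDeriv timeDir).continuous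
  have h4 := (ch.entropyDensity_isBigO (S := S)).add ch.one_isBigO
  have h5 := (h4.mul h2).add (((h3.trans ch.one_isBigO)).mul h1)
  refine ((h5.mul (ch.comp_chartMap_isBigO (ch.rhoF_continuous θ))).mul
    (isBigO_refl ch.weight _)).congr (fun p => ?_) (fun p => by ring)
  simp only [fluxForm, ch.ricciPot_sub_momentTheta_eq θ, ch.rho_eq_rhoF, hψ]
  have hsym : ∀ a, (hessMat spaceDir f p)⁻¹ a b = (hessMat spaceDir f p)⁻¹ b a := fun a =>
    hessMat_inv_symm _ ch.smooth p a b
  simp only [hsym, mul_add, Finset.sum_add_distrib, Finset.mul_sum, Finset.sum_mul, add_mul]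
  congr 1
  · congr 1 <;> refine Finset.sum_congr rfl fun a _ => ?_ <;> ring
  · refine Finset.sum_congr rfl fun a _ => ?_
    ring

theorem exp_neg_eq (p : ℝ × (κ → ℝ)) :
    Real.exp (-f p) = Real.exp (-ch.F (chartMap ch.B p)) * ch.weight p * ch.weight p := by
  rw [ch.f_eq, ← ch.log_weight_sq, neg_sub, sub_eq_add_neg, add_comm, Real.exp_add,
    Real.exp_log (pow_pos (ch.weight_pos p) 2)]
  ring

theorem exp_neg_isBigO :
    (fun p => Real.exp (-f p)) =O[𝓟 (ch.cone S)] fun p => (1 + ‖p.2‖) * ch.weight p := by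
  refine ((ch.one_isBigO.mul (ch.comp_chartMap_isBigO
    (X := fun q => Real.exp (-ch.F q)) ch.F_smooth.continuous.neg.rexp)).mul
    (ch.weight_isBigO.mul (isBigO_refl ch.weight _))).congr (fun p => ?_) (fun p => by ring)
  rw [ch.exp_neg_eq]; ring

theorem momentTheta_isBigO (θ : κ → ℝ) :
    momentTheta spaceDir θ f =O[𝓟 (ch.cone S)] fun _ => (1 : ℝ) := by
  rw [show momentTheta spaceDir θ f = _ from funext (ch.momentTheta_eq θ)]
  exact ch.comp_chartMap_isBigO (ch.thetaF_smooth θ).continuous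

theorem ricciPot_isBigO :
    ricciPot spaceDir f =O[𝓟 (ch.cone S)] fun _ => (1 : ℝ) := by
  rw [show ricciPot spaceDir f = _ from funext ch.ricciPot_eq]
  exact ch.comp_chartMap_isBigO ch.ricciF_smooth.continuous

theorem weight_eq_exp (p : ℝ × (κ → ℝ)) :
    ch.weight p = Real.exp ((∑ a, ch.B.mulVec p.2 a) / 2) := by
  rw [weight, Finset.sum_div, Real.exp_sum]; rfl

end ToricChart

/-- An integrable majorant for exponentially decaying functions of logarithmic coordinates. -/
theorem integrable_one_add_norm_mul_exp {c : ℝ} (hc : 0 < c) :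
    Integrable fun ξ : κ → ℝ => (1 + ‖ξ‖) * Real.exp (-(c * ‖ξ‖)) := by
  -- The bound e^x ≥ x^m/m! must absorb the linear factor and still leave the power card κ + 1,
  -- which is integrable because it exceeds the dimension.
  set m := Fintype.card κ + 2 with hm
  have h1 : Integrable fun ξ : κ → ℝ => (1 + ‖ξ‖) ^ (-((Fintype.card κ : ℝ) + 1)) := by
    refine integrable_one_add_norm ?_
    rw [Module.finrank_fintype_fun_eq_card]; linarith
  have h2 := h1.const_mul (m.factorial * Real.exp c / c ^ m)
  refine h2.mono' (by fun_prop) (Eventually.of_forall fun ξ => ?_)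
  have hp : 0 < 1 + ‖ξ‖ := by positivity
  have h3 := Real.pow_div_factorial_le_exp (c * (1 + ‖ξ‖)) (by positivity) m
  rw [Real.norm_of_nonneg (by positivity), Real.rpow_neg hp.le]
  have h4 : (1 + ‖ξ‖) ^ ((Fintype.card κ : ℝ) + 1) = (1 + ‖ξ‖) ^ (Fintype.card κ + 1) := by
    rw [← Real.rpow_natCast]; push_cast; rfl
  rw [h4, ← div_eq_mul_inv, le_div_iff₀ (by positivity)]
  have h5 : Real.exp (-(c * ‖ξ‖)) = Real.exp c * Real.exp (-(c * (1 + ‖ξ‖))) := by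
    rw [← Real.exp_add]; congr 1; ring
  rw [h5, Real.exp_neg]
  have h6 : (1 + ‖ξ‖) ^ m * c ^ m ≤ m.factorial * Real.exp (c * (1 + ‖ξ‖)) := by
    rw [div_le_iff₀ (by positivity), mul_pow] at h3
    linarith
  have h7 : (1 + ‖ξ‖) * (1 + ‖ξ‖) ^ (Fintype.card κ + 1) = (1 + ‖ξ‖) ^ m := by
    rw [hm]; ring
  rw [show (1 + ‖ξ‖) * (Real.exp c * (Real.exp (c * (1 + ‖ξ‖)))⁻¹) *
    (1 + ‖ξ‖) ^ (Fintype.card κ + 1) = ((1 + ‖ξ‖) * (1 + ‖ξ‖) ^ (Fintype.card κ + 1)) * Real.exp c *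
      (Real.exp (c * (1 + ‖ξ‖)))⁻¹ by ring, h7]
  rw [← div_eq_mul_inv, div_le_iff₀ (Real.exp_pos _), div_mul_eq_mul_div, le_div_iff₀ (by positivity)]
  nlinarith [Real.exp_pos c]

end SmoothCalculus

/-! ## Slices and linear substitutions -/

namespace SmoothCalculus

open ToricKahler

set_option linter.unusedSectionVars false

variable {κ A : Type*} [Fintype κ] [DecidableEq κ] [Fintype A] [DecidableEq A]

section Slice

variable {f : ℝ × (κ → ℝ) → ℝ} (hf : Smooth f) (s : ℝ)
include hf

theorem dirDeriv_slice (i : κ) :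
    dirDeriv (stdDir i) (fun η => f (s, η)) = fun η => dirDeriv (spaceDir i) f (s, η) :=
  funext fun ξ => fderiv_space_slice hf s ξ _

theorem hessMat_slice :
    hessMat stdDir (fun η => f (s, η)) = fun ξ => hessMat spaceDir f (s, ξ) := by
  funext ξ
  ext i j
  simp only [hessMat, Matrix.of_apply]
  rw [dirDeriv_slice hf, dirDeriv_slice (hf.dirDeriv _)]

theorem logDet_slice :
    logDet stdDir (fun η => f (s, η)) = fun ξ => logDet spaceDir f (s, ξ) := by
  funext ξ
  rw [logDet, hessMat_slice hf, logDet]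

theorem momentTheta_slice (θ : κ → ℝ) :
    momentTheta stdDir θ (fun η => f (s, η)) = fun ξ => momentTheta spaceDir θ f (s, ξ) := by
  funext ξ
  simp only [momentTheta, dirDeriv_slice hf]

theorem ricciPot_slice :
    ricciPot stdDir (fun η => f (s, η)) = fun ξ => ricciPot spaceDir f (s, ξ) := by
  funext ξ
  simp only [ricciPot, logDet_slice hf]

theorem rho_slice (θ : κ → ℝ) :
    rho stdDir θ (fun η => f (s, η)) = fun ξ => rho spaceDir θ f (s, ξ) := by
  funext ξ
  simp only [rho, logDet_slice hf, momentTheta_slice hf]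

theorem weightedLaplacian_slice (θ : κ → ℝ) {χ : ℝ × (κ → ℝ) → ℝ} (hχ : Smooth χ) :
    weightedLaplacian stdDir θ (fun η => f (s, η)) (fun η => χ (s, η)) =
      fun ξ => weightedLaplacian spaceDir θ f χ (s, ξ) := by
  funext ξ
  simp only [weightedLaplacian, hessMat_slice hf, hessMat_slice hχ, dirDeriv_slice hχ]

theorem entropyDensity_slice :
    entropyDensity stdDir (fun η => f (s, η)) (fun j ξ => ξ j) =
      fun ξ => entropyDensity spaceDir f (fun j p => p.2 j) (s, ξ) := by
  funext ξ
  simp only [entropyDensity, logDet_slice hf, dirDeriv_slice hf]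

end Slice

theorem smooth_mulVec (B : Matrix A κ ℝ) : ContDiff ℝ (⊤ : ℕ∞) fun ξ : κ → ℝ => B.mulVec ξ :=
  (Matrix.mulVecLin B).toContinuousLinearMap.contDiff

theorem dirDeriv_comp_mulVec (B : Matrix A κ ℝ) {k : (A → ℝ) → ℝ} (hk : Smooth k) (j : κ)
    (ξ : κ → ℝ) : dirDeriv (stdDir j) (fun ξ => k (B.mulVec ξ)) ξ =
      ∑ a, B a j * dirDeriv (stdDir a) k (B.mulVec ξ) := by
  have h : HasFDerivAt (fun ξ => k (B.mulVec ξ)) _ ξ :=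
    (hk.diff (B.mulVec ξ)).hasFDerivAt.comp ξ
      (Matrix.mulVecLin B).toContinuousLinearMap.hasFDerivAt
  rw [dirDeriv, h.fderiv, ContinuousLinearMap.comp_apply]
  have h2 : (Matrix.mulVecLin B).toContinuousLinearMap (stdDir j) =
      ∑ a, B a j • (stdDir a : A → ℝ) := by
    ext b
    simp [stdDir, Matrix.mulVec_single, Finset.sum_apply, Pi.single_apply]
  rw [h2, map_sum]
  simp only [map_smul, smul_eq_mul]
  rfl

theorem hessMat_comp_mulVec (B : Matrix A κ ℝ) {k : (A → ℝ) → ℝ} (hk : Smooth k) (ξ : κ → ℝ) :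
    hessMat stdDir (fun ξ => k (B.mulVec ξ)) ξ =
      B.transpose * hessMat stdDir k (B.mulVec ξ) * B := by
  ext i j
  simp only [hessMat, Matrix.of_apply, Matrix.mul_apply, Matrix.transpose_apply]
  have h1 : dirDeriv (stdDir j) (fun ξ => k (B.mulVec ξ)) =
      fun ξ => ∑ a, B a j * dirDeriv (stdDir a) k (B.mulVec ξ) :=
    funext fun ξ => dirDeriv_comp_mulVec B hk j ξ
  have hs : ∀ a, Smooth fun ξ => dirDeriv (stdDir a) k (B.mulVec ξ) := fun a =>
    (hk.dirDeriv _).comp (smooth_mulVec B)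
  rw [h1, dirDeriv_sum _ fun a => contDiff_const.mul (hs a)]
  refine Finset.sum_congr rfl fun a _ => ?_
  rw [dirDeriv_const_mul (hs a), dirDeriv_comp_mulVec B (hk.dirDeriv _), mul_comm]

end SmoothCalculus

namespace ToricKahler

/-- Test the Hermitian form on real vectors: the real part of its value is the value of the real
part of the matrix. -/
theorem posDef_re {N : Type*} [Fintype N] {M : Matrix N N ℂ} (h : M.PosDef) :
    (Matrix.of fun a b => (M a b).re).PosDef := by
  rw [Matrix.posDef_iff_dotProduct_mulVec] at h ⊢
  refine ⟨?_, fun x hx => ?_⟩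
  · ext a b
    have := congrArg Complex.re (h.1.apply a b)
    simpa using this
  · have hx' : (fun a => (x a : ℂ)) ≠ 0 := fun h0 => hx (by
      ext a; simpa using congrFun h0 a)
    have h1 := (Complex.lt_def.1 (h.2 hx')).1
    simpa [Matrix.mulVec, dotProduct, Complex.mul_re] using h1

end ToricKahler

/-! ## Smooth families of Kähler potentials -/

namespace FanoPolytope

open ToricKahler SmoothCalculus

variable {n d : ℕ} {P : FanoPolytope n d}

/-- A smooth family of Kähler potentials. -/
structure IsSmoothFamily (g : P.KahlerMetric) (Φ : ℝ → P.Manifold → ℝ) : Prop where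
  smooth : ∀ v, Smooth fun q : ℝ × (P.Active v → ℂ) => Φ q.1 (P.chart v q.2)
  potential : ∀ s, IsKahlerPotential g (Φ s)

/-- Through constant families the uniform estimates for families also serve for a single potential.
-/
theorem IsKahlerPotential.constFamily {g : P.KahlerMetric} {φ : P.Manifold → ℝ}
    (h : IsKahlerPotential g φ) : IsSmoothFamily g fun _ => φ :=
  ⟨fun v => (h.1 v).comp contDiff_snd, fun _ => h⟩

/-- The metric coefficients of a family at real points of a chart. -/
def metricMat (g : P.KahlerMetric) (Φ : ℝ → P.Manifold → ℝ) (v : P.Vertex)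
    (q : ℝ × (P.Active v → ℝ)) : Matrix (P.Active v) (P.Active v) ℝ :=
  Matrix.of fun a b => (complexHessian (localPot g (Φ q.1) v) (fun a => (q.2 a : ℂ)) a b).re

theorem metricMat_posDef {g : P.KahlerMetric} {Φ : ℝ → P.Manifold → ℝ}
    (h : ∀ s, IsKahlerPotential g (Φ s)) (v : P.Vertex) (q : ℝ × (P.Active v → ℝ)) :
    (metricMat g Φ v q).PosDef :=
  posDef_re ((h q.1).2.2 v fun a => (q.2 a : ℂ))

theorem localPot_smooth (g : P.KahlerMetric) {φ : P.Manifold → ℝ} (h : P.IsSmooth φ)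
    (v : P.Vertex) : Smooth (localPot g φ v) := (g.weight_smooth v).add (h v)

theorem contDiff_ofReal_pi {N : Type*} [Fintype N] :
    ContDiff ℝ (⊤ : ℕ∞) fun r : N → ℝ => fun a => (r a : ℂ) :=
  contDiff_pi.2 fun a => Complex.ofRealCLM.contDiff.comp (contDiff_apply ℝ ℝ a)

theorem expPoint_smooth {N : Type*} [Fintype N] :
    ContDiff ℝ (⊤ : ℕ∞) (expPoint : (N → ℝ) → N → ℂ) :=
  contDiff_ofReal_pi.comp (contDiff_pi.2 fun a =>
    ((contDiff_apply ℝ ℝ a).div_const 2).exp)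

theorem metricMat_smooth {g : P.KahlerMetric} {Φ : ℝ → P.Manifold → ℝ}
    (h : IsSmoothFamily g Φ) (v : P.Vertex) : SmoothMat (metricMat g Φ v) := by
  have hF : Smooth fun q : ℝ × (P.Active v → ℂ) => localPot g (Φ q.1) v q.2 :=
    ((g.weight_smooth v).comp contDiff_snd).add (h.smooth v)
  intro a b
  have h1 : ∀ (q : ℝ × (P.Active v → ℝ)) (u w : P.Active v → ℂ),
      fderiv ℝ (fderiv ℝ (localPot g (Φ q.1) v)) (fun a => (q.2 a : ℂ)) u w =
      dirDeriv (0, u) (dirDeriv (0, w) fun q : ℝ × (P.Active v → ℂ) => localPot g (Φ q.1) v q.2)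
        (q.1, fun a => (q.2 a : ℂ)) := by
    intro q u w
    have hs := smooth_space_slice hF q.1
    rw [← fderiv_fderiv_apply (hs.contDiffAt.of_le two_le_smooth),
      ← fderiv_space_slice (hF.dirDeriv _)]
    exact congrArg (fun k => fderiv ℝ k (fun a => (q.2 a : ℂ)) u)
      (funext fun y => fderiv_space_slice hF q.1 y w)
  have h2 : (fun q : ℝ × (P.Active v → ℝ) => metricMat g Φ v q a b) = fun q =>
      (dirDeriv (0, Pi.single a 1) (dirDeriv (0, Pi.single b 1)
        fun q : ℝ × (P.Active v → ℂ) => localPot g (Φ q.1) v q.2) (q.1, fun a => (q.2 a : ℂ)) +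
      dirDeriv (0, Pi.single a Complex.I) (dirDeriv (0, Pi.single b Complex.I)
        fun q : ℝ × (P.Active v → ℂ) => localPot g (Φ q.1) v q.2)
          (q.1, fun a => (q.2 a : ℂ))) / 4 := by
    funext q
    rw [metricMat, Matrix.of_apply, complexHessian_re
      ((localPot_smooth g (h.potential q.1).1 v).contDiffAt.of_le two_le_smooth), h1, h1]
  rw [h2]
  have hc : ContDiff ℝ (⊤ : ℕ∞) fun q : ℝ × (P.Active v → ℝ) => (q.1, fun a => (q.2 a : ℂ)) :=
    contDiff_fst.prodMk (contDiff_ofReal_pi.comp contDiff_snd)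
  exact ((((hF.dirDeriv _).dirDeriv _).comp hc).add
    (((hF.dirDeriv _).dirDeriv _).comp hc)).div_const 4

/-- The local potential as a function of the logarithmic coordinates of the chart. -/
theorem localPot_expPoint_logNormSq (g : P.KahlerMetric) {φ : P.Manifold → ℝ}
    (h : P.IsTorusInvariant φ) (v : P.Vertex) {y : P.Active v → ℂ} (hy : ∀ a, y a ≠ 0) :
    localPot g φ v y = localPot g φ v (expPoint (logNormSq y)) := by
  rw [localPot_eq g h v hy, localPot_eq g h v (expPoint_ne_zero _), logNormSq_expPoint]

/-- At real points with r_a > 0 the complex Hessian is r_a⁻¹ (D²)_ab r_b⁻¹. Solving for D² exhibits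
a middle factor that is defined and positive up to r_a = 0. -/
theorem hessMat_localPot (g : P.KahlerMetric) {φ : P.Manifold → ℝ} (h : IsKahlerPotential g φ)
    (v : P.Vertex) (η : P.Active v → ℝ) :
    hessMat stdDir (fun η => localPot g φ v (expPoint η)) η =
      Matrix.diagonal (fun a => Real.exp (η a / 2)) * metricMat g (fun _ => φ) v
        (0, fun a => Real.exp (η a / 2)) * Matrix.diagonal (fun a => Real.exp (η a / 2)) := by
  ext a b
  have hk : Smooth fun η => localPot g φ v (expPoint η) :=
    (localPot_smooth g h.1 v).comp expPoint_smooth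
  have h1 := complexHessian_comp_logNormSq (expPoint_ne_zero η) hk a b
  have h2 : complexHessian (localPot g φ v) (expPoint η) =
      complexHessian (fun y => localPot g φ v (expPoint (logNormSq y))) (expPoint η) :=
    complexHessian_congr (by
      filter_upwards [eventually_nonvanishing (expPoint_ne_zero η)] with y hy
      exact localPot_expPoint_logNormSq g h.2.1 v hy)
  rw [Matrix.mul_diagonal, Matrix.diagonal_mul, metricMat, Matrix.of_apply]
  change _ = _ * (complexHessian (localPot g φ v) (expPoint η) a b).re * _
  rw [h2, h1, logNormSq_expPoint]
  simp only [expPoint, Complex.conj_ofReal, ← Complex.ofReal_inv, ← Complex.ofReal_mul,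
    Complex.ofReal_re]
  have ha := (Real.exp_pos (η a / 2)).ne'
  have hb := (Real.exp_pos (η b / 2)).ne'
  field_simp

theorem torusPot_smooth (g : P.KahlerMetric) {φ : P.Manifold → ℝ} (h : IsKahlerPotential g φ) :
    Smooth (torusPot g φ) := by
  have v := P.nonempty_vertex.some
  rw [show torusPot g φ = _ from funext fun ξ => torusPot_eq_localPot g φ v ξ]
  refine ((localPot_smooth g h.1 v).comp (expPoint_smooth.comp (smooth_mulVec _))).sub ?_
  exact ContDiff.sum fun a _ => (contDiff_apply ℝ ℝ a).comp (smooth_mulVec (P.edgeMat v))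

theorem hessMat_torusPot (g : P.KahlerMetric) {φ : P.Manifold → ℝ} (h : IsKahlerPotential g φ)
    (v : P.Vertex) (ξ : Fin n → ℝ) :
    hessMat stdDir (torusPot g φ) ξ = (P.edgeMat v).transpose *
      hessMat stdDir (fun η => localPot g φ v (expPoint η)) (P.edgeCoord v ξ) * P.edgeMat v := by
  have hk : Smooth fun η => localPot g φ v (expPoint η) :=
    (localPot_smooth g h.1 v).comp expPoint_smooth
  have h1 : torusPot g φ = fun ξ => (fun η => localPot g φ v (expPoint η))
      ((P.edgeMat v).mulVec ξ) - ∑ j, (-v.1 j) * ξ j := by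
    funext ξ
    rw [torusPot_eq_localPot g φ v ξ, P.sum_edgeCoord]
    simp only [neg_mul, Finset.sum_neg_distrib, mul_comm (v.1 _)]
    rfl
  have h2 : Smooth fun ξ => (fun η => localPot g φ v (expPoint η)) ((P.edgeMat v).mulVec ξ) :=
    hk.comp (smooth_mulVec _)
  rw [h1, hessMat_sub_linear h2, hessMat_comp_mulVec _ hk]
  rfl

/-- The Hessian is congruent to the positive metric matrix of a chart, by the injective matrix that
combines the edges with the radii. -/
theorem hessMat_torusPot_posDef (g : P.KahlerMetric) {φ : P.Manifold → ℝ}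
    (h : IsKahlerPotential g φ) (ξ : Fin n → ℝ) :
    (hessMat stdDir (torusPot g φ) ξ).PosDef := by
  have v := P.nonempty_vertex.some
  set D := Matrix.diagonal fun a => Real.exp (P.edgeCoord v ξ a / 2)
  have hG := metricMat_posDef (Φ := fun _ => φ) (fun _ => h) v
    (0, fun a => Real.exp (P.edgeCoord v ξ a / 2))
  have hinj : Function.Injective (D * P.edgeMat v).mulVec := by
    have : P.normalMat v * Matrix.diagonal (fun a => (Real.exp (P.edgeCoord v ξ a / 2))⁻¹) *
        (D * P.edgeMat v) = 1 := by
      rw [Matrix.mul_assoc, ← Matrix.mul_assoc _ D, Matrix.diagonal_mul_diagonal]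
      simp only [inv_mul_cancel₀ (Real.exp_pos _).ne', Matrix.diagonal_one, Matrix.one_mul,
        P.normalMat_mul_edgeMat]
    intro x y hxy
    have h1 := congrArg (Matrix.mulVec (P.normalMat v *
      Matrix.diagonal fun a => (Real.exp (P.edgeCoord v ξ a / 2))⁻¹)) hxy
    simpa only [Matrix.mulVec_mulVec, this, Matrix.one_mulVec] using h1
  have h1 := hG.conjTranspose_mul_mul_same hinj
  rw [hessMat_torusPot g h v, hessMat_localPot g h v]
  convert h1 using 1
  rw [Matrix.conjTranspose_eq_transpose_of_trivial, Matrix.transpose_mul,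
    Matrix.diagonal_transpose]
  simp only [Matrix.mul_assoc]
  rfl

/-- The toric chart of a smooth family of Kähler potentials at a vertex. -/
def toricChart {g : P.KahlerMetric} {Φ : ℝ → P.Manifold → ℝ} (h : IsSmoothFamily g Φ)
    (v : P.Vertex) : ToricChart (fun p : ℝ × (Fin n → ℝ) => torusPot g (Φ p.1) p.2) (P.Active v) where
  B := P.edgeMat v
  C := P.normalMat v
  BC := P.edgeMat_mul_normalMat v
  CB := P.normalMat_mul_edgeMat v
  F q := localPot g (Φ q.1) v fun a => (q.2 a : ℂ)
  F_smooth := by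
    have hF : Smooth fun q : ℝ × (P.Active v → ℂ) => localPot g (Φ q.1) v q.2 :=
      ((g.weight_smooth v).comp contDiff_snd).add (h.smooth v)
    exact hF.comp (contDiff_fst.prodMk (contDiff_ofReal_pi.comp contDiff_snd))
  G := metricMat g Φ v
  G_smooth := metricMat_smooth h v
  G_pos q := (metricMat_posDef h.potential v q).det_pos
  f_eq p := torusPot_eq_localPot g (Φ p.1) v p.2
  hess_eq p := by
    obtain ⟨s, ξ⟩ := p
    have hs : Smooth fun p : ℝ × (Fin n → ℝ) => torusPot g (Φ p.1) p.2 := by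
      have hF : Smooth fun q : ℝ × (P.Active v → ℂ) => localPot g (Φ q.1) v q.2 :=
        ((g.weight_smooth v).comp contDiff_snd).add (h.smooth v)
      simp only [torusPot_eq_localPot g _ v]
      refine (hF.comp (contDiff_fst.prodMk
        (expPoint_smooth.comp ((smooth_mulVec _).comp contDiff_snd)))).sub ?_
      exact ContDiff.sum fun a _ =>
        (contDiff_apply ℝ ℝ a).comp ((smooth_mulVec (P.edgeMat v)).comp contDiff_snd)
    have h1 := congrFun (hessMat_slice hs s) ξ
    rw [← h1, hessMat_torusPot g (h.potential s) v, hessMat_localPot g (h.potential s) v]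
    rfl

end FanoPolytope

/-! ## Integrals of a smooth family of Kähler potentials -/

namespace FanoPolytope

open ToricKahler SmoothCalculus Asymptotics Filter

variable {n d : ℕ} {P : FanoPolytope n d}

variable (P) in
/-- An integrable majorant. -/
def decay (ξ : Fin n → ℝ) : ℝ :=
  (1 + ‖ξ‖) * Real.exp (-(P.exists_sum_edgeCoord_le.choose / 2 * ‖ξ‖))

variable (P) in
theorem decay_nonneg (ξ : Fin n → ℝ) : 0 ≤ P.decay ξ := by unfold decay; positivity

variable (P) in
theorem integrable_decay : Integrable P.decay :=
  integrable_one_add_norm_mul_exp (half_pos P.exists_sum_edgeCoord_le.choose_spec.1)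

/-- The cones of the finitely many vertices cover ℝⁿ, so local constants add up to a global one. -/
theorem exists_bound_of_isBigO {g : P.KahlerMetric} {Φ : ℝ → P.Manifold → ℝ}
    (h : IsSmoothFamily g Φ) {S : ℝ} {Q w : ℝ × (Fin n → ℝ) → ℝ}
    (hQ : ∀ v, Q =O[𝓟 ((toricChart h v).cone S)] w) :
    ∃ K : ℝ, ∀ s ∈ Set.Icc 0 S, ∀ ξ, |Q (s, ξ)| ≤ K * |w (s, ξ)| := by
  have hfin : Fintype P.Vertex := Fintype.ofFinite _
  choose K hK using fun v => isBigO_principal.1 (hQ v)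
  refine ⟨∑ v, |K v|, fun s hs ξ => ?_⟩
  obtain ⟨v, hv, -⟩ := P.exists_edgeCoord_nonpos ξ
  have h1 := hK v (s, ξ) ⟨hs, hv⟩
  simp only [Real.norm_eq_abs] at h1
  refine h1.trans (mul_le_mul_of_nonneg_right ?_ (abs_nonneg _))
  exact (le_abs_self _).trans
    (Finset.single_le_sum (f := fun v => |K v|) (fun v _ => abs_nonneg _) (Finset.mem_univ v))

/-- The weight is e^{∑ η_a/2}, and on its cone ∑ η_a ≤ -c|ξ|; hence the rate c/2 in `decay`. -/
theorem exists_decay_bound {g : P.KahlerMetric} {Φ : ℝ → P.Manifold → ℝ}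
    (h : IsSmoothFamily g Φ) {S : ℝ} {Q : ℝ × (Fin n → ℝ) → ℝ}
    (hQ : ∀ v, Q =O[𝓟 ((toricChart h v).cone S)]
      fun p => (1 + ‖p.2‖) * (toricChart h v).weight p) :
    ∃ K : ℝ, 0 ≤ K ∧ ∀ s ∈ Set.Icc 0 S, ∀ ξ, |Q (s, ξ)| ≤ K * P.decay ξ := by
  obtain ⟨K, hK⟩ := exists_bound_of_isBigO h (S := S) (w := fun p => P.decay p.2) fun v => by
    refine (hQ v).trans (isBigO_principal.2 ⟨1, fun p hp => ?_⟩)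
    have h1 := P.exists_sum_edgeCoord_le.choose_spec.2 v p.2 hp.2
    rw [one_mul, Real.norm_of_nonneg (P.decay_nonneg _), Real.norm_of_nonneg
      (mul_nonneg (by positivity) ((toricChart h v).weight_pos p).le), ToricChart.weight_eq_exp,
      decay]
    refine mul_le_mul_of_nonneg_left (Real.exp_le_exp.2 ?_) (by positivity)
    have h2 : ∑ a, (toricChart h v).B.mulVec p.2 a = ∑ a, P.edgeCoord v p.2 a := rfl
    rw [h2]; linarith
  refine ⟨|K|, abs_nonneg _, fun s hs ξ => (hK s hs ξ).trans ?_⟩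
  rw [abs_of_nonneg (P.decay_nonneg ξ)]
  exact mul_le_mul_of_nonneg_right (le_abs_self K) (P.decay_nonneg ξ)

theorem IsSmoothFamily.torusPot_smooth {g : P.KahlerMetric} {Φ : ℝ → P.Manifold → ℝ}
    (h : IsSmoothFamily g Φ) : Smooth fun p : ℝ × (Fin n → ℝ) => torusPot g (Φ p.1) p.2 :=
  (toricChart h P.nonempty_vertex.some).smooth

theorem IsSmoothFamily.det_pos {g : P.KahlerMetric} {Φ : ℝ → P.Manifold → ℝ}
    (h : IsSmoothFamily g Φ) (p : ℝ × (Fin n → ℝ)) :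
    0 < (hessMat spaceDir (fun p : ℝ × (Fin n → ℝ) => torusPot g (Φ p.1) p.2) p).det :=
  (toricChart h P.nonempty_vertex.some).det_hess_pos p

/-- The reduced functional in logarithmic coordinates. -/
def entropyIntegral (θ : Fin n → ℝ) (f : (Fin n → ℝ) → ℝ) : ℝ :=
  ∫ ξ, entropyDensity stdDir f (fun j ξ => ξ j) ξ * rho stdDir θ f ξ

/-- The pointwise identity `entropy_variation` is a conservation law for the entropy density times
ρ. The decay estimates make density, source and flux uniformly integrable, so the flux disappears.
-/
theorem entropyIntegral_sub {g : P.KahlerMetric} {Φ : ℝ → P.Manifold → ℝ}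
    (h : IsSmoothFamily g Φ) (θ : Fin n → ℝ) {S : ℝ} (hS : 0 ≤ S) :
    entropyIntegral θ (torusPot g (Φ S)) - entropyIntegral θ (torusPot g (Φ 0)) =
      -∫ s in (0 : ℝ)..S, ∫ ξ, deriv (fun s => torusPot g (Φ s) ξ) s *
        weightedLaplacian stdDir θ (torusPot g (Φ s)) (fun ξ => ricciPot stdDir (torusPot g (Φ s)) ξ -
          momentTheta stdDir θ (torusPot g (Φ s)) ξ) ξ * rho stdDir θ (torusPot g (Φ s)) ξ := by
  set f : ℝ × (Fin n → ℝ) → ℝ := fun p => torusPot g (Φ p.1) p.2 with hf_def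
  have hf : Smooth f := h.torusPot_smooth
  have hd : ∀ p, (hessMat spaceDir f p).det ≠ 0 := fun p => (h.det_pos p).ne'
  have hξ : ∀ j, Smooth fun p : ℝ × (Fin n → ℝ) => p.2 j := fun j => smooth_snd_apply j
  have hχ : Smooth fun q => ricciPot spaceDir f q - momentTheta spaceDir θ f q :=
    (ricciPot_smooth hf hd).sub (momentTheta_smooth hf)
  have hρ := rho_smooth (e := spaceDir) (θ := θ) hf hd
  have hA := entropyDensity_smooth hf hd hξ
  have hvar := entropy_variation (e := spaceDir) (θ := θ) hf hd hξ timeDir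
    (fun i j p => by
      rw [dirDeriv_snd_apply]; simp [spaceDir, Pi.single_apply, eq_comm])
    (fun j p => by rw [dirDeriv_snd_apply]; simp [timeDir])
  obtain ⟨K1, hK1, hb1⟩ := exists_decay_bound h (S := S)
    fun v => (toricChart h v).entropy_isBigO θ
  obtain ⟨K2, hK2, hb2⟩ := exists_decay_bound h (S := S)
    fun v => (toricChart h v).laplacian_isBigO θ
  choose K3 hK3 hb3 using fun b => exists_decay_bound h (S := S)
    fun v => (toricChart h v).flux_isBigO θ b
  have hle : ∀ {K : ℝ} {t : ℝ} (ξ : Fin n → ℝ), K ≤ K1 + K2 + ∑ b, K3 b → t ≤ K * P.decay ξ →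
      t ≤ (K1 + K2 + ∑ b, K3 b) * P.decay ξ := fun ξ h1 h2 =>
    h2.trans (mul_le_mul_of_nonneg_right h1 (P.decay_nonneg ξ))
  have hs3 : 0 ≤ ∑ b, K3 b := Finset.sum_nonneg fun b _ => hK3 b
  have hinv := SmoothMat.inv (hessMat_smooth spaceDir hf) hd
  have hflux : ∀ a, Smooth (fluxForm spaceDir θ f (fun j p => p.2 j) (dirDeriv timeDir f) a) :=
    fun a => fluxForm_smooth hf hd hξ (hf.dirDeriv _) a
  have hlap : Smooth (weightedLaplacian spaceDir θ f
      fun q => ricciPot spaceDir f q - momentTheta spaceDir θ f q) := by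
    unfold weightedLaplacian
    exact (ContDiff.sum fun i _ => ContDiff.sum fun j _ =>
      (hinv i j).mul (hessMat_smooth spaceDir hχ i j)).add
      (ContDiff.sum fun i _ => contDiff_const.mul (hχ.dirDeriv _))
  have hmain := integral_sub_eq_of_conservation (Q := fun q => entropyDensity spaceDir f
      (fun j p => p.2 j) q * rho spaceDir θ f q)
    (J := fun p => dirDeriv timeDir f p * weightedLaplacian spaceDir θ f
      (fun q => ricciPot spaceDir f q - momentTheta spaceDir θ f q) p * rho spaceDir θ f p)
    (W := fun b q => rho spaceDir θ f q * ∑ a, (hessMat spaceDir f q)⁻¹ a b *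
      fluxForm spaceDir θ f (fun j p => p.2 j) (dirDeriv timeDir f) a q)
    (hA.mul hρ) (((hf.dirDeriv _).mul hlap).mul hρ).continuous
    (fun b => hρ.mul (ContDiff.sum fun a _ => (hinv a b).mul (hflux a))) hvar hS
    -- A single majorant, with the sum of all constants, dominates density, source and every flux
    -- component.
    (g := fun ξ => (K1 + K2 + ∑ b, K3 b) * P.decay ξ) (P.integrable_decay.const_mul _)
    (fun s hs ξ => hle ξ (by linarith) (hb1 s hs ξ))
    (fun s hs ξ => hle ξ (by linarith) (hb2 s hs ξ))
    (fun b s hs ξ => hle ξ (by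
      have := Finset.single_le_sum (f := K3) (fun b _ => hK3 b) (Finset.mem_univ b)
      linarith) (hb3 b s hs ξ))
  have hslice : ∀ s, torusPot g (Φ s) = fun ξ => f (s, ξ) := fun s => rfl
  simp only [entropyIntegral, hslice, entropyDensity_slice hf, rho_slice hf, ricciPot_slice hf,
    momentTheta_slice hf, (hasDerivAt_time_slice hf _ _).deriv]
  rw [hmain]
  congr 2
  funext s
  congr 1
  funext ξ
  rw [weightedLaplacian_slice hf s θ hχ]

/-! ### Integrability and moments for a single potential. -/

section Single

variable {g : P.KahlerMetric} {φ : P.Manifold → ℝ} (h : IsKahlerPotential g φ)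
include h

theorem integrable_of_decay {Q : (Fin n → ℝ) → ℝ} (hc : Continuous Q)
    (hQ : ∀ v, (fun p : ℝ × (Fin n → ℝ) => Q p.2) =O[𝓟 ((toricChart h.constFamily v).cone 0)]
      fun p => (1 + ‖p.2‖) * (toricChart h.constFamily v).weight p) : Integrable Q := by
  obtain ⟨K, -, hK⟩ := exists_decay_bound h.constFamily hQ
  exact (P.integrable_decay.const_mul K).mono' hc.aestronglyMeasurable
    (Eventually.of_forall fun ξ => hK 0 (by simp) ξ)

theorem rho_torusPot_eq (θ : Fin n → ℝ) (p : ℝ × (Fin n → ℝ)) :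
    rho stdDir θ (torusPot g φ) p.2 = rho spaceDir θ
      (fun p : ℝ × (Fin n → ℝ) => torusPot g ((fun _ => φ) p.1) p.2) p := by
  have := congrFun (rho_slice h.constFamily.torusPot_smooth p.1 θ) p.2
  exact this

theorem det_torusPot_pos (ξ : Fin n → ℝ) : 0 < (hessMat stdDir (torusPot g φ) ξ).det :=
  (hessMat_torusPot_posDef g h ξ).det_pos

theorem rho_torusPot_smooth (θ : Fin n → ℝ) : Smooth (rho stdDir θ (torusPot g φ)) :=
  rho_smooth (torusPot_smooth g h) fun ξ => (det_torusPot_pos h ξ).ne'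

theorem logDet_torusPot_smooth : Smooth (logDet stdDir (torusPot g φ)) :=
  logDet_smooth (torusPot_smooth g h) fun ξ => (det_torusPot_pos h ξ).ne'

theorem integrable_entropy (θ : Fin n → ℝ) :
    Integrable fun ξ => entropyDensity stdDir (torusPot g φ) (fun j ξ => ξ j) ξ *
      rho stdDir θ (torusPot g φ) ξ := by
  have hs := h.constFamily.torusPot_smooth
  refine integrable_of_decay h ?_ fun v => ?_
  · exact ((entropyDensity_smooth (torusPot_smooth g h) (fun ξ => (det_torusPot_pos h ξ).ne')
      (fun j => contDiff_apply ℝ ℝ j)).mul (rho_torusPot_smooth h θ)).continuous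
  · refine ((toricChart h.constFamily v).entropy_isBigO θ).congr_left fun p => ?_
    rw [rho_torusPot_eq h, ← congrFun (entropyDensity_slice hs p.1) p.2]

theorem integrable_logDet (θ : Fin n → ℝ) :
    Integrable fun ξ => logDet stdDir (torusPot g φ) ξ * rho stdDir θ (torusPot g φ) ξ := by
  have hs := h.constFamily.torusPot_smooth
  refine integrable_of_decay h
    ((logDet_torusPot_smooth h).mul (rho_torusPot_smooth h θ)).continuous fun v => ?_
  refine ((toricChart h.constFamily v).logDet_rho_isBigO θ).congr_left fun p => ?_
  rw [rho_torusPot_eq h, ← congrFun (logDet_slice hs p.1) p.2]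

theorem integrable_exp_neg : Integrable fun ξ => Real.exp (-torusPot g φ ξ) :=
  integrable_of_decay h (torusPot_smooth g h).continuous.neg.rexp fun v =>
    (toricChart h.constFamily v).exp_neg_isBigO

theorem momentTheta_torusPot_eq (θ : Fin n → ℝ) (p : ℝ × (Fin n → ℝ)) :
    momentTheta stdDir θ (torusPot g φ) p.2 = momentTheta spaceDir θ
      (fun p : ℝ × (Fin n → ℝ) => torusPot g ((fun _ => φ) p.1) p.2) p :=
  congrFun (momentTheta_slice h.constFamily.torusPot_smooth p.1 θ) p.2

theorem momentTheta_torusPot_continuous (θ : Fin n → ℝ) :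
    Continuous (momentTheta stdDir θ (torusPot g φ)) :=
  (momentTheta_smooth (torusPot_smooth g h)).continuous

theorem integrable_momentTheta_mul_exp_neg (θ : Fin n → ℝ) :
    Integrable fun ξ => momentTheta stdDir θ (torusPot g φ) ξ * Real.exp (-torusPot g φ ξ) := by
  refine integrable_of_decay h ((momentTheta_torusPot_continuous h θ).mul
    (torusPot_smooth g h).continuous.neg.rexp) fun v => ?_
  refine (((toricChart h.constFamily v).momentTheta_isBigO θ).mul
    (toricChart h.constFamily v).exp_neg_isBigO).congr (fun p => ?_) (fun p => by rw [one_mul])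
  rw [momentTheta_torusPot_eq h]

/-- The barycenter formula: the moments of `e^{-f}` vanish. -/
theorem integral_momentTheta_mul_exp_neg (θ : Fin n → ℝ) :
    ∫ ξ, momentTheta stdDir θ (torusPot g φ) ξ * Real.exp (-torusPot g φ ξ) = 0 := by
  have hf := torusPot_smooth g h
  have hj : ∀ j, Integrable (fun ξ => dirDeriv (stdDir j) (torusPot g φ) ξ *
      Real.exp (-torusPot g φ ξ)) ∧ ∫ ξ, dirDeriv (stdDir j) (torusPot g φ) ξ *
      Real.exp (-torusPot g φ ξ) = 0 := by
    intro j
    have h1 := integrable_momentTheta_mul_exp_neg h (Pi.single j 1)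
    simp only [momentTheta, Pi.single_apply, ite_mul, one_mul, zero_mul, Finset.sum_ite_eq',
      Finset.mem_univ, if_true] at h1
    refine ⟨h1, ?_⟩
    have h2 : ∀ ξ, HasLineDerivAt ℝ (fun ξ => Real.exp (-torusPot g φ ξ))
        (-(dirDeriv (stdDir j) (torusPot g φ) ξ * Real.exp (-torusPot g φ ξ))) ξ (stdDir j) := by
      intro ξ
      have h3 := ((hf.diff ξ).hasFDerivAt.neg.exp).hasLineDerivAt (stdDir j)
      rwa [_root_.smul_apply, _root_.neg_apply, smul_eq_mul, mul_neg, mul_comm] at h3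
    -- Integration by parts against the constant function 1: the derivative of an integrable
    -- function with integrable derivative has integral zero.
    have h3 := integral_bilinear_hasLineDerivAt_right_eq_neg_left_of_integrable
      (μ := volume) (B := ContinuousLinearMap.mul ℝ ℝ) (f := fun _ => (1 : ℝ)) (f' := fun _ => 0)
      (v := (stdDir j : Fin n → ℝ)) (g := fun ξ => Real.exp (-torusPot g φ ξ))
      (g' := fun ξ => -(dirDeriv (stdDir j) (torusPot g φ) ξ * Real.exp (-torusPot g φ ξ)))
      (by simp) (by simpa using h1) (by simpa using integrable_exp_neg h)
      (fun ξ _ => by simpa using (hasFDerivAt_const (1 : ℝ) ξ).hasLineDerivAt (stdDir j))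
      (fun ξ _ => h2 ξ)
    simpa [integral_neg] using h3
  simp only [momentTheta, Finset.sum_mul, mul_assoc]
  rw [integral_finsetSum _ fun j _ => (hj j).1.const_mul _]
  simp only [integral_const_mul, (hj _).2, mul_zero, Finset.sum_const_zero]

theorem exists_ricciPot_bound : ∃ K : ℝ, ∀ ξ, |ricciPot stdDir (torusPot g φ) ξ| ≤ K := by
  obtain ⟨K, hK⟩ := exists_bound_of_isBigO h.constFamily (S := 0) (w := fun _ => 1)
    fun v => (toricChart h.constFamily v).ricciPot_isBigO
  refine ⟨K, fun ξ => ?_⟩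
  have h1 := hK 0 (by simp) ξ
  rw [← congrFun (ricciPot_slice h.constFamily.torusPot_smooth 0) ξ] at h1
  simpa using h1

end Single

end FanoPolytope

/-! ## Curvature, Ricci potentials and field potentials on the open orbit -/

namespace FanoPolytope

open ToricKahler SmoothCalculus

variable {n d : ℕ} {P : FanoPolytope n d}

theorem contDiffAt_logNormSq {N : Type*} [Fintype N] {w : N → ℂ} (hw : ∀ j, w j ≠ 0) :
    ContDiffAt ℝ (⊤ : ℕ∞) (logNormSq : (N → ℂ) → N → ℝ) w := by
  refine contDiffAt_pi.2 fun j => ContDiffAt.log ?_ (pow_ne_zero 2 (norm_ne_zero_iff.2 (hw j)))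
  exact ((contDiff_norm_sq ℝ).comp (contDiff_apply ℝ ℂ j)).contDiffAt

variable (P) in
theorem contDiffAt_monomial (v : P.Vertex) {w : Fin n → ℂ} (hw : ∀ j, w j ≠ 0) :
    ContDiffAt ℝ (⊤ : ℕ∞) (P.monomial v) w := by
  refine contDiffAt_pi.2 fun a => ContDiffAt.congr_of_eventuallyEq (f := fun w : Fin n → ℂ =>
    ∏ j, w j ^ P.edge v a j) (contDiffAt_prod fun j _ => ?_) (Filter.Eventually.of_forall fun _ => rfl)
  have h1 : ContDiffAt ℝ (⊤ : ℕ∞) (fun w : Fin n → ℂ => w j) w := (contDiff_apply ℝ ℂ j).contDiffAt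
  cases P.edge v a j with
  | ofNat m => simpa using h1.pow m
  | negSucc m =>
    simp only [zpow_negSucc]
    exact (h1.pow (m + 1)).inv (pow_ne_zero _ (hw j))

theorem IsSmooth.contDiffAt_orbit {F : P.Manifold → ℝ} (hF : P.IsSmooth F) {w : Fin n → ℂ}
    (hw : ∀ j, w j ≠ 0) : ContDiffAt ℝ (⊤ : ℕ∞) (fun w => F (P.orbit w)) w := by
  let v := P.nonempty_vertex.some
  refine ((hF v).contDiffAt.comp w (P.contDiffAt_monomial v hw)).congr_of_eventuallyEq ?_
  filter_upwards [eventually_nonvanishing hw] with y hy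
  rw [P.orbit_eq_chart v hy]; rfl

/-- Compactness of the manifold in concrete form: every point of the torus lies in the closed unit
polydisc of one of finitely many charts. -/
theorem IsSmooth.exists_bound {F : P.Manifold → ℝ} (hF : P.IsSmooth F) :
    ∃ K : ℝ, ∀ w : Fin n → ℂ, (∀ j, w j ≠ 0) → |F (P.orbit w)| ≤ K := by
  have hfin : Fintype P.Vertex := Fintype.ofFinite _
  choose K hK using fun v => (isCompact_closedBall (0 : P.Active v → ℂ) 1).exists_bound_of_continuousOn
    (hF v).continuous.continuousOn
  refine ⟨∑ v, |K v|, fun w hw => ?_⟩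
  obtain ⟨v, hv, -⟩ := P.exists_edgeCoord_nonpos (logNormSq w)
  have hball : P.monomial v w ∈ Metric.closedBall (0 : P.Active v → ℂ) 1 := by
    rw [mem_closedBall_zero_iff, pi_norm_le_iff_of_nonneg zero_le_one]
    intro a
    have h1 := hv a
    rw [← P.logNormSq_monomial v hw, logNormSq, Real.log_pow] at h1
    have h2 : Real.log ‖P.monomial v w a‖ ≤ 0 := by push_cast at h1; linarith
    exact (Real.log_nonpos_iff (norm_nonneg _)).1 h2
  have h1 := hK v _ hball
  rw [← P.orbit_eq_chart v hw, Real.norm_eq_abs] at h1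
  exact h1.trans ((le_abs_self _).trans
    (Finset.single_le_sum (f := fun v => |K v|) (fun v _ => abs_nonneg _) (Finset.mem_univ v)))

/-! ### Identification of the Ricci and field potentials. -/

section

variable {g : P.KahlerMetric} {φ : P.Manifold → ℝ} (hφ : IsKahlerPotential g φ)
include hφ

theorem orbitMetric_eq {w : Fin n → ℂ} (hw : ∀ j, w j ≠ 0) :
    orbitMetric g φ w = complexHessian (fun y => torusPot g φ (logNormSq y)) w :=
  complexHessian_congr (by
    filter_upwards [eventually_nonvanishing hw] with y hy
    exact pot_orbit g hφ.2.1 hy)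

theorem isLogMetric_orbitMetric : IsLogMetric (torusPot g φ) (orbitMetric g φ) := by
  intro w hw a b
  rw [orbitMetric_eq hφ hw, complexHessian_comp_logNormSq hw (torusPot_smooth g hφ)]

theorem ricciPot_torusPot_smooth : Smooth (ricciPot stdDir (torusPot g φ)) :=
  ricciPot_smooth (torusPot_smooth g hφ) fun ξ => (det_torusPot_pos hφ ξ).ne'

theorem hessMat_ricciPot (ξ : Fin n → ℝ) (a b : Fin n) :
    hessMat stdDir (ricciPot stdDir (torusPot g φ)) ξ a b =
      -hessMat stdDir (logDet stdDir (torusPot g φ)) ξ a b -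
        hessMat stdDir (torusPot g φ) ξ a b := by
  have hL := logDet_torusPot_smooth hφ
  have hf := torusPot_smooth g hφ
  simp only [hessMat, Matrix.of_apply]
  have h1 : dirDeriv (stdDir b) (ricciPot stdDir (torusPot g φ)) =
      fun ξ => -dirDeriv (stdDir b) (logDet stdDir (torusPot g φ)) ξ -
        dirDeriv (stdDir b) (torusPot g φ) ξ := by
    funext ξ
    unfold ricciPot
    rw [dirDeriv_sub hL.neg hf, dirDeriv_neg]
  rw [h1, dirDeriv_sub (hL.dirDeriv _).neg (hf.dirDeriv _), dirDeriv_neg]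

/-- The Ricci potential is unique up to a constant. -/
theorem IsRicciPotential.exists_eq {h : P.Manifold → ℝ} (hh : IsRicciPotential g φ h) :
    ∃ c : ℝ, ∀ w : Fin n → ℂ, (∀ j, w j ≠ 0) →
      h (P.orbit w) = ricciPot stdDir (torusPot g φ) (logNormSq w) + c := by
  have hR := ricciPot_torusPot_smooth hφ
  have hc1 : ∀ w : Fin n → ℂ, (∀ j, w j ≠ 0) → ContDiffAt ℝ 2 (fun w => h (P.orbit w)) w :=
    fun w hw => (hh.1.contDiffAt_orbit hw).of_le two_le_smooth
  have hc2 : ∀ w : Fin n → ℂ, (∀ j, w j ≠ 0) →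
      ContDiffAt ℝ 2 (fun w => ricciPot stdDir (torusPot g φ) (logNormSq w)) w :=
    fun w hw => (hR.contDiffAt.comp w (contDiffAt_logNormSq hw)).of_le two_le_smooth
  obtain ⟨K1, hK1⟩ := hh.1.exists_bound
  obtain ⟨K2, hK2⟩ := exists_ricciPot_bound hφ
  have hone : ∀ j : Fin n, (1 : Fin n → ℂ) j ≠ 0 := fun j => one_ne_zero
  refine ⟨h (P.orbit 1) - ricciPot stdDir (torusPot g φ) (logNormSq 1), fun w hw => ?_⟩
  -- The two Ricci potentials have the same complex Hessian and are both bounded on the torus, so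
  -- Liouville makes their difference constant.
  have := eq_of_bounded_pluriharmonic
    (k := fun w => h (P.orbit w) - ricciPot stdDir (torusPot g φ) (logNormSq w))
    (fun w hw => (hc1 w hw).sub (hc2 w hw)) (fun w hw => ?_) (M := K1 + K2)
    (fun w hw => (abs_sub _ _).trans (add_le_add (hK1 w hw) (hK2 _))) hw hone
  · linarith
  · rw [complexHessian_sub (hc1 w hw) (hc2 w hw), ← hh.2 w hw]
    ext a b
    have hg := isLogMetric_orbitMetric hφ
    rw [Matrix.sub_apply, Matrix.sub_apply, complexHessian_comp_logNormSq hw hR,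
      hg.ricci (torusPot_smooth g hφ) (det_torusPot_pos hφ) hw, hg w hw, hessMat_ricciPot hφ]
    push_cast
    simp only [Matrix.zero_apply]
    ring

/-- Integrals over the manifold in logarithmic coordinates. -/
theorem integralM_eq {F : (Fin n → ℂ) → ℂ} {k : (Fin n → ℝ) → ℝ}
    (hF : ∀ w : Fin n → ℂ, (∀ j, w j ≠ 0) → F w = k (logNormSq w)) :
    integralM g φ F =
      (((2 * Real.pi) ^ n * ∫ ξ, k ξ * (hessMat stdDir (torusPot g φ) ξ).det : ℝ) : ℂ) := by
  have hg := isLogMetric_orbitMetric hφ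
  have hm : MeasurableSet (torus n) := (isOpen_nonvanishing (N := Fin n)).measurableSet
  have h1 : integralM g φ F = ∫ w in torus n, (((∏ a, (‖w a‖ ^ 2)⁻¹) •
      (fun ξ => 2 ^ n * (k ξ * (hessMat stdDir (torusPot g φ) ξ).det)) (logNormSq w) : ℝ) : ℂ) := by
    refine setIntegral_congr_fun hm fun w hw => ?_
    dsimp only
    rw [hF w hw, hg.volumeDensity hw, Fintype.card_fin]
    push_cast
    simp only [smul_eq_mul]
    push_cast
    ring
  -- The volume density contributes 2ⁿ and the integration over the torus πⁿ.
  have h2 := integral_torus_comp_logNormSq (N := Fin n)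
    (fun ξ => 2 ^ n * (k ξ * (hessMat stdDir (torusPot g φ) ξ).det))
  rw [h1, integral_complex_ofReal]
  congr 1
  refine h2.trans ?_
  rw [Fintype.card_fin, integral_const_mul, smul_eq_mul, mul_pow]
  ring

/-- With the Ricci potential as exponent the determinant cancels, so the normalization of Θ becomes
an integral against e^{-f}. -/
theorem exp_ricciPot_mul_det (ξ : Fin n → ℝ) :
    Real.exp (ricciPot stdDir (torusPot g φ) ξ) * (hessMat stdDir (torusPot g φ) ξ).det =
      Real.exp (-torusPot g φ ξ) := by
  rw [ricciPot, sub_eq_add_neg, Real.exp_add, logDet, Real.exp_neg (Real.log _),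
    Real.exp_log (det_torusPot_pos hφ ξ)]
  have := (det_torusPot_pos hφ ξ).ne'
  field_simp

/-- The potential of the field is the moment of `θ`. -/
theorem IsFieldPotential.eq {θ : Fin n → ℝ} {h Θ : P.Manifold → ℝ} (hh : IsRicciPotential g φ h)
    (hΘ : IsFieldPotential g θ φ h Θ) {w : Fin n → ℂ} (hw : ∀ j, w j ≠ 0) :
    Θ (P.orbit w) = momentTheta stdDir θ (torusPot g φ) (logNormSq w) := by
  obtain ⟨c', hc'⟩ := hh.exists_eq hφ
  have hf := torusPot_smooth g hφ
  have hm : Smooth (momentTheta stdDir θ (torusPot g φ)) := momentTheta_smooth hf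
  have hg := isLogMetric_orbitMetric hφ
  have hd1 : ∀ w : Fin n → ℂ, (∀ j, w j ≠ 0) → DifferentiableAt ℝ (fun w => Θ (P.orbit w)) w :=
    fun w hw => (hΘ.1.contDiffAt_orbit hw).differentiableAt (by simp)
  have hd2 : ∀ w : Fin n → ℂ, (∀ j, w j ≠ 0) →
      DifferentiableAt ℝ (fun w => momentTheta stdDir θ (torusPot g φ) (logNormSq w)) w :=
    fun w hw => (hm.contDiffAt.comp w (contDiffAt_logNormSq hw)).differentiableAt (by simp)
  have hone : ∀ j : Fin n, (1 : Fin n → ℂ) j ≠ 0 := fun j => one_ne_zero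
  have hdb : ∀ w : Fin n → ℂ, (∀ j, w j ≠ 0) → ∀ b, dzbar (fun y => ((Θ (P.orbit y) -
      momentTheta stdDir θ (torusPot g φ) (logNormSq y) : ℝ) : ℂ)) b w = 0 := by
    intro w hw b
    have e1 : dzbar (fun y => ((Θ (P.orbit y) -
        momentTheta stdDir θ (torusPot g φ) (logNormSq y) : ℝ) : ℂ)) b w =
        dzbar (fun y => (Θ (P.orbit y) : ℂ)) b w -
        dzbar (fun y => (momentTheta stdDir θ (torusPot g φ) (logNormSq y) : ℂ)) b w := by
      have d1 : DifferentiableAt ℝ (fun w => (Θ (P.orbit w) : ℂ)) w :=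
        Complex.ofRealCLM.differentiableAt.comp w (hd1 w hw)
      have d2 : DifferentiableAt ℝ
          (fun w => (momentTheta stdDir θ (torusPot g φ) (logNormSq w) : ℂ)) w :=
        Complex.ofRealCLM.differentiableAt.comp w (hd2 w hw)
      simp only [dzbar, Complex.ofReal_sub]
      rw [fderiv_fun_sub d1 d2]
      simp only [_root_.sub_apply]
      ring
    rw [e1, ← hΘ.2.1 w hw b, dzbar_comp_logNormSq hw hm, dirDeriv_momentTheta hf]
    simp only [hg w hw, toricField]
    rw [sub_eq_zero]
    push_cast
    rw [div_eq_mul_inv, Finset.sum_mul]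
    refine Finset.sum_congr rfl fun a _ => ?_
    have h2 : hessMat stdDir (torusPot g φ) (logNormSq w) a b =
        dirDeriv (stdDir b) (dirDeriv (stdDir a) (torusPot g φ)) (logNormSq w) := by
      rw [hessMat_symm _ hf]; rfl
    rw [h2]
    have := hw a
    field_simp
  set c := Θ (P.orbit 1) - momentTheta stdDir θ (torusPot g φ) (logNormSq 1) with hc_def
  have hc : ∀ w : Fin n → ℂ, (∀ j, w j ≠ 0) →
      Θ (P.orbit w) = momentTheta stdDir θ (torusPot g φ) (logNormSq w) + c := by
    intro w hw
    have := eq_of_dzbar_eq_zero (k := fun y => Θ (P.orbit y) -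
      momentTheta stdDir θ (torusPot g φ) (logNormSq y)) (fun w hw => (hd1 w hw).sub (hd2 w hw))
      hdb hw hone
    linarith
  -- The moment part integrates to zero, so the normalization reads c ∫ e^{-f} = 0 up to a positive
  -- factor. The free constant c' of the Ricci potential only enters that factor.
  have hint := hΘ.2.2
  rw [integralM_eq hφ (k := fun ξ => (momentTheta stdDir θ (torusPot g φ) ξ + c) *
    Real.exp (ricciPot stdDir (torusPot g φ) ξ + c')) (fun w hw => by rw [hc w hw, hc' w hw])] at hint
  have h3 : ∀ ξ, (momentTheta stdDir θ (torusPot g φ) ξ + c) *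
      Real.exp (ricciPot stdDir (torusPot g φ) ξ + c') * (hessMat stdDir (torusPot g φ) ξ).det =
      Real.exp c' * (momentTheta stdDir θ (torusPot g φ) ξ * Real.exp (-torusPot g φ ξ) +
        c * Real.exp (-torusPot g φ ξ)) := by
    intro ξ
    rw [Real.exp_add, ← exp_ricciPot_mul_det hφ]; ring
  simp only [h3] at hint
  rw [integral_const_mul, integral_add (integrable_momentTheta_mul_exp_neg hφ θ)
    ((integrable_exp_neg hφ).const_mul c), integral_momentTheta_mul_exp_neg hφ, zero_add,
    integral_const_mul] at hint
  have hpos : 0 < ∫ ξ, Real.exp (-torusPot g φ ξ) := integral_exp_pos (integrable_exp_neg hφ)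
  have hc0 : c = 0 := by
    have h4 := Complex.ofReal_eq_zero.1 hint
    have h5 : (2 * Real.pi) ^ n ≠ 0 := by positivity
    simpa [h5, Real.exp_ne_zero, hpos.ne'] using h4
  rw [hc w hw, hc0, add_zero]

end

/-- Only interior times qualify: the path is constrained on [0, 1] alone, and its values outside
could spoil a two-sided derivative at the endpoints. -/
theorem IsPotentialPath.differentiableAt {g : P.KahlerMetric} {φ : P.Manifold → ℝ}
    {path : ℝ → P.Manifold → ℝ} (hpath : IsPotentialPath g φ path) {t : ℝ}
    (ht : t ∈ Set.Ioo (0 : ℝ) 1) {w : Fin n → ℂ} (hw : ∀ j, w j ≠ 0) :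
    DifferentiableAt ℝ (fun s => path s (P.orbit w)) t := by
  let v := P.nonempty_vertex.some
  have hn : Set.Icc (0 : ℝ) 1 ×ˢ (Set.univ : Set (P.Active v → ℂ)) ∈
      nhds (t, P.monomial v w) := prod_mem_nhds (Icc_mem_nhds ht.1 ht.2) Filter.univ_mem
  have h1 := ((hpath.1 v).contDiffAt hn).differentiableAt (by simp)
  have h2 : DifferentiableAt ℝ (fun s : ℝ => (s, P.monomial v w)) t :=
    differentiableAt_id.prodMk (differentiableAt_const _)
  rw [P.orbit_eq_chart v hw]
  exact DifferentiableAt.comp (f := fun s : ℝ => (s, P.monomial v w)) t h1 h2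

/-- The variation of the K-energy in logarithmic coordinates. -/
theorem integralM_variation {g : P.KahlerMetric} {θ : Fin n → ℝ} {φ : P.Manifold → ℝ}
    {path h Θ : ℝ → P.Manifold → ℝ} (hpath : IsPotentialPath g φ path) {t : ℝ}
    (ht : t ∈ Set.Ioo (0 : ℝ) 1) (hh : IsRicciPotential g (path t) (h t))
    (hΘ : IsFieldPotential g θ (path t) (h t) (Θ t)) :
    (integralM g (path t) fun w => (deriv (fun s => path s (P.orbit w)) t : ℂ) *
      (scalarCurvature (orbitMetric g (path t)) w - n
        - traceNabla (orbitMetric g (path t)) (toricField θ) w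
        + applyField (toricField θ)
            (fun w => ((h t (P.orbit w) - Θ t (P.orbit w) : ℝ) : ℂ)) w) *
      (Real.exp (Θ t (P.orbit w)) : ℂ)) = (((2 * Real.pi) ^ n *
      ∫ ξ, deriv (fun s => torusPot g (path s) ξ) t *
        weightedLaplacian stdDir θ (torusPot g (path t)) (fun ξ =>
          ricciPot stdDir (torusPot g (path t)) ξ - momentTheta stdDir θ (torusPot g (path t)) ξ) ξ *
        rho stdDir θ (torusPot g (path t)) ξ : ℝ) : ℂ) := by
  have ht' : t ∈ Set.Icc (0 : ℝ) 1 := ⟨ht.1.le, ht.2.le⟩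
  have hφ := hpath.2.1 t ht'
  have hf := torusPot_smooth g hφ
  have hg := isLogMetric_orbitMetric hφ
  obtain ⟨c', hc'⟩ := hh.exists_eq hφ
  set f := torusPot g (path t) with hf_def
  have hχ : Smooth fun ξ => ricciPot stdDir f ξ - momentTheta stdDir θ f ξ :=
    (ricciPot_torusPot_smooth hφ).sub (momentTheta_smooth hf)
  rw [integralM_eq hφ (k := fun ξ => deriv (fun s => torusPot g (path s) ξ) t *
    weightedLaplacian stdDir θ f (fun ξ => ricciPot stdDir f ξ - momentTheta stdDir θ f ξ) ξ *
    Real.exp (momentTheta stdDir θ f ξ))]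
  · congr 2
    refine integral_congr_ae (Filter.Eventually.of_forall fun ξ => ?_)
    dsimp only
    rw [rho, Real.exp_add, logDet, Real.exp_log (det_torusPot_pos hφ ξ)]
    ring
  intro w hw
  -- The potentials on the torus are evaluated at positive points, and invariance of every `path s`
  -- near t moves the derivative there.
  have e1 : deriv (fun s => (path s (P.orbit w) : ℂ)) t =
      (deriv (fun s => torusPot g (path s) (logNormSq w)) t : ℝ) := by
    rw [(hpath.differentiableAt ht hw).hasDerivAt.ofReal_comp.deriv]
    congr 1
    have h1 : (fun s => torusPot g (path s) (logNormSq w)) =ᶠ[nhds t]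
        fun s => g.pot (P.orbit (expPoint (logNormSq w))) + path s (P.orbit w) := by
      filter_upwards [Ioo_mem_nhds ht.1 ht.2] with s hs
      rw [torusPot_eq, P.apply_orbit_eq (F := path s)
        (fun v s' y _ => (hpath.2.1 s ⟨hs.1.le, hs.2.le⟩).2.1 v s' y) hw]
    rw [h1.deriv_eq, deriv_const_add]
  have e2 : applyField (toricField θ) (fun w => ((h t (P.orbit w) - Θ t (P.orbit w) : ℝ) : ℂ)) w =
      ((∑ a, θ a * dirDeriv (stdDir a) (fun ξ => ricciPot stdDir f ξ - momentTheta stdDir θ f ξ)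
        (logNormSq w) : ℝ) : ℂ) := by
    -- The undetermined constant of the Ricci potential survives here and is killed by the
    -- derivative along X.
    have h2 : (fun w => ((h t (P.orbit w) - Θ t (P.orbit w) : ℝ) : ℂ)) =ᶠ[nhds w] fun w =>
        ((fun ξ => ricciPot stdDir f ξ - momentTheta stdDir θ f ξ + c') (logNormSq w) : ℂ) := by
      filter_upwards [eventually_nonvanishing hw] with y hy
      rw [hc' y hy, hΘ.eq hφ hh hy]
      push_cast; ring
    simp only [applyField, dz_congr h2]
    push_cast
    refine Finset.sum_congr rfl fun a _ => ?_
    have h3 := dz_comp_logNormSq hw (hχ.add contDiff_const : Smooth fun ξ =>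
      ricciPot stdDir f ξ - momentTheta stdDir θ f ξ + c') a
    push_cast at h3 ⊢
    rw [h3, dirDeriv_add hχ contDiff_const, dirDeriv_const, add_zero, toricField]
    have := hw a
    field_simp
  have e3 := hg.bracket hf (det_torusPot_pos hφ) hw θ
  rw [Fintype.card_fin] at e3
  rw [e1, e2, hΘ.eq hφ hh hw]
  change _ * (_ - _ - traceNabla _ (fun w j => (θ j : ℂ) * w j) w + _) * _ = _
  rw [e3]
  push_cast
  rfl

end FanoPolytope

/-! ## The modified K-energy in logarithmic coordinates -/

namespace FanoPolytope

open ToricKahler SmoothCalculus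

variable {n d : ℕ} {P : FanoPolytope n d}

theorem sin_sq_mem_Icc (s : ℝ) : Real.sin s ^ 2 ∈ Set.Icc (0 : ℝ) 1 :=
  ⟨sq_nonneg _, Real.sin_sq_le_one s⟩

/-- Since sin² maps ℝ into [0, 1], the reparametrized path is smooth for all real times, as the
conservation law requires. -/
theorem IsPotentialPath.smoothFamily {g : P.KahlerMetric} {φ : P.Manifold → ℝ}
    {path : ℝ → P.Manifold → ℝ} (hpath : IsPotentialPath g φ path) :
    IsSmoothFamily g fun s => path (Real.sin s ^ 2) := by
  refine ⟨fun v => ?_, fun s => hpath.2.1 _ (sin_sq_mem_Icc s)⟩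
  have h1 : ContDiff ℝ (⊤ : ℕ∞) fun q : ℝ × (P.Active v → ℂ) => (Real.sin q.1 ^ 2, q.2) :=
    ((Real.contDiff_sin.comp contDiff_fst).pow 2).prodMk contDiff_snd
  exact (hpath.1 v).comp_contDiff h1 fun q => ⟨sin_sq_mem_Icc q.1, Set.mem_univ _⟩

theorem image_sin_sq : (fun s => Real.sin s ^ 2) '' Set.Ioo 0 (Real.pi / 2) = Set.Ioo (0 : ℝ) 1 := by
  ext t
  constructor
  · rintro ⟨s, hs, rfl⟩
    have h1 := Real.sin_pos_of_pos_of_lt_pi hs.1 (by linarith [hs.2, Real.pi_pos])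
    have h2 := Real.cos_pos_of_mem_Ioo ⟨by linarith [hs.1, Real.pi_pos], hs.2⟩
    refine ⟨by positivity, ?_⟩
    have := Real.sin_sq_add_cos_sq s
    simp only
    nlinarith
  · intro ht
    have h0 : 0 < √t := Real.sqrt_pos.2 ht.1
    have h1 : √t < 1 := (Real.sqrt_lt_sqrt ht.1.le ht.2).trans_eq Real.sqrt_one
    refine ⟨Real.arcsin √t, ⟨Real.arcsin_pos.2 h0, Real.arcsin_lt_pi_div_two.2 h1⟩, ?_⟩
    simp only
    rw [Real.sin_arcsin (by linarith) h1.le, Real.sq_sqrt ht.1.le]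

theorem hasDerivAt_sin_sq (s : ℝ) :
    HasDerivAt (fun s => Real.sin s ^ 2) (2 * Real.sin s * Real.cos s) s := by
  have h := (Real.hasDerivAt_sin s).fun_pow 2
  simpa using h

theorem integral_comp_sin_sq (I : ℝ → ℝ) :
    ∫ t in Set.Ioo (0 : ℝ) 1, I t =
      ∫ s in Set.Ioo 0 (Real.pi / 2), 2 * Real.sin s * Real.cos s * I (Real.sin s ^ 2) := by
  have hpos : ∀ s ∈ Set.Ioo 0 (Real.pi / 2), 0 < Real.sin s ∧ 0 < Real.cos s := fun s hs =>
    ⟨Real.sin_pos_of_pos_of_lt_pi hs.1 (by linarith [hs.2, Real.pi_pos]),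
      Real.cos_pos_of_mem_Ioo ⟨by linarith [hs.1, Real.pi_pos], hs.2⟩⟩
  have hder : ∀ s ∈ Set.Ioo 0 (Real.pi / 2), HasDerivWithinAt (fun s => Real.sin s ^ 2)
      (2 * Real.sin s * Real.cos s) (Set.Ioo 0 (Real.pi / 2)) s := fun s _ =>
    (hasDerivAt_sin_sq s).hasDerivWithinAt
  have hinj : Set.InjOn (fun s => Real.sin s ^ 2) (Set.Ioo 0 (Real.pi / 2)) := by
    intro s hs s' hs' h
    have h1 : Real.sin s = Real.sin s' :=
      (pow_left_inj₀ (hpos s hs).1.le (hpos s' hs').1.le two_ne_zero).1 h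
    exact Real.injOn_sin ⟨by linarith [hs.1, Real.pi_pos], hs.2.le⟩
      ⟨by linarith [hs'.1, Real.pi_pos], hs'.2.le⟩ h1
  have h := integral_image_eq_integral_abs_deriv_smul measurableSet_Ioo hder hinj I
  rw [image_sin_sq] at h
  rw [h]
  refine setIntegral_congr_fun measurableSet_Ioo fun s hs => ?_
  have := hpos s hs
  simp only [smul_eq_mul]
  rw [abs_of_pos (mul_pos (mul_pos two_pos this.1) this.2)]

/-- The variation of the functional in logarithmic coordinates. -/
def logVariation (g : P.KahlerMetric) (θ : Fin n → ℝ) (ψ : (Fin n → ℝ) → ℝ)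
    (φ : P.Manifold → ℝ) : ℝ :=
  ∫ ξ, ψ ξ * weightedLaplacian stdDir θ (torusPot g φ) (fun ξ => ricciPot stdDir (torusPot g φ) ξ -
    momentTheta stdDir θ (torusPot g φ) ξ) ξ * rho stdDir θ (torusPot g φ) ξ

/-- The K-energy integrates minus the variation of the entropy functional up to a constant factor,
so only the endpoints of the path matter. -/
theorem modifiedKEnergy_eq {g : P.KahlerMetric} {θ : Fin n → ℝ} {φ : P.Manifold → ℝ}
    {path h Θ : ℝ → P.Manifold → ℝ} (hpath : IsPotentialPath g φ path)
    (hh : ∀ t ∈ Set.Icc (0 : ℝ) 1, IsRicciPotential g (path t) (h t))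
    (hΘ : ∀ t ∈ Set.Icc (0 : ℝ) 1, IsFieldPotential g θ (path t) (h t) (Θ t)) :
    modifiedKEnergy g θ path h Θ = (((2 * Real.pi) ^ n / FanoPolytope.vol g *
      (entropyIntegral θ (torusPot g φ) - entropyIntegral θ (torusPot g 0)) : ℝ) : ℂ) := by
  have hpi : 0 ≤ Real.pi / 2 := by positivity
  set I : ℝ → ℝ := fun t => logVariation g θ (fun ξ => deriv (fun s => torusPot g (path s) ξ) t)
    (path t) with hI
  have h1 := entropyIntegral_sub hpath.smoothFamily θ hpi
  simp only [Real.sin_pi_div_two, one_pow, Real.sin_zero, hpath.2.2.2] at h1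
  rw [zero_pow two_ne_zero, hpath.2.2.1] at h1
  have h2 : ∀ s ∈ Set.Ioo 0 (Real.pi / 2), logVariation g θ
      (fun ξ => deriv (fun s => torusPot g (path (Real.sin s ^ 2)) ξ) s) (path (Real.sin s ^ 2)) =
      2 * Real.sin s * Real.cos s * I (Real.sin s ^ 2) := by
    intro s hs
    have ht : Real.sin s ^ 2 ∈ Set.Ioo (0 : ℝ) 1 := by
      rw [← image_sin_sq]; exact ⟨s, hs, rfl⟩
    have h3 : ∀ ξ, deriv (fun s => torusPot g (path (Real.sin s ^ 2)) ξ) s =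
        2 * Real.sin s * Real.cos s *
          deriv (fun s => torusPot g (path s) ξ) (Real.sin s ^ 2) := by
      intro ξ
      have h4 : DifferentiableAt ℝ (fun s => torusPot g (path s) ξ) (Real.sin s ^ 2) :=
        (hpath.differentiableAt ht (expPoint_ne_zero ξ)).const_add _
      have h6 : HasDerivAt (fun s => torusPot g (path (Real.sin s ^ 2)) ξ) _ s :=
        HasDerivAt.comp (h₂ := fun s => torusPot g (path s) ξ) s h4.hasDerivAt
          (hasDerivAt_sin_sq s)
      rw [h6.deriv, mul_comm]
    rw [hI]
    simp only [logVariation]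
    rw [← integral_const_mul]
    congr 1
    funext ξ
    rw [h3]; ring
  have h3 : (∫ s in (0 : ℝ)..(Real.pi / 2), logVariation g θ
      (fun ξ => deriv (fun s => torusPot g (path (Real.sin s ^ 2)) ξ) s) (path (Real.sin s ^ 2))) =
      ∫ t in Set.Ioo (0 : ℝ) 1, I t := by
    rw [intervalIntegral.integral_of_le hpi, integral_Ioc_eq_integral_Ioo,
      setIntegral_congr_fun measurableSet_Ioo h2, integral_comp_sin_sq]
  have h4 := h1.trans (congrArg Neg.neg h3)
  -- Pass to the open interval: the endpoints, where the time derivative is not controlled, form a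
  -- null set.
  rw [h4, modifiedKEnergy, intervalIntegral.integral_of_le zero_le_one,
    integral_Ioc_eq_integral_Ioo]
  have h5 : ∀ t ∈ Set.Ioo (0 : ℝ) 1, _ = _ := fun t ht =>
    integralM_variation (θ := θ) hpath ht (hh t ⟨ht.1.le, ht.2.le⟩) (hΘ t ⟨ht.1.le, ht.2.le⟩)
  rw [setIntegral_congr_fun measurableSet_Ioo h5]
  have h6 : (∫ t in Set.Ioo (0 : ℝ) 1, (((2 * Real.pi) ^ n * I t : ℝ) : ℂ)) =
      (((2 * Real.pi) ^ n * ∫ t in Set.Ioo (0 : ℝ) 1, I t : ℝ) : ℂ) := by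
    rw [integral_complex_ofReal, integral_const_mul]
  refine (congrArg (fun z => -(1 / (FanoPolytope.vol g : ℂ)) * z) h6).trans ?_
  push_cast
  ring

end FanoPolytope

/-! ## Decomposition of the polytope into cones over its facets -/

namespace FanoPolytope

open Set Filter
open scoped Pointwise

variable {n d : ℕ} (P : FanoPolytope n d)

/-- The outer normal of a facet as a vector. -/
def normalVec (i : Fin d) : EuclideanSpace ℝ (Fin n) := WithLp.toLp 2 fun j => (P.normal i j : ℝ)

theorem inner_normalVec (i : Fin d) (x : EuclideanSpace ℝ (Fin n)) :
    inner ℝ (P.normalVec i) x = ∑ j, x j * (P.normal i j : ℝ) := by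
  simp [normalVec, PiLp.inner_apply]

theorem mem_body_iff {x : EuclideanSpace ℝ (Fin n)} :
    x ∈ P.body ↔ ∀ i, inner ℝ (P.normalVec i) x ≤ 1 := by
  simp only [inner_normalVec]; rfl

theorem mem_face_iff {i : Fin d} {x : EuclideanSpace ℝ (Fin n)} :
    x ∈ P.face i ↔ x ∈ P.body ∧ inner ℝ (P.normalVec i) x = 1 := by
  rw [inner_normalVec]; rfl

theorem normalVec_ne_zero (i : Fin d) : P.normalVec i ≠ 0 := by
  intro h
  obtain ⟨x, hx, -⟩ := P.facet i
  rw [← inner_normalVec, h, inner_zero_left] at hx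
  exact zero_ne_one hx

theorem normalVec_injective : Function.Injective P.normalVec := by
  intro i k hik
  by_contra hne
  obtain ⟨x, hx, hk⟩ := P.facet i
  have h1 := hk k (Ne.symm hne)
  rw [← inner_normalVec] at hx h1
  rw [← hik, hx] at h1
  exact lt_irrefl _ h1

include P in
theorem dim_pos_of_facet (i : Fin d) : 0 < n := by
  rcases Nat.eq_zero_or_pos n with h | h
  · subst h
    exact absurd (Subsingleton.elim _ _) (P.normalVec_ne_zero i)
  · exact h

theorem measurableSet_body : MeasurableSet P.body := P.isClosed_body.measurableSet

theorem isClosed_face (i : Fin d) : IsClosed (P.face i) := by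
  have : P.face i = P.body ∩ {x | inner ℝ (P.normalVec i) x = 1} := by
    ext x; exact P.mem_face_iff
  rw [this]
  exact P.isClosed_body.inter (isClosed_eq (by fun_prop) continuous_const)

/-- The cone over a facet. -/
def sector (i : Fin d) : Set (EuclideanSpace ℝ (Fin n)) :=
  {x | 0 < inner ℝ (P.normalVec i) x ∧ inner ℝ (P.normalVec i) x ≤ 1 ∧
    ∀ k, inner ℝ (P.normalVec k) x ≤ inner ℝ (P.normalVec i) x}

theorem measurableSet_sector (i : Fin d) : MeasurableSet (P.sector i) := by
  have : P.sector i = {x | 0 < inner ℝ (P.normalVec i) x} ∩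
      ({x | inner ℝ (P.normalVec i) x ≤ 1} ∩
        ⋂ k, {x | inner ℝ (P.normalVec k) x ≤ inner ℝ (P.normalVec i) x}) := by
    ext x; simp [sector]
  rw [this]
  refine (measurableSet_lt (by fun_prop) (by fun_prop)).inter
    ((measurableSet_le (by fun_prop) (by fun_prop)).inter
      (MeasurableSet.iInter fun k => measurableSet_le (by fun_prop) (by fun_prop)))

theorem sector_subset_body (i : Fin d) : P.sector i ⊆ P.body := fun _ hx =>
  P.mem_body_iff.2 fun k => (hx.2.2 k).trans hx.2.1

theorem smul_mem_sector_iff {i : Fin d} {s : ℝ} (hs : s ∈ Ioc (0 : ℝ) 1)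
    {y : EuclideanSpace ℝ (Fin n)} (hy : inner ℝ (P.normalVec i) y = 1) :
    s • y ∈ P.sector i ↔ y ∈ P.face i := by
  rw [mem_face_iff, mem_body_iff]
  simp only [sector, mem_ofPred_eq, inner_smul_right, hy, mul_one]
  constructor
  · rintro ⟨-, -, h⟩
    exact ⟨fun k => by nlinarith [h k, hs.1], trivial⟩
  · rintro ⟨h, -⟩
    exact ⟨hs.1, hs.2, fun k => by nlinarith [h k, hs.1]⟩

/-- The Lebesgue measure of a facet. -/
def faceMeasure (i : Fin d) : Measure (EuclideanSpace ℝ (Fin n)) := μHE[n - 1].restrict (P.face i)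

/-- Cavalieri's principle for the level sets of ⟨ℓ, ·⟩: consecutive levels are at distance ds/|ℓ|.
-/
theorem volume_eq_lintegral_slice {ℓ : EuclideanSpace ℝ (Fin n)} (hℓ : ℓ ≠ 0)
    {t : Set (EuclideanSpace ℝ (Fin n))} (ht : MeasurableSet t) :
    volume t = ENNReal.ofReal ‖ℓ‖⁻¹ * ∫⁻ s : ℝ, μHE[n - 1] (t ∩ {x | inner ℝ ℓ x = s}) := by
  have hnorm : ‖ℓ‖ ≠ 0 := norm_ne_zero_iff.2 hℓ
  -- The step ℓ/|ℓ|² raises the level of ⟨ℓ, ·⟩ by exactly one, so slicing along it is indexed by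
  -- the level.
  have hv : (‖ℓ‖ ^ 2)⁻¹ • ℓ ≠ 0 := smul_ne_zero (inv_ne_zero (pow_ne_zero 2 hnorm)) hℓ
  have h := EuclideanGeometry.euclideanHausdorffMeasure_eq_lintegral
    (0 : EuclideanSpace ℝ (Fin n)) hv ht
  rw [finrank_euclideanSpace_fin, EuclideanSpace.euclideanHausdorffMeasure_eq_volume] at h
  rw [h]
  congr 1
  · rw [← ofReal_norm, norm_smul, norm_inv, norm_pow, norm_norm]
    congr 1
    field_simp
  · congr 1
    funext s
    congr 2
    ext x
    simp only [SetLike.mem_coe, AffineSubspace.mem_mk', mem_ofPred_eq, vadd_eq_add, add_zero,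
      vsub_eq_sub, Submodule.mem_orthogonal_singleton_iff_inner_right, inner_smul_left, inner_sub_right,
      inner_smul_right, real_inner_self_eq_norm_sq]
    have h2 : ‖ℓ‖ ^ 2 ≠ 0 := pow_ne_zero 2 hnorm
    simp only [map_inv₀, map_pow, conj_trivial]
    rw [inv_mul_cancel₀ h2, mul_one, sub_eq_zero, mul_comm s, mul_right_inj' (inv_ne_zero h2)]

/-- The slice of the cone at height s is the facet scaled by s, and scaling multiplies its
(n-1)-dimensional measure by s^{n-1}. -/
theorem volume_inter_sector (i : Fin d) {t : Set (EuclideanSpace ℝ (Fin n))} (ht : MeasurableSet t) :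
    volume (t ∩ P.sector i) = ENNReal.ofReal ‖P.normalVec i‖⁻¹ *
      ∫⁻ s in Ioc (0 : ℝ) 1, ENNReal.ofReal (s ^ (n - 1)) * P.faceMeasure i ((fun y => s • y) ⁻¹' t) := by
  rw [volume_eq_lintegral_slice (P.normalVec_ne_zero i) (ht.inter (P.measurableSet_sector i)),
    ← lintegral_indicator measurableSet_Ioc]
  congr 1
  congr 1
  funext s
  by_cases hs : s ∈ Ioc (0 : ℝ) 1
  · have hmeas : MeasurableSet ((fun y : EuclideanSpace ℝ (Fin n) => s • y) ⁻¹' t) :=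
      ht.preimage (measurable_const_smul s)
    rw [indicator_of_mem hs, faceMeasure, Measure.restrict_apply hmeas]
    have hset : t ∩ P.sector i ∩ {x | inner ℝ (P.normalVec i) x = s} =
        s • (((fun y : EuclideanSpace ℝ (Fin n) => s • y) ⁻¹' t) ∩ P.face i) := by
      ext x
      rw [Set.mem_smul_set_iff_inv_smul_mem₀ hs.1.ne']
      have hx : s • s⁻¹ • x = x := smul_inv_smul₀ hs.1.ne' x
      constructor
      · rintro ⟨⟨h1, h2⟩, h3⟩
        have h4 : inner ℝ (P.normalVec i) (s⁻¹ • x) = 1 := by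
          rw [inner_smul_right, show inner ℝ (P.normalVec i) x = s from h3,
            inv_mul_cancel₀ hs.1.ne']
        refine ⟨by rwa [mem_preimage, hx], ?_⟩
        rwa [← P.smul_mem_sector_iff hs h4, hx]
      · rintro ⟨h1, h2⟩
        have h4 := (P.mem_face_iff.1 h2).2
        rw [mem_preimage, hx] at h1
        refine ⟨⟨h1, ?_⟩, ?_⟩
        · rwa [← P.smul_mem_sector_iff hs h4, hx] at h2
        · rw [inner_smul_right, inv_mul_eq_div, div_eq_one_iff_eq hs.1.ne'] at h4
          exact h4
    rw [hset, Measure.euclideanHausdorffMeasure_smul₀ _ hs.1.ne', ENNReal.smul_def, smul_eq_mul]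
    congr 1
    rw [ENNReal.coe_pow, ← enorm_eq_nnnorm, ← ofReal_norm, Real.norm_of_nonneg hs.1.le,
      ENNReal.ofReal_pow hs.1.le]
  · rw [indicator_of_notMem hs]
    have : t ∩ P.sector i ∩ {x | inner ℝ (P.normalVec i) x = s} = ∅ := by
      rw [Set.eq_empty_iff_forall_notMem]
      rintro x ⟨⟨-, h1, h2, -⟩, h3⟩
      rw [show inner ℝ (P.normalVec i) x = s from h3] at h1 h2
      exact hs ⟨h1, h2⟩
    rw [this, measure_empty]

/-- The radial part of the Lebesgue measure. -/
def radialMeasure (n : ℕ) : Measure ℝ :=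
  (volume.restrict (Ioc (0 : ℝ) 1)).withDensity fun s => ENNReal.ofReal (s ^ (n - 1))

theorem lintegral_radialMeasure {F : ℝ → ENNReal} (hF : Measurable F) :
    ∫⁻ s, F s ∂radialMeasure n = ∫⁻ s in Ioc (0 : ℝ) 1, ENNReal.ofReal (s ^ (n - 1)) * F s :=
  lintegral_withDensity_eq_lintegral_mul _ (by fun_prop) hF

theorem radialMeasure_univ : radialMeasure n univ = ENNReal.ofReal (((n - 1 : ℕ) + 1 : ℝ)⁻¹) := by
  rw [radialMeasure, withDensity_apply _ MeasurableSet.univ, Measure.restrict_univ,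
    ← ofReal_integral_eq_lintegral_ofReal]
  · rw [← intervalIntegral.integral_of_le zero_le_one, integral_pow]
    simp
  · exact (continuous_pow (n - 1)).integrableOn_Ioc
  · exact (ae_restrict_iff' measurableSet_Ioc).2 (Eventually.of_forall fun s hs => pow_nonneg hs.1.le _)

instance : IsFiniteMeasure (radialMeasure n) := ⟨by
  rw [radialMeasure_univ]; exact ENNReal.ofReal_lt_top⟩

/-- The cone over the facet lies in the bounded body, and its volume is a positive multiple of the
measure of the facet. -/
instance isFiniteMeasure_faceMeasure (i : Fin d) : IsFiniteMeasure (P.faceMeasure i) := ⟨by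
  have h := P.volume_inter_sector i MeasurableSet.univ
  simp only [univ_inter, preimage_univ] at h
  rw [← lintegral_radialMeasure measurable_const, lintegral_const, radialMeasure_univ] at h
  have hfin : volume (P.sector i) < ⊤ :=
    (measure_mono (P.sector_subset_body i)).trans_lt P.isCompact_body.measure_lt_top
  have h1 : ENNReal.ofReal ‖P.normalVec i‖⁻¹ ≠ 0 := by
    simpa using P.normalVec_ne_zero i
  have h2 : ENNReal.ofReal (((n - 1 : ℕ) + 1 : ℝ)⁻¹) ≠ 0 := by
    have : (0 : ℝ) < ((n - 1 : ℕ) + 1 : ℝ)⁻¹ := by positivity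
    simpa using this
  by_contra htop
  rw [not_lt, top_le_iff] at htop
  rw [htop, ENNReal.top_mul h2, ENNReal.mul_top h1] at h
  exact hfin.ne h⟩

theorem restrict_sector (i : Fin d) :
    volume.restrict (P.sector i) = ENNReal.ofReal ‖P.normalVec i‖⁻¹ •
      ((radialMeasure n).prod (P.faceMeasure i)).map fun p => p.1 • p.2 := by
  have hm : Measurable fun p : ℝ × EuclideanSpace ℝ (Fin n) => p.1 • p.2 :=
    measurable_fst.smul measurable_snd
  refine Measure.ext fun t ht => ?_
  have hmt := hm ht
  rw [Measure.restrict_apply ht, P.volume_inter_sector i ht, Measure.smul_apply, smul_eq_mul,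
    Measure.map_apply hm ht, Measure.prod_apply hmt,
    lintegral_radialMeasure (measurable_measure_prodMk_left hmt)]
  rfl

/-- Otherwise the whole ray through x would lie in P, which is bounded. -/
theorem exists_inner_pos {x : EuclideanSpace ℝ (Fin n)} (hx : x ≠ 0) :
    ∃ i, 0 < inner ℝ (P.normalVec i) x := by
  by_contra hcon
  push Not at hcon
  obtain ⟨R, hR⟩ := P.isCompact_body.isBounded.exists_norm_le
  have h0 : 0 < ‖x‖ := norm_pos_iff.2 hx
  have hR' : 0 ≤ R := by
    have := hR 0 (P.mem_body_iff.2 fun i => by simp)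
    simpa using this
  have h1 : ((R + 1) / ‖x‖) • x ∈ P.body := P.mem_body_iff.2 fun i => by
    rw [inner_smul_right]
    have : 0 ≤ (R + 1) / ‖x‖ := by positivity
    nlinarith [hcon i]
  have h2 := hR _ h1
  rw [norm_smul, Real.norm_of_nonneg (by positivity), div_mul_cancel₀ _ h0.ne'] at h2
  linarith

theorem volume_inner_eq_zero {v : EuclideanSpace ℝ (Fin n)} (hv : v ≠ 0) :
    volume {x : EuclideanSpace ℝ (Fin n) | inner ℝ v x = 0} = 0 := by
  have h : {x : EuclideanSpace ℝ (Fin n) | inner ℝ v x = 0} =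
      ((ℝ ∙ v)ᗮ : Submodule ℝ (EuclideanSpace ℝ (Fin n))) := by
    ext x; simp [Submodule.mem_orthogonal_singleton_iff_inner_right]
  rw [h]
  refine Measure.addHaar_submodule _ _ fun htop => hv ?_
  have : v ∈ (ℝ ∙ v)ᗮ := htop ▸ Submodule.mem_top
  rw [Submodule.mem_orthogonal_singleton_iff_inner_right] at this
  exact inner_self_eq_zero.1 this

/-- Two cones meet inside the hyperplane where their normals agree; it is a proper hyperplane
because distinct facets have distinct normals. -/
theorem aedisjoint_sector : Pairwise (Function.onFun (AEDisjoint volume) P.sector) := by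
  intro i k hik
  refine measure_mono_null ?_ (volume_inner_eq_zero (v := P.normalVec i - P.normalVec k)
    (sub_ne_zero.2 fun h => hik (P.normalVec_injective h)))
  rintro x ⟨h1, h2⟩
  rw [mem_ofPred_eq, inner_sub_left]
  have := h1.2.2 k
  have := h2.2.2 i
  linarith

/-- A nonzero point lies in the cone over a facet whose normal is largest on it. Only the origin is
missed. -/
theorem body_ae_eq_iUnion_sector (hn : 0 < n) : P.body =ᵐ[volume] ⋃ i, P.sector i := by
  have : Nontrivial (EuclideanSpace ℝ (Fin n)) := by
    have : Nonempty (Fin n) := ⟨⟨0, hn⟩⟩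
    infer_instance
  refine (ae_eq_set.2 ⟨measure_mono_null (t := {0}) ?_ (measure_singleton _), ?_⟩)
  · rintro x ⟨hx, hx'⟩
    by_contra h0
    obtain ⟨i, hi⟩ := P.exists_inner_pos h0
    have : Nonempty (Fin d) := ⟨i⟩
    obtain ⟨k, hk⟩ := Finite.exists_max fun i => inner ℝ (P.normalVec i) x
    exact hx' (mem_iUnion.2 ⟨k, hi.trans_le (hk i), P.mem_body_iff.1 hx k, hk⟩)
  · rw [sdiff_eq_empty.2 (iUnion_subset P.sector_subset_body), measure_empty]

/-! ### Integration over the polytope along rays from the origin. -/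

variable {H : EuclideanSpace ℝ (Fin n) → ℝ}

theorem integrable_prod_of_integrableOn_body (i : Fin d) (hH : IntegrableOn H P.body) :
    Integrable (fun p : ℝ × EuclideanSpace ℝ (Fin n) => H (p.1 • p.2))
      ((radialMeasure n).prod (P.faceMeasure i)) := by
  have h1 : Integrable H (volume.restrict (P.sector i)) := hH.mono_set (P.sector_subset_body i)
  have hc : ENNReal.ofReal ‖P.normalVec i‖⁻¹ ≠ 0 := by simpa using P.normalVec_ne_zero i
  rw [P.restrict_sector, integrable_smul_measure hc ENNReal.ofReal_ne_top] at h1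
  have hm : Measurable fun p : ℝ × EuclideanSpace ℝ (Fin n) => p.1 • p.2 :=
    measurable_fst.smul measurable_snd
  exact h1.comp_measurable hm

theorem integral_radialMeasure (F : ℝ → ℝ) :
    ∫ s, F s ∂radialMeasure n = ∫ s in Ioc (0 : ℝ) 1, s ^ (n - 1) * F s := by
  rw [radialMeasure, integral_withDensity_eq_integral_toReal_smul (by fun_prop)
    (Eventually.of_forall fun _ => ENNReal.ofReal_lt_top)]
  refine setIntegral_congr_fun measurableSet_Ioc fun s hs => ?_
  simp only [smul_eq_mul]
  rw [ENNReal.toReal_ofReal (pow_nonneg hs.1.le _)]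

theorem integrable_radialMeasure_iff {F : ℝ → ℝ} : Integrable F (radialMeasure n) ↔
    IntegrableOn (fun s => s ^ (n - 1) * F s) (Ioc (0 : ℝ) 1) := by
  rw [radialMeasure, integrable_withDensity_iff_integrable_smul' (by fun_prop)
    (Eventually.of_forall fun _ => ENNReal.ofReal_lt_top)]
  refine integrable_congr ((ae_restrict_iff' measurableSet_Ioc).2
    (Eventually.of_forall fun s hs => ?_))
  simp only [smul_eq_mul]
  rw [ENNReal.toReal_ofReal (pow_nonneg hs.1.le _)]

theorem setIntegral_body (hn : 0 < n) (hH : IntegrableOn H P.body) :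
    ∫ x in P.body, H x = ∑ i, ‖P.normalVec i‖⁻¹ * ∫ y in P.face i,
      (∫ s in Ioc (0 : ℝ) 1, s ^ (n - 1) * H (s • y)) ∂μHE[n - 1] := by
  rw [setIntegral_congr_set (P.body_ae_eq_iUnion_sector hn),
    integral_iUnion_ae (fun i => (P.measurableSet_sector i).nullMeasurableSet) P.aedisjoint_sector
      (hH.mono_set (iUnion_subset P.sector_subset_body)), tsum_fintype]
  refine Finset.sum_congr rfl fun i _ => ?_
  have hint := P.integrable_prod_of_integrableOn_body i hH
  have hm : Measurable fun p : ℝ × EuclideanSpace ℝ (Fin n) => p.1 • p.2 :=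
    measurable_fst.smul measurable_snd
  have hae : AEStronglyMeasurable H (((radialMeasure n).prod (P.faceMeasure i)).map
      fun p => p.1 • p.2) := by
    have h1 : AEStronglyMeasurable H (volume.restrict (P.sector i)) :=
      (hH.mono_set (P.sector_subset_body i)).aestronglyMeasurable
    have hc : ENNReal.ofReal ‖P.normalVec i‖⁻¹ ≠ 0 := by simpa using P.normalVec_ne_zero i
    rw [P.restrict_sector] at h1
    exact h1.mono_ac (Measure.AbsolutelyContinuous.smul_right Measure.AbsolutelyContinuous.rfl hc)
  rw [P.restrict_sector, integral_smul_measure, integral_map hm.aemeasurable hae,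
    integral_prod_symm _ hint, ENNReal.toReal_ofReal (by positivity), smul_eq_mul]
  simp only [integral_radialMeasure, faceMeasure]

theorem ae_integrableOn_radial (i : Fin d) (hH : IntegrableOn H P.body) :
    ∀ᵐ y ∂P.faceMeasure i, IntegrableOn (fun s => s ^ (n - 1) * H (s • y)) (Ioc (0 : ℝ) 1) := by
  filter_upwards [(P.integrable_prod_of_integrableOn_body i hH).prod_left_ae] with y hy
  exact integrable_radialMeasure_iff.1 hy

theorem linearForm_smul (θ : Fin n → ℝ) (s : ℝ) (y : EuclideanSpace ℝ (Fin n)) :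
    linearForm θ (s • y) = s * linearForm θ y := by
  simp only [linearForm, PiLp.smul_apply, smul_eq_mul, Finset.mul_sum]
  exact Finset.sum_congr rfl fun j _ => by ring

theorem continuous_linearForm (θ : Fin n → ℝ) : Continuous (linearForm θ) := by
  unfold linearForm; fun_prop

theorem integrableOn_body_mul_continuous {u k : EuclideanSpace ℝ (Fin n) → ℝ}
    (hu : IntegrableOn u P.body) (hk : Continuous k) : IntegrableOn (fun x => k x * u x) P.body :=
  hu.continuousOn_mul hk.continuousOn P.isCompact_body

/-- The linear functional as an integral over the polytope, by integration along the rays. -/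
theorem linearPart_eq (θ : Fin n → ℝ) {u G : EuclideanSpace ℝ (Fin n) → ℝ}
    (hu : IntegrableOn u P.body)
    (hG : IntegrableOn (fun x => G x * Real.exp (linearForm θ x)) P.body)
    (hc : ∀ i, ∀ y ∈ P.face i, ContinuousOn (fun s : ℝ => u (s • y)) (Icc 0 1))
    (hd : ∀ i, ∀ y ∈ P.face i, ∀ s ∈ Ioo (0 : ℝ) 1,
      HasDerivAt (fun s : ℝ => u (s • y)) (G (s • y) / s) s)
    (hG0 : n = 0 → ∀ x, G x = 0) :
    P.linearPart θ u = ∫ x in P.body, G x * Real.exp (linearForm θ x) := by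
  -- In dimension zero n - 1 truncates to 0, but there are no facets and both sides vanish.
  rcases Nat.eq_zero_or_pos n with hn | hn
  · have he : IsEmpty (Fin d) := ⟨fun i => by have := P.dim_pos_of_facet i; omega⟩
    subst hn
    simp [linearPart, hG0, linearForm]
  have hk : Continuous fun x : EuclideanSpace ℝ (Fin n) =>
      (n + linearForm θ x) * Real.exp (linearForm θ x) :=
    (continuous_const.add (continuous_linearForm θ)).mul (continuous_linearForm θ).rexp
  have hI := P.integrableOn_body_mul_continuous hu hk
  have hH := hG.add hI
  have h1 := P.setIntegral_body hn hH
  have h2 : ∫ x in P.body, ((fun x => G x * Real.exp (linearForm θ x)) + fun x =>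
      (n + linearForm θ x) * Real.exp (linearForm θ x) * u x) x =
      (∫ x in P.body, G x * Real.exp (linearForm θ x)) +
      ∫ x in P.body, (n + linearForm θ x) * Real.exp (linearForm θ x) * u x :=
    integral_add hG hI
  have h3 : ∀ i, ‖P.normalVec i‖⁻¹ * ∫ y in P.face i, (∫ s in Ioc (0 : ℝ) 1, s ^ (n - 1) *
      ((fun x => G x * Real.exp (linearForm θ x)) + fun x =>
      (n + linearForm θ x) * Real.exp (linearForm θ x) * u x) (s • y)) ∂μHE[n - 1] =
      ∫ y in P.face i, u y * Real.exp (linearForm θ y) * inner ℝ (P.unitNormal i) y ∂μHE[n - 1] := by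
    intro i
    rw [← integral_const_mul]
    refine integral_congr_ae ?_
    have hface : ∀ᵐ y ∂P.faceMeasure i, y ∈ P.face i :=
      ae_restrict_mem (P.isClosed_face i).measurableSet
    filter_upwards [P.ae_integrableOn_radial i hH, hface] with y hy hyf
    -- The density ⟨ν, y⟩ of dσ is constant on the facet and equals the Jacobian 1/|ℓ_i| of the
    -- cone.
    have hinner : inner ℝ (P.unitNormal i) y = ‖P.normalVec i‖⁻¹ := by
      have : P.unitNormal i = ‖P.normalVec i‖⁻¹ • P.normalVec i := rfl
      rw [this, real_inner_smul_left, (P.mem_face_iff.1 hyf).2, mul_one]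
    -- The integrand along the ray is the derivative of sⁿ e^{sθ(y)} u(sy). The lower endpoint
    -- contributes nothing because n > 0.
    have hftc := intervalIntegral.integral_eq_sub_of_hasDerivAt_of_le (a := (0 : ℝ)) (b := 1)
      (f := fun s => s ^ n * Real.exp (s * linearForm θ y) * u (s • y))
      (f' := fun s => s ^ (n - 1) * ((fun x => G x * Real.exp (linearForm θ x)) + fun x =>
        (n + linearForm θ x) * Real.exp (linearForm θ x) * u x) (s • y)) zero_le_one
      (ContinuousOn.mul (by fun_prop) (hc i y hyf)) (fun s hs => by
        have e1 : HasDerivAt (fun s : ℝ => s ^ n) (n * s ^ (n - 1)) s := hasDerivAt_pow n s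
        have e2 : HasDerivAt (fun s : ℝ => Real.exp (s * linearForm θ y))
            (Real.exp (s * linearForm θ y) * linearForm θ y) s := by
          simpa using ((hasDerivAt_id s).mul_const (linearForm θ y)).exp
        refine ((e1.mul e2).mul (hd i y hyf s hs)).congr_deriv ?_
        simp only [Pi.add_apply, Pi.mul_apply, linearForm_smul]
        have hs0 : s ≠ 0 := hs.1.ne'
        obtain ⟨m, rfl⟩ : ∃ m, n = m + 1 := ⟨n - 1, by omega⟩
        simp only [Nat.add_sub_cancel]
        field_simp
        ring) ((intervalIntegrable_iff_integrableOn_Ioc_of_le zero_le_one).2 hy)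
    rw [intervalIntegral.integral_of_le zero_le_one] at hftc
    rw [hftc, hinner]
    simp only [one_pow, one_mul, one_smul, zero_pow hn.ne', zero_mul, sub_zero]
    ring
  rw [h2, Finset.sum_congr rfl fun i _ => h3 i] at h1
  rw [linearPart]
  linarith

end FanoPolytope

/-! ## Legendre duality for potentials of a convex body -/

namespace ConvexDuality

open Set Filter Topology

set_option linter.unusedSectionVars false

variable {E : Type*} [NormedAddCommGroup E] [InnerProductSpace ℝ E] [FiniteDimensional ℝ E]

/-- The vector representing a linear form. -/
def dualVec (E : Type*) [NormedAddCommGroup E] [InnerProductSpace ℝ E] [FiniteDimensional ℝ E] :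
    (E →L[ℝ] ℝ) →L[ℝ] E :=
  ∑ j, (ContinuousLinearMap.apply ℝ ℝ (stdOrthonormalBasis ℝ E j)).smulRight
    (stdOrthonormalBasis ℝ E j)

theorem inner_dualVec (L : E →L[ℝ] ℝ) (w : E) : inner ℝ (dualVec E L) w = L w := by
  have h : dualVec E L = ∑ j, L (stdOrthonormalBasis ℝ E j) • stdOrthonormalBasis ℝ E j := by
    simp [dualVec]
  conv_rhs => rw [← (stdOrthonormalBasis ℝ E).sum_repr' w]
  rw [h, sum_inner, map_sum]
  refine Finset.sum_congr rfl fun j _ => ?_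
  rw [real_inner_smul_left, map_smul, smul_eq_mul, mul_comm]

theorem dualVec_inner (x : E) : dualVec E (innerSL ℝ x) = x :=
  ext_inner_right ℝ fun w => by rw [inner_dualVec, innerSL_apply_apply]

/-- The gradient map. -/
def gradMap (F : E → ℝ) (ξ : E) : E := dualVec E (fderiv ℝ F ξ)

/-- The derivative of the gradient map. -/
def hessMap (F : E → ℝ) (ξ : E) : E →L[ℝ] E := (dualVec E).comp (fderiv ℝ (fderiv ℝ F) ξ)

theorem inner_gradMap (F : E → ℝ) (ξ w : E) : inner ℝ (gradMap F ξ) w = fderiv ℝ F ξ w :=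
  inner_dualVec _ _

theorem inner_hessMap (F : E → ℝ) (ξ v w : E) :
    inner ℝ (hessMap F ξ v) w = fderiv ℝ (fderiv ℝ F) ξ v w :=
  inner_dualVec _ _

/-- The Legendre transform. -/
def legendre (F : E → ℝ) (x : E) : ℝ := ⨆ ξ : E, (inner ℝ ξ x - F ξ)

/-- A smooth function with positive Hessian at bounded distance from the support function of `K`. -/
structure IsPotential (K : Set E) (F : E → ℝ) : Prop where
  smooth : ContDiff ℝ (⊤ : ℕ∞) F
  hess_pos : ∀ ξ v : E, v ≠ 0 → 0 < fderiv ℝ (fderiv ℝ F) ξ v v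
  exists_bound : ∃ C, ∀ ξ : E, (∀ x ∈ K, inner ℝ ξ x - C ≤ F ξ) ∧ ∃ x ∈ K, F ξ ≤ inner ℝ ξ x + C

namespace IsPotential

variable {K : Set E} {F : E → ℝ} (hF : IsPotential K F)
include hF

theorem differentiable : Differentiable ℝ F := hF.smooth.differentiable (by simp)

theorem smooth_fderiv : ContDiff ℝ (⊤ : ℕ∞) (fderiv ℝ F) := hF.smooth.fderiv_right (by simp)

theorem hasStrictFDerivAt_gradMap (ξ : E) : HasStrictFDerivAt (gradMap F) (hessMap F ξ) ξ :=
  (dualVec E).hasStrictFDerivAt.comp ξ (hF.smooth_fderiv.contDiffAt.hasStrictFDerivAt (by simp))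

/-- Along the segment the directional derivative is strictly increasing, and the mean value theorem
compares it with its value at the start. -/
theorem lt_of_ne {ξ η : E} (h : η ≠ ξ) : F ξ + inner ℝ (gradMap F ξ) (η - ξ) < F η := by
  set v := η - ξ with hv
  have hv0 : v ≠ 0 := sub_ne_zero.2 h
  have hline : ∀ t : ℝ, HasDerivAt (fun t : ℝ => ξ + t • v) v t := fun t => by
    simpa using ((hasDerivAt_id t).smul_const v).const_add ξ
  have h1 : ∀ t : ℝ, HasDerivAt (fun t : ℝ => F (ξ + t • v)) (fderiv ℝ F (ξ + t • v) v) t :=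
    fun t => (hF.differentiable _).hasFDerivAt.comp_hasDerivAt t (hline t)
  have h2 : ∀ t : ℝ, HasDerivAt (fun t : ℝ => fderiv ℝ F (ξ + t • v) v)
      (fderiv ℝ (fderiv ℝ F) (ξ + t • v) v v) t := fun t =>
    (((hF.smooth_fderiv.differentiable (by simp) _).hasFDerivAt.comp_hasDerivAt t (hline t))).clm_apply
      (hasDerivAt_const t v) |>.congr_deriv (by simp)
  have hmono : StrictMono fun t : ℝ => fderiv ℝ F (ξ + t • v) v :=
    strictMono_of_deriv_pos fun t => by rw [(h2 t).deriv]; exact hF.hess_pos _ _ hv0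
  obtain ⟨c, hc, hc'⟩ := exists_hasDerivAt_eq_slope (fun t : ℝ => F (ξ + t • v)) _ zero_lt_one
    (fun t _ => (h1 t).continuousAt.continuousWithinAt) fun t _ => h1 t
  have h3 := hmono hc.1
  simp only [zero_smul, add_zero, one_smul, sub_zero, div_one] at h3 hc'
  rw [hc', hv, add_sub_cancel] at h3
  rw [inner_gradMap]
  linarith

theorem le (ξ η : E) : F ξ + inner ℝ (gradMap F ξ) (η - ξ) ≤ F η := by
  by_cases h : η = ξ
  · simp [h]
  · exact (hF.lt_of_ne h).le

theorem gradMap_injective : Function.Injective (gradMap F) := by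
  intro ξ η h
  by_contra hne
  have h1 := hF.lt_of_ne (Ne.symm hne)
  have h2 := hF.lt_of_ne hne
  rw [← h, ← neg_sub η ξ, inner_neg_right] at h2
  linarith

theorem bddAbove {x : E} (hx : x ∈ K) : BddAbove (range fun ξ : E => inner ℝ ξ x - F ξ) := by
  obtain ⟨C, hC⟩ := hF.exists_bound
  refine ⟨C, ?_⟩
  rintro _ ⟨ξ, rfl⟩
  have := (hC ξ).1 x hx
  simp only
  linarith

theorem le_legendre {x : E} (hx : x ∈ K) (ξ : E) : inner ℝ ξ x - F ξ ≤ legendre F x :=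
  le_ciSup (hF.bddAbove hx) ξ

theorem legendre_bound : ∃ C, ∀ x ∈ K, |legendre F x| ≤ C := by
  obtain ⟨C, hC⟩ := hF.exists_bound
  refine ⟨|C| + |F 0|, fun x hx => abs_le.2 ⟨?_, ?_⟩⟩
  · have := hF.le_legendre hx 0
    rw [inner_zero_left] at this
    linarith [neg_abs_le (F 0), le_abs_self (F 0), abs_nonneg C]
  · have : legendre F x ≤ C := ciSup_le fun ξ => by linarith [(hC ξ).1 x hx]
    linarith [le_abs_self C, abs_nonneg (F 0)]

/-- The tangent plane inequality says that the supremum is attained at ξ. -/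
theorem legendre_gradMap (ξ : E) :
    legendre F (gradMap F ξ) = inner ℝ ξ (gradMap F ξ) - F ξ := by
  have hle : ∀ η : E, inner ℝ η (gradMap F ξ) - F η ≤ inner ℝ ξ (gradMap F ξ) - F ξ := fun η => by
    have := hF.le ξ η
    rw [inner_sub_right, real_inner_comm η, real_inner_comm ξ] at this
    linarith
  exact le_antisymm (ciSup_le hle) (le_ciSup (f := fun η : E => inner ℝ η (gradMap F ξ) - F η)
    ⟨_, by rintro _ ⟨η, rfl⟩; exact hle η⟩ ξ)

/-- Separate a gradient outside K from K by a linear form. In that direction convexity makes F grow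
faster than the support function of K, contradicting the bounded distance. -/
theorem gradMap_mem (hK : Convex ℝ K) (hKc : IsClosed K) (ξ : E) : gradMap F ξ ∈ K := by
  by_contra hmem
  obtain ⟨L, c, hL, hc⟩ := geometric_hahn_banach_closed_point hK hKc hmem
  obtain ⟨C, hC⟩ := hF.exists_bound
  obtain ⟨R, hR⟩ : ∃ R, ∀ x ∈ K, inner ℝ ξ x ≤ R := ⟨F ξ + C, fun x hx => by
    linarith [(hC ξ).1 x hx]⟩
  have hδ : 0 < L (gradMap F ξ) - c := sub_pos.2 hc
  -- So far along the separating direction that the gap in slope exceeds R + C - F ξ.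
  set t := (|R + C - F ξ| + 1) / (L (gradMap F ξ) - c) with ht
  have ht0 : 0 < t := by positivity
  obtain ⟨x, hx, hx'⟩ := (hC (ξ + t • dualVec E L)).2
  have h1 := hF.le ξ (ξ + t • dualVec E L)
  rw [add_sub_cancel_left, inner_smul_right, real_inner_comm, inner_dualVec] at h1
  rw [inner_add_left, real_inner_smul_left, inner_dualVec] at hx'
  have h2 := hL x hx
  have h3 : t * (L (gradMap F ξ) - c) = |R + C - F ξ| + 1 := div_mul_cancel₀ _ hδ.ne'
  nlinarith [hR x hx, le_abs_self (R + C - F ξ), mul_lt_mul_of_pos_left h2 ht0]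

theorem hessMap_injective (ξ : E) : Function.Injective (hessMap F ξ) := by
  rw [injective_iff_map_eq_zero]
  intro v hv
  by_contra hne
  have := hF.hess_pos ξ v hne
  rw [← inner_hessMap, hv, inner_zero_left] at this
  exact lt_irrefl _ this

/-- The derivative of the gradient map as an equivalence. -/
def hessEquiv (ξ : E) : E ≃L[ℝ] E :=
  (LinearEquiv.ofInjectiveEndo (hessMap F ξ : E →ₗ[ℝ] E) (hF.hessMap_injective ξ)).toContinuousLinearEquiv

theorem coe_hessEquiv (ξ : E) : (hF.hessEquiv ξ : E →L[ℝ] E) = hessMap F ξ := by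
  ext v; rfl

theorem hasStrictFDerivAt_equiv (ξ : E) :
    HasStrictFDerivAt (gradMap F) (hF.hessEquiv ξ : E →L[ℝ] E) ξ := by
  rw [coe_hessEquiv]; exact hF.hasStrictFDerivAt_gradMap ξ

theorem isOpenMap_gradMap : IsOpenMap (gradMap F) :=
  have : CompleteSpace E := FiniteDimensional.complete ℝ E
  isOpenMap_of_hasStrictFDerivAt_equiv hF.hasStrictFDerivAt_equiv

/-- The gradient map is open by the inverse function theorem, so its range lies in the interior.
Conversely, for x interior, F - ⟨·, x⟩ grows at least linearly and has a minimum, where the gradient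
is x. -/
theorem range_gradMap (hK : Convex ℝ K) (hKc : IsClosed K) : range (gradMap F) = interior K := by
  refine Subset.antisymm (interior_maximal ?_ hF.isOpenMap_gradMap.isOpen_range) fun x hx => ?_
  · rintro _ ⟨ξ, rfl⟩; exact hF.gradMap_mem hK hKc ξ
  obtain ⟨ε, hε, hball⟩ := Metric.nhds_basis_closedBall.mem_iff.1 (mem_interior_iff_mem_nhds.1 hx)
  obtain ⟨C, hC⟩ := hF.exists_bound
  have hlow : ∀ ξ : E, ε * ‖ξ‖ - C ≤ F ξ - inner ℝ ξ x := by
    intro ξ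
    by_cases h0 : ξ = 0
    · have := (hC ξ).1 x (interior_subset hx)
      subst h0
      simp only [norm_zero, mul_zero, inner_zero_left] at this ⊢
      linarith
    · have hn : ‖ξ‖ ≠ 0 := norm_ne_zero_iff.2 h0
      have h1 := (hC ξ).1 (x + (ε / ‖ξ‖) • ξ) (hball (by
        rw [mem_closedBall_iff_norm, add_sub_cancel_left, norm_smul, norm_div, norm_norm,
          div_mul_cancel₀ _ hn, Real.norm_of_nonneg hε.le]))
      rw [inner_add_right, inner_smul_right, real_inner_self_eq_norm_sq] at h1
      have h2 : ε / ‖ξ‖ * ‖ξ‖ ^ 2 = ε * ‖ξ‖ := by field_simp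
      linarith
  have hcont : Continuous fun ξ : E => F ξ - inner ℝ ξ x :=
    hF.smooth.continuous.sub (continuous_id.inner continuous_const)
  have htend : Tendsto (fun ξ : E => F ξ - inner ℝ ξ x) (cocompact E) atTop :=
    tendsto_atTop_mono hlow (tendsto_atTop_add_const_right _ _
      ((tendsto_norm_cocompact_atTop).const_mul_atTop hε))
  obtain ⟨ξ, hξ⟩ := hcont.exists_forall_le htend
  have hmin : IsLocalMin (fun ξ : E => F ξ - inner ℝ ξ x) ξ := Eventually.of_forall hξ
  have hd : HasFDerivAt (fun ξ : E => F ξ - inner ℝ ξ x) (fderiv ℝ F ξ - innerSL ℝ x) ξ := by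
    have h2 : HasFDerivAt (fun ξ : E => inner ℝ ξ x) (innerSL ℝ x) ξ := by
      simp only [fun ξ : E => real_inner_comm x ξ]
      exact (innerSL ℝ x).hasFDerivAt
    exact (hF.differentiable ξ).hasFDerivAt.sub h2
  have h3 := hmin.fderiv_eq_zero
  rw [hd.fderiv, sub_eq_zero] at h3
  exact ⟨ξ, by rw [gradMap, h3, dualVec_inner]⟩

/-- The gradient of the Legendre transform inverts the gradient map. -/
theorem hasFDerivAt_legendre (ξ : E) :
    HasFDerivAt (legendre F) (innerSL ℝ ξ) (gradMap F ξ) := by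
  have : CompleteSpace E := FiniteDimensional.complete ℝ E
  have hs := hF.hasStrictFDerivAt_equiv ξ
  set k := hs.localInverse (gradMap F) (hF.hessEquiv ξ) ξ with hk
  have hk1 : HasFDerivAt k ((hF.hessEquiv ξ).symm : E →L[ℝ] E) (gradMap F ξ) :=
    hs.to_localInverse.hasFDerivAt
  have hk2 : k (gradMap F ξ) = ξ := hs.localInverse_apply_image
  have hev : legendre F =ᶠ[𝓝 (gradMap F ξ)] fun y => inner ℝ (k y) y - F (k y) := by
    filter_upwards [hs.eventually_right_inverse] with y hy
    have := hF.legendre_gradMap (k y)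
    rwa [show gradMap F (k y) = y from hy] at this
  have hFk : HasFDerivAt (fun y => F (k y)) _ (gradMap F ξ) :=
    HasFDerivAt.comp (gradMap F ξ) (hF.differentiable _).hasFDerivAt hk1
  refine ((((hk1.inner ℝ (hasFDerivAt_id _))).sub hFk).congr_fderiv ?_).congr_of_eventuallyEq hev
  ext v
  rw [hk2]
  simp only [_root_.sub_apply, ContinuousLinearMap.comp_apply, ContinuousLinearMap.prod_apply,
    fderivInnerCLM_apply, innerSL_apply_apply, id, ContinuousLinearMap.id_apply]
  -- The derivative of the inverse map enters twice with opposite signs and drops out, since ξ is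
  -- critical for ⟨·, x⟩ - F.
  rw [← inner_gradMap, real_inner_comm (gradMap F ξ), add_sub_cancel_right]

theorem fderiv_fderiv_legendre (ξ v w : E) :
    fderiv ℝ (fun y => fderiv ℝ (legendre F) y w) (gradMap F ξ) v =
      inner ℝ ((hF.hessEquiv ξ).symm v) w := by
  have : CompleteSpace E := FiniteDimensional.complete ℝ E
  have hs := hF.hasStrictFDerivAt_equiv ξ
  set k := hs.localInverse (gradMap F) (hF.hessEquiv ξ) ξ with hk
  have hk1 : HasFDerivAt k ((hF.hessEquiv ξ).symm : E →L[ℝ] E) (gradMap F ξ) :=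
    hs.to_localInverse.hasFDerivAt
  have hev : (fun y => fderiv ℝ (legendre F) y w) =ᶠ[𝓝 (gradMap F ξ)] fun y => inner ℝ w (k y) := by
    filter_upwards [hs.eventually_right_inverse] with y hy
    have := (hF.hasFDerivAt_legendre (k y)).fderiv
    rw [show gradMap F (k y) = y from hy] at this
    rw [this, innerSL_apply_apply, real_inner_comm]
  have h2 : HasFDerivAt (fun y => inner ℝ w (k y)) _ (gradMap F ξ) :=
    (innerSL ℝ w).hasFDerivAt.comp (gradMap F ξ) hk1
  rw [hev.fderiv_eq, h2.fderiv, ContinuousLinearMap.comp_apply, innerSL_apply_apply,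
    real_inner_comm]
  rfl

/-! ### Measurability and substitution by the gradient map. -/

section Measure

variable [MeasurableSpace E] [BorelSpace E] {μ : Measure E}

/-- A supremum of continuous functions is lower semicontinuous where it is bounded, and boundedness
is known only on K; hence the passage to the subtype. -/
theorem aemeasurable_legendre {s : Set E} (hs : MeasurableSet s) (hsK : s ⊆ K) :
    AEMeasurable (legendre F) (μ.restrict s) := by
  refine aemeasurable_restrict_of_measurable_subtype hs ?_
  refine LowerSemicontinuous.measurable ?_
  refine lowerSemicontinuous_ciSup (fun x => hF.bddAbove (hsK x.2)) fun ξ => ?_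
  refine Continuous.lowerSemicontinuous ?_
  exact (continuous_const.inner continuous_subtype_val).sub continuous_const

theorem integrableOn_legendre {s : Set E} (hs : MeasurableSet s) (hsK : s ⊆ K) (hμ : μ s < ⊤) :
    IntegrableOn (legendre F) s μ := by
  obtain ⟨C, hC⟩ := hF.legendre_bound
  exact IntegrableOn.of_bound hμ (hF.aemeasurable_legendre hs hsK).aestronglyMeasurable C
    ((ae_restrict_iff' hs).2 (Eventually.of_forall fun x hx => hC x (hsK hx)))

variable [μ.IsAddHaarMeasure] (hK : Convex ℝ K) (hKc : IsClosed K)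
include hK hKc

/-- The frontier of a convex set is null, so the interior, which is the range of the injective
gradient map, carries the whole integral. -/
theorem setIntegral_eq (H : E → ℝ) :
    ∫ x in K, H x ∂μ = ∫ ξ, |(hessMap F ξ).det| * H (gradMap F ξ) ∂μ := by
  have h1 : K =ᵐ[μ] interior K := by
    refine (ae_eq_set.2 ⟨measure_mono_null ?_ (hK.addHaar_frontier μ), ?_⟩)
    · rw [hKc.frontier_eq]
    · rw [sdiff_eq_empty.2 interior_subset, measure_empty]
  have h2 := integral_image_eq_integral_abs_det_fderiv_smul μ MeasurableSet.univ
    (fun ξ _ => (hF.hasStrictFDerivAt_gradMap ξ).hasFDerivAt.hasFDerivWithinAt)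
    hF.gradMap_injective.injOn H
  rw [setIntegral_congr_set h1, ← hF.range_gradMap hK hKc, ← image_univ, h2, setIntegral_univ]
  rfl

theorem integrableOn_iff (H : E → ℝ) :
    IntegrableOn H K μ ↔ Integrable (fun ξ => |(hessMap F ξ).det| * H (gradMap F ξ)) μ := by
  have h1 : K =ᵐ[μ] interior K := by
    refine (ae_eq_set.2 ⟨measure_mono_null ?_ (hK.addHaar_frontier μ), ?_⟩)
    · rw [hKc.frontier_eq]
    · rw [sdiff_eq_empty.2 interior_subset, measure_empty]
  have h2 := integrableOn_image_iff_integrableOn_abs_det_fderiv_smul μ MeasurableSet.univ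
    (fun ξ _ => (hF.hasStrictFDerivAt_gradMap ξ).hasFDerivAt.hasFDerivWithinAt)
    hF.gradMap_injective.injOn H
  rw [integrableOn_congr_set_ae h1, ← hF.range_gradMap hK hKc, ← image_univ, h2, integrableOn_univ]
  rfl

end Measure

/-! ### The Legendre transform along rays from an interior point. -/

section Ray

variable (hK : Convex ℝ K) (hKc : IsClosed K) (h0 : (0 : E) ∈ interior K)
include hK hKc h0

/-- For s < 1 the point sy is a convex combination with positive weight on the interior point 0,
hence interior itself, and there the transform is differentiable. -/
theorem hasDerivAt_ray {y : E} (hy : y ∈ K) {s : ℝ} (hs : s ∈ Ico (0 : ℝ) 1) :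
    HasDerivAt (fun s : ℝ => legendre F (s • y)) (fderiv ℝ (legendre F) (s • y) y) s := by
  have hmem : s • y ∈ interior K := by
    have h := hK.combo_interior_closure_mem_interior h0 (subset_closure hy) (a := 1 - s) (b := s)
      (by linarith [hs.2]) hs.1 (by ring)
    simpa using h
  rw [← hF.range_gradMap hK hKc] at hmem
  obtain ⟨ξ, hξ⟩ := hmem
  have h1 := hF.hasFDerivAt_legendre ξ
  rw [hξ] at h1
  have h2 : HasDerivAt (fun s : ℝ => s • y) y s := by
    simpa using (hasDerivAt_id s).smul_const y
  have h3 := h1.comp_hasDerivAt s h2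
  rw [h1.fderiv]
  exact h3

/-- Only s = 1 needs care. Lower semicontinuity comes from the supremum, upper semicontinuity from
convexity between 0 and y. -/
theorem continuousOn_ray {y : E} (hy : y ∈ K) :
    ContinuousOn (fun s : ℝ => legendre F (s • y)) (Icc 0 1) := by
  intro s hs
  rcases hs.2.lt_or_eq with h | h
  · exact (hF.hasDerivAt_ray hK hKc h0 hy ⟨hs.1, h⟩).continuousAt.continuousWithinAt
  subst h
  have hmem : ∀ s ∈ Icc (0 : ℝ) 1, s • y ∈ K := fun s hs => by
    have h := hK (interior_subset h0) hy (a := 1 - s) (b := s) (by linarith [hs.2]) hs.1 (by ring)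
    simpa using h
  have hupper : ∀ s ∈ Icc (0 : ℝ) 1,
      legendre F (s • y) ≤ (1 - s) * legendre F 0 + s * legendre F y := fun s hs => by
    refine ciSup_le fun ξ => ?_
    have e1 := hF.le_legendre (interior_subset h0) ξ
    have e2 := hF.le_legendre hy ξ
    rw [inner_zero_right] at e1
    rw [inner_smul_right]
    nlinarith [hs.1, hs.2, mul_le_mul_of_nonneg_left e1 (sub_nonneg.2 hs.2),
      mul_le_mul_of_nonneg_left e2 hs.1]
  rw [ContinuousWithinAt, one_smul]
  refine tendsto_order.2 ⟨fun a ha => ?_, fun a ha => ?_⟩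
  · obtain ⟨ξ, hξ⟩ := exists_lt_of_lt_ciSup ha
    have hc : Tendsto (fun s : ℝ => inner ℝ ξ (s • y) - F ξ) (𝓝[Icc 0 1] 1)
        (𝓝 (inner ℝ ξ y - F ξ)) := by
      have : Continuous fun s : ℝ => inner ℝ ξ (s • y) - F ξ := by fun_prop
      have h2 := this.continuousWithinAt (s := Icc 0 1) (x := 1)
      rwa [ContinuousWithinAt, one_smul] at h2
    filter_upwards [(tendsto_order.1 hc).1 a hξ, self_mem_nhdsWithin] with s h1 h2
    exact h1.trans_le (hF.le_legendre (hmem s h2) ξ)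
  · have hc : Tendsto (fun s : ℝ => (1 - s) * legendre F 0 + s * legendre F y) (𝓝[Icc 0 1] 1)
        (𝓝 (legendre F y)) := by
      have : Continuous fun s : ℝ => (1 - s) * legendre F 0 + s * legendre F y := by fun_prop
      have h2 := this.continuousWithinAt (s := Icc 0 1) (x := 1)
      rw [ContinuousWithinAt] at h2
      simpa using h2
    filter_upwards [(tendsto_order.1 hc).2 a ha, self_mem_nhdsWithin] with s h1 h2
    exact (hupper s h2).trans_lt h1

end Ray

end IsPotential

end ConvexDuality

/-! ## The reduced functional -/

namespace FanoPolytope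

open ToricKahler SmoothCalculus ConvexDuality

variable {n d : ℕ} {P : FanoPolytope n d}

/-! ### Translation between Euclidean space and coordinate derivatives. -/

section Coordinates

variable {f : (Fin n → ℝ) → ℝ} (hf : Smooth f)
include hf

theorem fderiv_comp_ofLp (ξ v : EuclideanSpace ℝ (Fin n)) :
    fderiv ℝ (fun ξ : EuclideanSpace ℝ (Fin n) => f ξ.ofLp) ξ v =
      ∑ j, v j * dirDeriv (stdDir j) f ξ.ofLp := by
  have h : HasFDerivAt (fun ξ : EuclideanSpace ℝ (Fin n) => f ξ.ofLp) _ ξ :=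
    (hf.diff ξ.ofLp).hasFDerivAt.comp ξ
      (PiLp.continuousLinearEquiv 2 ℝ fun _ : Fin n => ℝ).toContinuousLinearMap.hasFDerivAt
  rw [h.fderiv, ContinuousLinearMap.comp_apply]
  have h2 : (PiLp.continuousLinearEquiv 2 ℝ fun _ : Fin n => ℝ).toContinuousLinearMap v =
      ∑ j, v j • (stdDir j : Fin n → ℝ) := by
    ext b
    simp [stdDir, Finset.sum_apply, Pi.single_apply]
  rw [h2, map_sum]
  simp only [map_smul, smul_eq_mul]
  rfl

theorem smooth_comp_ofLp :
    ContDiff ℝ (⊤ : ℕ∞) fun ξ : EuclideanSpace ℝ (Fin n) => f ξ.ofLp :=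
  hf.comp (PiLp.continuousLinearEquiv 2 ℝ fun _ : Fin n => ℝ).contDiff

theorem fderiv_fderiv_comp_ofLp (ξ v w : EuclideanSpace ℝ (Fin n)) :
    fderiv ℝ (fderiv ℝ fun ξ : EuclideanSpace ℝ (Fin n) => f ξ.ofLp) ξ v w =
      ∑ i, ∑ j, v i * hessMat stdDir f ξ.ofLp i j * w j := by
  have hs := smooth_comp_ofLp hf
  have hd : DifferentiableAt ℝ (fderiv ℝ fun ξ : EuclideanSpace ℝ (Fin n) => f ξ.ofLp) ξ :=
    (hs.fderiv_right (m := (⊤ : ℕ∞)) (by simp)).differentiable (by simp) ξ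
  have h1 : fderiv ℝ (fderiv ℝ fun ξ : EuclideanSpace ℝ (Fin n) => f ξ.ofLp) ξ v w =
      fderiv ℝ (fun y => fderiv ℝ (fun ξ : EuclideanSpace ℝ (Fin n) => f ξ.ofLp) y w) ξ v := by
    rw [fderiv_clm_apply hd (differentiableAt_const w)]
    simp
  have h2 : Smooth fun x : Fin n → ℝ => ∑ j, w j * dirDeriv (stdDir j) f x :=
    ContDiff.sum fun j _ => contDiff_const.mul (hf.dirDeriv _)
  rw [h1, show (fun y => fderiv ℝ (fun ξ : EuclideanSpace ℝ (Fin n) => f ξ.ofLp) y w) =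
    fun y : EuclideanSpace ℝ (Fin n) => (fun x : Fin n → ℝ => ∑ j, w j * dirDeriv (stdDir j) f x)
      y.ofLp from funext fun y => fderiv_comp_ofLp hf y w, fderiv_comp_ofLp h2]
  refine Finset.sum_congr rfl fun i _ => ?_
  rw [dirDeriv_sum _ fun j => contDiff_const.mul (hf.dirDeriv _), Finset.mul_sum]
  refine Finset.sum_congr rfl fun j _ => ?_
  rw [dirDeriv_const_mul (hf.dirDeriv _)]
  simp only [hessMat, Matrix.of_apply]
  ring

end Coordinates

theorem det_eq_det_of_inner {A : EuclideanSpace ℝ (Fin n) →L[ℝ] EuclideanSpace ℝ (Fin n)}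
    {M : Matrix (Fin n) (Fin n) ℝ}
    (h : ∀ i j, M i j = inner ℝ (A (EuclideanSpace.single i 1)) (EuclideanSpace.single j 1)) :
    M.det = A.det := by
  have h1 : LinearMap.toMatrix (EuclideanSpace.basisFun (Fin n) ℝ).toBasis
      (EuclideanSpace.basisFun (Fin n) ℝ).toBasis (A : _ →ₗ[ℝ] _) = M.transpose := by
    ext i j
    rw [LinearMap.toMatrix_apply, Matrix.transpose_apply, h, EuclideanSpace.inner_single_right]
    simp
  rw [← Matrix.det_transpose, ← h1, LinearMap.det_toMatrix]

theorem legendreDual_eq (f : EuclideanSpace ℝ (Fin n) → ℝ) : legendreDual f = legendre f := by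
  funext x
  simp only [legendreDual, legendre]
  congr 1
  funext ξ
  congr 1
  simp [PiLp.inner_apply, mul_comm]

variable (P) in
theorem zero_mem_interior_body : (0 : EuclideanSpace ℝ (Fin n)) ∈ interior P.body := by
  have ho : IsOpen (⋂ i, {x : EuclideanSpace ℝ (Fin n) | inner ℝ (P.normalVec i) x < 1}) :=
    isOpen_iInter_of_finite fun i => isOpen_lt (by fun_prop) continuous_const
  refine interior_maximal (fun x hx => P.mem_body_iff.2 fun i => ?_) ho (by simp)
  exact (Set.mem_iInter.1 hx i : inner ℝ (P.normalVec i) x < 1).le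

theorem integral_comp_ofLp (H : (Fin n → ℝ) → ℝ) :
    ∫ ξ : EuclideanSpace ℝ (Fin n), H ξ.ofLp = ∫ ξ, H ξ :=
  (PiLp.volume_preserving_ofLp (Fin n)).integral_comp
    (MeasurableEquiv.toLp 2 (Fin n → ℝ)).symm.measurableEmbedding H

theorem integrable_comp_ofLp {H : (Fin n → ℝ) → ℝ} (hH : Integrable H) :
    Integrable fun ξ : EuclideanSpace ℝ (Fin n) => H ξ.ofLp :=
  (PiLp.volume_preserving_ofLp (Fin n)).integrable_comp_of_integrable hH

section

variable {g : P.KahlerMetric} {φ : P.Manifold → ℝ} (h : IsKahlerPotential g φ)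
include h

theorem exists_localPot_bound : ∃ K : ℝ, ∀ (v : P.Vertex) (ξ : Fin n → ℝ),
    (∀ a, P.edgeCoord v ξ a ≤ 0) → |localPot g φ v (expPoint (P.edgeCoord v ξ))| ≤ K := by
  have hfin : Fintype P.Vertex := Fintype.ofFinite _
  choose K hK using fun v => (isCompact_closedBall (0 : P.Active v → ℂ) 1).exists_bound_of_continuousOn
    (localPot_smooth g h.1 v).continuous.continuousOn
  refine ⟨∑ v, |K v|, fun v ξ hv => ?_⟩
  have hball : expPoint (P.edgeCoord v ξ) ∈ Metric.closedBall (0 : P.Active v → ℂ) 1 := by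
    rw [mem_closedBall_zero_iff, pi_norm_le_iff_of_nonneg zero_le_one]
    intro a
    simp only [expPoint, Complex.norm_real, Real.norm_eq_abs, Real.abs_exp, Real.exp_le_one_iff]
    linarith [hv a]
  exact (hK v _ hball).trans ((le_abs_self _).trans
    (Finset.single_le_sum (f := fun v => |K v|) (fun v _ => abs_nonneg _) (Finset.mem_univ v)))

/-- On the cone of a vertex v maximizing ξ, f differs from ⟨ξ, v⟩ by the local potential on the unit
polydisc, which is bounded. So f stays at bounded distance from the support function of P. -/
theorem isPotential_logPotential : IsPotential P.body (logPotential g φ) := by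
  have hf := torusPot_smooth g h
  refine ⟨smooth_comp_ofLp hf, fun ξ v hv => ?_, ?_⟩
  · have h1 := fderiv_fderiv_comp_ofLp hf ξ v v
    have hv' : v.ofLp ≠ 0 := fun h0 => hv (by ext j; simpa using congrFun h0 j)
    have h2 := (Matrix.posDef_iff_dotProduct_mulVec.1 (hessMat_torusPot_posDef g h ξ.ofLp)).2 hv'
    refine lt_of_lt_of_eq h2 (Eq.trans ?_ h1.symm)
    simp only [dotProduct, Matrix.mulVec, Finset.mul_sum, star_trivial, mul_assoc]
  · obtain ⟨K, hK⟩ := exists_localPot_bound h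
    refine ⟨K, fun ξ => ?_⟩
    obtain ⟨v, hv, hmax⟩ := P.exists_edgeCoord_nonpos ξ.ofLp
    have h1 : logPotential g φ ξ =
        localPot g φ v (expPoint (P.edgeCoord v ξ.ofLp)) + inner ℝ ξ v.1 := by
      have := torusPot_eq_localPot g φ v ξ.ofLp
      rw [P.sum_edgeCoord, sub_neg_eq_add] at this
      rw [show logPotential g φ ξ = torusPot g φ ξ.ofLp from rfl, this]
      simp [PiLp.inner_apply, mul_comm]
    have h2 := abs_le.1 (hK v ξ.ofLp hv)
    refine ⟨fun x hx => ?_, v.1, v.2.1, by linarith⟩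
    have h3 : inner ℝ ξ x ≤ inner ℝ ξ v.1 := by
      have := hmax x hx
      simpa [PiLp.inner_apply, mul_comm] using this
    linarith

theorem det_hessMap (ξ : EuclideanSpace ℝ (Fin n)) :
    (hessMap (logPotential g φ) ξ).det = (hessMat stdDir (torusPot g φ) ξ.ofLp).det := by
  refine (det_eq_det_of_inner fun i j => ?_).symm
  rw [inner_hessMap]
  have := fderiv_fderiv_comp_ofLp (torusPot_smooth g h) ξ (EuclideanSpace.single i 1)
    (EuclideanSpace.single j 1)
  refine Eq.trans ?_ this.symm
  simp

/-- At Df(ξ) the Hessian of the Legendre transform is the inverse of the Hessian of f. -/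
theorem det_realHessian (ξ : EuclideanSpace ℝ (Fin n)) :
    (realHessian (legendre (logPotential g φ)) (gradMap (logPotential g φ) ξ)).det =
      (hessMat stdDir (torusPot g φ) ξ.ofLp).det⁻¹ := by
  have hF := isPotential_logPotential h
  have h1 : (realHessian (legendre (logPotential g φ)) (gradMap (logPotential g φ) ξ)).det =
      ((hF.hessEquiv ξ).symm : EuclideanSpace ℝ (Fin n) →L[ℝ] EuclideanSpace ℝ (Fin n)).det :=
    det_eq_det_of_inner fun i j => hF.fderiv_fderiv_legendre ξ _ _
  have h2 : ((hF.hessEquiv ξ).symm : EuclideanSpace ℝ (Fin n) →L[ℝ] EuclideanSpace ℝ (Fin n)).det *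
      (hF.hessEquiv ξ : EuclideanSpace ℝ (Fin n) →L[ℝ] EuclideanSpace ℝ (Fin n)).det = 1 := by
    have h3 := LinearMap.det_comp
      (((hF.hessEquiv ξ).symm : EuclideanSpace ℝ (Fin n) →L[ℝ] EuclideanSpace ℝ (Fin n)) :
        EuclideanSpace ℝ (Fin n) →ₗ[ℝ] EuclideanSpace ℝ (Fin n))
      ((hF.hessEquiv ξ : EuclideanSpace ℝ (Fin n) →L[ℝ] EuclideanSpace ℝ (Fin n)) :
        EuclideanSpace ℝ (Fin n) →ₗ[ℝ] EuclideanSpace ℝ (Fin n))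
    refine h3.symm.trans ?_
    convert LinearMap.det_id (A := ℝ) (M := EuclideanSpace ℝ (Fin n)) using 2
    ext v
    simp
  rw [hF.coe_hessEquiv, det_hessMap h] at h2
  rw [h1]
  exact eq_inv_of_mul_eq_one_left h2

theorem gradMap_apply (ξ : EuclideanSpace ℝ (Fin n)) (j : Fin n) :
    gradMap (logPotential g φ) ξ j = dirDeriv (stdDir j) (torusPot g φ) ξ.ofLp := by
  have h1 := inner_gradMap (logPotential g φ) ξ (EuclideanSpace.single j 1)
  have h2 := fderiv_comp_ofLp (torusPot_smooth g h) ξ (EuclideanSpace.single j 1)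
  have h3 : fderiv ℝ (logPotential g φ) ξ (EuclideanSpace.single j 1) = _ := h2
  rw [h3] at h1
  rw [EuclideanSpace.inner_single_right] at h1
  simpa [Pi.single_apply] using h1

theorem linearForm_gradMap (θ : Fin n → ℝ) (ξ : EuclideanSpace ℝ (Fin n)) :
    linearForm θ (gradMap (logPotential g φ) ξ) = momentTheta stdDir θ (torusPot g φ) ξ.ofLp := by
  simp only [linearForm, momentTheta, gradMap_apply h]

theorem abs_det_mul_exp (θ : Fin n → ℝ) (ξ : EuclideanSpace ℝ (Fin n)) :
    |(hessMap (logPotential g φ) ξ).det| *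
      Real.exp (linearForm θ (gradMap (logPotential g φ) ξ)) =
      rho stdDir θ (torusPot g φ) ξ.ofLp := by
  have := det_torusPot_pos h ξ.ofLp
  rw [det_hessMap h, linearForm_gradMap h, abs_of_pos this, rho, Real.exp_add, logDet,
    Real.exp_log this]

theorem entropy_integrand (θ : Fin n → ℝ) (ξ : EuclideanSpace ℝ (Fin n)) :
    |(hessMap (logPotential g φ) ξ).det| *
      (Real.log (realHessian (legendre (logPotential g φ)) (gradMap (logPotential g φ) ξ)).det *
        Real.exp (linearForm θ (gradMap (logPotential g φ) ξ))) =
      -(logDet stdDir (torusPot g φ) ξ.ofLp * rho stdDir θ (torusPot g φ) ξ.ofLp) := by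
  rw [mul_left_comm, abs_det_mul_exp h, det_realHessian h, Real.log_inv, logDet, neg_mul]

/-- Since Du = ξ at x = Df(ξ), the radial derivative ⟨x, Du⟩ becomes ⟨ξ, Df⟩, the part of the
entropy density beyond log det D²f. -/
theorem euler_integrand (θ : Fin n → ℝ) (ξ : EuclideanSpace ℝ (Fin n)) :
    |(hessMap (logPotential g φ) ξ).det| *
      (fderiv ℝ (legendre (logPotential g φ)) (gradMap (logPotential g φ) ξ)
        (gradMap (logPotential g φ) ξ) *
        Real.exp (linearForm θ (gradMap (logPotential g φ) ξ))) =
      entropyDensity stdDir (torusPot g φ) (fun j ξ => ξ j) ξ.ofLp *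
        rho stdDir θ (torusPot g φ) ξ.ofLp -
      logDet stdDir (torusPot g φ) ξ.ofLp * rho stdDir θ (torusPot g φ) ξ.ofLp := by
  rw [mul_left_comm, abs_det_mul_exp h,
    ((isPotential_logPotential h).hasFDerivAt_legendre ξ).fderiv, innerSL_apply_apply,
    entropyDensity, ← sub_mul, add_sub_cancel_left]
  simp [PiLp.inner_apply, gradMap_apply h, mul_comm]

theorem integrableOn_log_det (θ : Fin n → ℝ) :
    IntegrableOn (fun x => Real.log (realHessian (legendre (logPotential g φ)) x).det *
      Real.exp (linearForm θ x)) P.body := by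
  rw [(isPotential_logPotential h).integrableOn_iff P.convex_body P.isClosed_body]
  simp only [entropy_integrand h]
  exact integrable_comp_ofLp (integrable_logDet h θ).neg

theorem integrableOn_euler (θ : Fin n → ℝ) :
    IntegrableOn (fun x => fderiv ℝ (legendre (logPotential g φ)) x x *
      Real.exp (linearForm θ x)) P.body := by
  rw [(isPotential_logPotential h).integrableOn_iff P.convex_body P.isClosed_body]
  simp only [euler_integrand h]
  exact integrable_comp_ofLp ((integrable_entropy h θ).sub (integrable_logDet h θ))

theorem integrableOn_body : IntegrableOn (legendre (logPotential g φ)) P.body :=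
  (isPotential_logPotential h).integrableOn_legendre P.measurableSet_body subset_rfl
    P.isCompact_body.measure_lt_top

theorem integrableOn_face (i : Fin d) :
    IntegrableOn (legendre (logPotential g φ)) (P.face i) μHE[n - 1] := by
  refine (isPotential_logPotential h).integrableOn_legendre (P.isClosed_face i).measurableSet
    (fun x hx => hx.1) ?_
  have := measure_lt_top (P.faceMeasure i) Set.univ
  rwa [faceMeasure, Measure.restrict_apply_univ] at this

/-- The reduced functional in logarithmic coordinates. -/
theorem reducedFunctional_eq (θ : Fin n → ℝ) :
    P.reducedFunctional θ (legendre (logPotential g φ)) = entropyIntegral θ (torusPot g φ) := by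
  have hF := isPotential_logPotential h
  have h0 := P.zero_mem_interior_body
  have hlin := P.linearPart_eq θ (integrableOn_body h) (integrableOn_euler h θ)
    (fun i y hy => hF.continuousOn_ray P.convex_body P.isClosed_body h0 hy.1)
    (fun i y hy s hs => by
      have h1 := hF.hasDerivAt_ray P.convex_body P.isClosed_body h0 hy.1 ⟨hs.1.le, hs.2⟩
      rwa [map_smul, smul_eq_mul, mul_div_cancel_left₀ _ hs.1.ne'])
    (fun hn x => by
      subst hn
      rw [Subsingleton.elim x 0, map_zero])
  rw [reducedFunctional, hlin, hF.setIntegral_eq P.convex_body P.isClosed_body,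
    hF.setIntegral_eq P.convex_body P.isClosed_body]
  simp only [entropy_integrand h, euler_integrand h]
  rw [integral_comp_ofLp (fun ξ => -(logDet stdDir (torusPot g φ) ξ *
      rho stdDir θ (torusPot g φ) ξ)), integral_comp_ofLp (fun ξ =>
      entropyDensity stdDir (torusPot g φ) (fun j ξ => ξ j) ξ * rho stdDir θ (torusPot g φ) ξ -
      logDet stdDir (torusPot g φ) ξ * rho stdDir θ (torusPot g φ) ξ), integral_neg,
    integral_sub (integrable_entropy h θ) (integrable_logDet h θ), entropyIntegral]
  ring

end

end FanoPolytope

/-! ### The K-energy formula. -/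

theorem mainTheorem7 {n d : ℕ} (P : FanoPolytope n d) (g : P.KahlerMetric) (θ : Fin n → ℝ) :
    ∃ C : ℝ, ∀ φ : P.Manifold → ℝ, FanoPolytope.IsKahlerPotential g φ →
      ∀ u : EuclideanSpace ℝ (Fin n) → ℝ,
        u = legendreDual (FanoPolytope.logPotential g φ) →
        IntegrableOn (fun x => Real.log (realHessian u x).det * Real.exp (linearForm θ x)) P.body ∧
        IntegrableOn u P.body ∧
        (∀ i, IntegrableOn u (P.face i) μHE[n - 1]) ∧
        ∀ path h Θ : ℝ → P.Manifold → ℝ,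
          FanoPolytope.IsPotentialPath g φ path →
          (∀ t ∈ Set.Icc (0 : ℝ) 1, FanoPolytope.IsRicciPotential g (path t) (h t)) →
          (∀ t ∈ Set.Icc (0 : ℝ) 1, FanoPolytope.IsFieldPotential g θ (path t) (h t) (Θ t)) →
          FanoPolytope.modifiedKEnergy g θ path h Θ =
            (((2 * Real.pi) ^ n / FanoPolytope.vol g * P.reducedFunctional θ u + C : ℝ) : ℂ) := by
  -- The constant is minus the normalized entropy functional at the base potential φ = 0.
  refine ⟨-((2 * Real.pi) ^ n / FanoPolytope.vol g *
    FanoPolytope.entropyIntegral θ (FanoPolytope.torusPot g 0)), fun φ hφ u hu => ?_⟩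
  rw [FanoPolytope.legendreDual_eq] at hu
  subst hu
  refine ⟨FanoPolytope.integrableOn_log_det hφ θ, FanoPolytope.integrableOn_body hφ,
    FanoPolytope.integrableOn_face hφ, fun path h Θ hpath hh hΘ => ?_⟩
  rw [FanoPolytope.modifiedKEnergy_eq hpath hh hΘ, FanoPolytope.reducedFunctional_eq hφ θ]
  congr 1
  ring

end
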